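/- Let $(M,\omega)$ be a connected symplectic manifold (without boundary) of dimension $2n$ with finite volume $\mathrm{Vol}(M)=\int_M\omega^n$ (for instance, a closed connected one). Hamiltonians $H\colon S^1\times M\to\mathbb{R}$ are smooth with compact support; $\langle H\rangle=\mathrm{Vol}(M)^{-1}\int_0^1\int_M H_t\,\omega^n\,dt$ is the mean value, and $H$ is normalized if $\langle H\rangle=0$. The Hamiltonian isotopy $\{\varphi_H^t\}$ is defined by $\varphi_H^0=\mathrm{id}$, $\frac{d}{dt}\varphi_H^t=X_{H_t}\circ\varphi_H^t$, where $\omega(X_{H_t},\cdot)=-dH_t$; put $\varphi_H=\varphi_H^1$. Let $\mathrm{Ham}(M)$ be the group of compactly supported Hamiltonian diffeomorphisms, $\pi\colon\widetilde{\mathrm{Ham}}(M)\to\mathrm{Ham}(M)$ its universal cover (Hamiltonian paths starting at the identity up to homotopy with fixed endpoints), and $\tilde\varphi_H\in\widetilde{\mathrm{Ham}}(M)$ the class of $\{\varphi_H^t\}_{0\le t\le 1}$. For an open set $U\subset M$, let $\mathcal{H}(U)$ be the set of Hamiltonians with compact support in $S^1\times U$, and $\mathrm{Ham}(U)=\{\varphi_F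 : F\in\mathcal{H}(U)\}$. A *subadditive invariant* is a function $c\colon\widetilde{\mathrm{Ham}}(M)\to\mathbb{R}$ with $c(\tilde\phi\tilde\psi)\le c(\tilde\phi)+c(\tilde\psi)$; put $\sigma_c(\tilde\phi)=\lim_{k\to\infty}c(\tilde\phi^k)/k$. It *descends asymptotically* to $\mathrm{Ham}(M)$ if $\sigma_c$ factors through $\pi$. A closed set $X\subset M$ is *$c$-superheavy* if $\inf_{S^1\times X}H\le\sigma_c(\tilde\varphi_H)\le\sup_{S^1\times X}H$ for every normalized Hamiltonian $H$. Let $N\ge 1$, and let $c_0,\dots,c_N$ be subadditive invariants descending asymptotically to $\mathrm{Ham}(M)$. Let $\mathcal{U}=\{U_\lambda\}_\lambda$ be an open cover of $M$ whose members satisfy the bounded spectrum condition with respect to every $c_i$, uniformly in $\lambda$: for each $i$ there is $K_i>0$ such that $c_i(\tilde\varphi_F)+\langle F\rangle\le K_i$ for all $\lambda$ and all $F\in\mathcal{H}(U_\lambda)$. (For a finite cover this says that each $U_\lambda$ satisfies the bounded spectrum condition.) Let $X_0,\dots,X_N$ be mutually disjoint compact subsets of $M$ such that each $X_i$ is $c_i$-superheavy.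 For $\phi\in\mathrm{Ham}(M)$ let $\|\phi\|_{\mathcal{U}}$ be the minimal number of factors in a decomposition of $\phi$ into a product of elements of $\bigcup_\lambda\mathrm{Ham}(U_\lambda)$ (with $\|\mathrm{id}\|_{\mathcal{U}}=0$), and let $\mathrm{osc}(r_1,\dots,r_N)=\max_{0\le i,j\le N}|r_i-r_j|$ with $r_0=0$. Then there exist an injective homomorphism $I\colon\mathbb{R}^N\to\mathrm{Ham}(M)$ and a constant $A>0$ such that, for all $r\in\mathbb{R}^N$, the norm $\|I(r)\|_{\mathcal{U}}$ is finite and $$A^{-1}\,\mathrm{osc}(r)\ \le\ \|I(r)\|_{\mathcal{U}}\ \le\ A\,(\mathrm{osc}(r)+1).$$ -/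

import Mathlib

open Set Filter Topology MeasureTheory
open scoped Manifold ContDiff

noncomputable section

namespace HamFrag

/-- The model space `ℝ²ⁿ`. -/
abbrev Model (n : ℕ) : Type := EuclideanSpace ℝ (Fin (2 * n))

section Symplectic

variable {n : ℕ} {M : Type*} [TopologicalSpace M] [ChartedSpace (Model n) M]

/-- For a field `Ω` of bilinear forms on `M`, the function `y ↦ Ω(u, v)` of the chart around `x₀`,
where the constant vectors `u, v` of the model space are regarded as vector fields on the domain of
the chart. -/
def localCoeff
    (Ω : ∀ x : M, TangentSpace (𝓡 (2 * n)) x →L[ℝ] TangentSpace (𝓡 (2 * n)) x →L[ℝ] ℝ)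
    (x₀ : M) (u v : Model n) (y : Model n) : ℝ :=
  Ω ((extChartAt (𝓡 (2 * n)) x₀).symm y)
    (mfderiv 𝓘(ℝ, Model n) (𝓡 (2 * n)) (extChartAt (𝓡 (2 * n)) x₀).symm y u)
    (mfderiv 𝓘(ℝ, Model n) (𝓡 (2 * n)) (extChartAt (𝓡 (2 * n)) x₀).symm y v)

end Symplectic

/-- A symplectic form on a manifold of dimension `2n`: a smooth, alternating, nondegenerate, closed
2-form. Closedness `dΩ = 0` is expressed in charts:
`∂_u Ω(v, w) + ∂_v Ω(w, u) + ∂_w Ω(u, v) = 0` for constant vectors `u, v, w`. -/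
structure SymplecticForm (n : ℕ) (M : Type*) [TopologicalSpace M] [ChartedSpace (Model n) M]
    [IsManifold (𝓡 (2 * n)) ∞ M] where
  toFun : ∀ x : M, TangentSpace (𝓡 (2 * n)) x →L[ℝ] TangentSpace (𝓡 (2 * n)) x →L[ℝ] ℝ
  contMDiff : ContMDiff (𝓡 (2 * n)) ((𝓡 (2 * n)).prod 𝓘(ℝ, Model n →L[ℝ] Model n →L[ℝ] ℝ)) ∞
    (fun x : M => Bundle.TotalSpace.mk' (Model n →L[ℝ] Model n →L[ℝ] ℝ)
      (E := fun x : M => TangentSpace (𝓡 (2 * n)) x →L[ℝ] TangentSpace (𝓡 (2 * n)) x →L[ℝ] ℝ)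
      x (toFun x))
  alternating : ∀ x v, toFun x v v = 0
  nondegenerate : ∀ x v, (∀ w, toFun x v w = 0) → v = 0
  closed : ∀ x₀ : M, ∀ y ∈ (extChartAt (𝓡 (2 * n)) x₀).target, ∀ u v w : Model n,
    fderiv ℝ (localCoeff toFun x₀ v w) y u + fderiv ℝ (localCoeff toFun x₀ w u) y v
      + fderiv ℝ (localCoeff toFun x₀ u v) y w = 0

variable {n : ℕ} {M : Type*} [TopologicalSpace M] [ChartedSpace (Model n) M]
  [IsManifold (𝓡 (2 * n)) ∞ M]

section Volume

variable [MeasurableSpace M]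

/-- The matrix `(Ω_ij)` of `Ω` in the chart around `x₀`. -/
def chartMatrix (Ω : SymplecticForm n M) (x₀ : M) (y : Model n) :
    Matrix (Fin (2 * n)) (Fin (2 * n)) ℝ :=
  Matrix.of fun i j => localCoeff Ω.toFun x₀ (EuclideanSpace.single i 1)
    (EuclideanSpace.single j 1) y

/-- The measure on the domain of the chart around `x₀` (extended by zero to `M`) given by the
volume form `Ωⁿ / n!`, whose density in the chart is the absolute value of the Pfaffian of
`(Ω_ij)`, that is, `√|det (Ω_ij)|`. -/
def chartVolume (Ω : SymplecticForm n M) (x₀ : M) : Measure M :=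
  Measure.map (extChartAt (𝓡 (2 * n)) x₀).symm
    ((volume.restrict (extChartAt (𝓡 (2 * n)) x₀).target).withDensity
      fun y => ENNReal.ofReal (Real.sqrt |(chartMatrix Ω x₀ y).det|))

/-- The measure on `M` given by the volume form `Ωⁿ / n!`. The measures `chartVolume Ω x₀` are its
restrictions to the domains of the charts, so that it is their least upper bound in the lattice of
measures. (The factor `1 / n!` is irrelevant for mean values.) -/
def liouville (Ω : SymplecticForm n M) : Measure M :=
  ⨆ x₀ : M, chartVolume Ω x₀

/-- The mean value `⟨H⟩ = Vol(M)⁻¹ ∫₀¹ ∫_M H_t Ωⁿ dt`. -/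
def meanValue (Ω : SymplecticForm n M) (H : ℝ → M → ℝ) : ℝ :=
  ((liouville Ω).real univ)⁻¹ * ∫ t in (0 : ℝ)..1, ∫ x, H t x ∂(liouville Ω)

end Volume

/-- Smooth time-dependent functions on `M`, supported in a compact subset of `U` (uniformly in
time). -/
def IsCptHamiltonian (n : ℕ) {M : Type*} [TopologicalSpace M] [ChartedSpace (Model n) M]
    (U : Set M) (H : ℝ → M → ℝ) : Prop :=
  ContMDiff (𝓘(ℝ, ℝ).prod (𝓡 (2 * n))) 𝓘(ℝ, ℝ) ∞ (fun p : ℝ × M => H p.1 p.2) ∧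
    ∃ C : Set M, IsCompact C ∧ C ⊆ U ∧ ∀ t, ∀ x ∉ C, H t x = 0

/-- The set `𝓗(U)` of Hamiltonians `S¹ × M → ℝ` with compact support in `S¹ × U`. Functions on
`S¹ × M`, where `S¹ = ℝ/ℤ`, are functions on `ℝ × M` that are 1-periodic in time. -/
def periodicHam (n : ℕ) {M : Type*} [TopologicalSpace M] [ChartedSpace (Model n) M]
    (U : Set M) : Set (ℝ → M → ℝ) :=
  {H | IsCptHamiltonian n U H ∧ ∀ t x, H (t + 1) x = H t x}

/-- `φ` is the Hamiltonian isotopy of `H`: `φ⁰ = id` and `dφᵗ/dt = X_{H_t} ∘ φᵗ`, where the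
Hamiltonian vector field is given by `Ω(X_{H_t}, ·) = -dH_t`. -/
def IsHamIsotopy (Ω : SymplecticForm n M) (H : ℝ → M → ℝ) (φ : ℝ → Equiv.Perm M) : Prop :=
  φ 0 = 1 ∧ ∀ t x, ∃ X : TangentSpace (𝓡 (2 * n)) (φ t x),
    (∀ w, Ω.toFun (φ t x) X w = -(mfderiv (𝓡 (2 * n)) 𝓘(ℝ, ℝ) (H t) (φ t x) w : ℝ)) ∧
    HasMFDerivAt 𝓘(ℝ, ℝ) (𝓡 (2 * n)) (fun s : ℝ => φ s x) t
      ((1 : ℝ →L[ℝ] ℝ).smulRight X)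

/-- The group, under pointwise composition, of Hamiltonian paths `{φᵗ}` of diffeomorphisms starting
at the identity. (The isotopies of compactly supported time-dependent Hamiltonians are closed under
products and inverses, so that the subgroup they generate consists of them only.) -/
def hamPath (Ω : SymplecticForm n M) : Subgroup (ℝ → Equiv.Perm M) :=
  Subgroup.closure {φ | ∃ H, IsCptHamiltonian n univ H ∧ IsHamIsotopy Ω H φ}

/-- The group `Ham(M)` of compactly supported Hamiltonian diffeomorphisms: the time-one maps of
Hamiltonian paths. -/
def Ham (Ω : SymplecticForm n M) : Subgroup (Equiv.Perm M) :=
  (hamPath Ω).map (Pi.evalMonoidHom (fun _ : ℝ => Equiv.Perm M) 1)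

/-- Evaluation at time one, `{φᵗ} ↦ φ¹`. -/
def hamPathEnd (Ω : SymplecticForm n M) : hamPath Ω →* Ham Ω :=
  (Pi.evalMonoidHom (fun _ : ℝ => Equiv.Perm M) 1).subgroupMap (hamPath Ω)

/-- Loops `{φᵗ}`, `0 ≤ t ≤ 1`, of Hamiltonian diffeomorphisms based at the identity that are
contractible: there is a smooth homotopy `Φ` with fixed endpoints from the constant loop to
`{φᵗ}` through Hamiltonian isotopies, which are generated by a smooth family `K` of Hamiltonians
with uniformly compact support. -/
def IsContractibleLoop (Ω : SymplecticForm n M) (φ : ℝ → Equiv.Perm M) : Prop :=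
  ∃ (K : ℝ → ℝ → M → ℝ) (Φ : ℝ → ℝ → Equiv.Perm M),
    ContMDiff (𝓘(ℝ, ℝ).prod (𝓘(ℝ, ℝ).prod (𝓡 (2 * n)))) 𝓘(ℝ, ℝ) ∞
      (fun p : ℝ × ℝ × M => K p.1 p.2.1 p.2.2) ∧
    (∃ C : Set M, IsCompact C ∧ ∀ s t, ∀ x ∉ C, K s t x = 0) ∧
    (∀ s ∈ Icc (0 : ℝ) 1, IsHamIsotopy Ω (K s) (Φ s)) ∧
    (∀ t ∈ Icc (0 : ℝ) 1, Φ 0 t = 1) ∧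
    (∀ t ∈ Icc (0 : ℝ) 1, Φ 1 t = φ t) ∧
    (∀ s ∈ Icc (0 : ℝ) 1, Φ s 1 = 1)

/-- The contractible loops form a normal subgroup of the group of Hamiltonian paths. -/
def contractibleLoops (Ω : SymplecticForm n M) : Subgroup (hamPath Ω) :=
  Subgroup.normalClosure {φ : hamPath Ω | IsContractibleLoop Ω φ}

/-- The universal cover of `Ham(M)`: Hamiltonian paths starting at the identity, up to homotopy
with fixed endpoints, that is, up to contractible loops, with pointwise composition. -/
def HamTilde (Ω : SymplecticForm n M) : Type _ :=
  hamPath Ω ⧸ contractibleLoops Ω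

instance (Ω : SymplecticForm n M) : (contractibleLoops Ω).Normal :=
  Subgroup.normalClosure_normal

instance (Ω : SymplecticForm n M) : Group (HamTilde Ω) :=
  inferInstanceAs (Group (hamPath Ω ⧸ contractibleLoops Ω))

theorem contractibleLoops_le_ker (Ω : SymplecticForm n M) :
    contractibleLoops Ω ≤ (hamPathEnd Ω).ker := by
  refine Subgroup.normalClosure_le_normal ?_
  rintro φ ⟨K, Φ, -, -, -, -, h1, h2⟩
  have h : (φ : ℝ → Equiv.Perm M) 1 = 1 := by
    rw [← h1 1 (by simp), h2 1 (by simp)]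
  exact MonoidHom.mem_ker.mpr (Subtype.ext h)

/-- The projection `π` from the universal cover to `Ham(M)`. -/
def proj (Ω : SymplecticForm n M) : HamTilde Ω →* Ham Ω :=
  QuotientGroup.lift (contractibleLoops Ω) (hamPathEnd Ω) (contractibleLoops_le_ker Ω)

/-- The element of the universal cover represented by the Hamiltonian isotopy `φ` of `H`. -/
def tildeOf (Ω : SymplecticForm n M) {U : Set M} {H : ℝ → M → ℝ} {φ : ℝ → Equiv.Perm M}
    (hH : H ∈ periodicHam n U) (hφ : IsHamIsotopy Ω H φ) : HamTilde Ω :=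
  QuotientGroup.mk (s := contractibleLoops Ω)
    (⟨φ, Subgroup.subset_closure ⟨H, ⟨hH.1.1, by
      obtain ⟨C, hC, -, h⟩ := hH.1.2
      exact ⟨C, hC, subset_univ _, h⟩⟩, hφ⟩⟩ : hamPath Ω)

/-- A subadditive invariant. -/
def IsSubadditiveInvariant (Ω : SymplecticForm n M) (c : HamTilde Ω → ℝ) : Prop :=
  ∀ g h, c (g * h) ≤ c g + c h

/-- `σ_c(g) = lim c(gᵏ) / k`. -/
def stab (Ω : SymplecticForm n M) (c : HamTilde Ω → ℝ) (g : HamTilde Ω) : ℝ :=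
  limUnder atTop fun k : ℕ => c (g ^ k) / k

/-- For a subadditive invariant the limit defining `σ_c` exists. -/
theorem tendsto_stab (Ω : SymplecticForm n M) {c : HamTilde Ω → ℝ}
    (hc : IsSubadditiveInvariant Ω c) (g : HamTilde Ω) :
    Tendsto (fun k : ℕ => c (g ^ k) / k) atTop (𝓝 (stab Ω c g)) := by
  have hs : Subadditive fun k : ℕ => c (g ^ k) := fun a b => by
    simpa only [pow_add] using hc (g ^ a) (g ^ b)
  have h1 : 0 ≤ c 1 := by
    have := hc 1 1
    rw [mul_one] at this
    linarith
  have hb : ∀ k : ℕ, -(k * |c g⁻¹|) ≤ c (g ^ k) := by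
    intro k
    induction k with
    | zero => simpa using h1
    | succ k ih =>
      have h2 := hc (g ^ (k + 1)) g⁻¹
      rw [pow_succ, mul_inv_cancel_right] at h2
      rw [pow_succ]
      push_cast
      linarith [le_abs_self (c g⁻¹)]
  refine tendsto_nhds_limUnder ⟨hs.lim, hs.tendsto_lim ⟨-|c g⁻¹|, ?_⟩⟩
  rintro _ ⟨k, rfl⟩
  rcases Nat.eq_zero_or_pos k with rfl | hk
  · simp
  · have hk' : (0 : ℝ) < k := by exact_mod_cast hk
    show -|c g⁻¹| ≤ c (g ^ k) / k
    rw [le_div_iff₀ hk']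
    linarith [hb k]

/-- `c` descends asymptotically to `Ham(M)`: `σ_c` factors through `π`. -/
def DescendsAsymptotically (Ω : SymplecticForm n M) (c : HamTilde Ω → ℝ) : Prop :=
  ∃ s : Ham Ω → ℝ, ∀ g, stab Ω c g = s (proj Ω g)

section

variable [MeasurableSpace M]

/-- `X` is `c`-superheavy: `inf_{S¹ × X} H ≤ σ_c(φ̃_H) ≤ sup_{S¹ × X} H` for every normalized
Hamiltonian `H`. (The infimum and the supremum are extended real numbers.) -/
def IsSuperheavy (Ω : SymplecticForm n M) (c : HamTilde Ω → ℝ) (X : Set M) : Prop :=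
  IsClosed X ∧ ∀ (H : ℝ → M → ℝ) (φ : ℝ → Equiv.Perm M) (hH : H ∈ periodicHam n univ)
    (hφ : IsHamIsotopy Ω H φ), meanValue Ω H = 0 →
      (⨅ (t : ℝ), ⨅ x ∈ X, (H t x : EReal)) ≤ (stab Ω c (tildeOf Ω hH hφ) : EReal) ∧
      (stab Ω c (tildeOf Ω hH hφ) : EReal) ≤ ⨆ (t : ℝ), ⨆ x ∈ X, (H t x : EReal)

/-- `U` satisfies the bounded spectrum condition with respect to `c`, with the constant `K`:
`c(φ̃_F) + ⟨F⟩ ≤ K` for all `F ∈ 𝓗(U)`. -/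
def BoundedSpectrumWith (Ω : SymplecticForm n M) (c : HamTilde Ω → ℝ) (U : Set M) (K : ℝ) : Prop :=
  ∀ (F : ℝ → M → ℝ) (φ : ℝ → Equiv.Perm M) (hF : F ∈ periodicHam n U)
    (hφ : IsHamIsotopy Ω F φ), c (tildeOf Ω hF hφ) + meanValue Ω F ≤ K

end

/-- `Ham(U)`, for `U` an open subset of `M`: the time-one maps of Hamiltonians in `𝓗(U)`. -/
def hamOn (Ω : SymplecticForm n M) (U : Set M) : Set (Equiv.Perm M) :=
  {θ | ∃ F ∈ periodicHam n U, ∃ φ : ℝ → Equiv.Perm M, IsHamIsotopy Ω F φ ∧ φ 1 = θ}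

/-- The fragmentation norm with respect to the family `U`: the minimal number of factors in a
decomposition into elements of the sets `Ham(U_l)` (it is `0` for the identity, the empty product,
and `⊤` if there is no decomposition). -/
def fragNorm (Ω : SymplecticForm n M) {Λ : Type*} (U : Λ → Set M) (θ : Ham Ω) : ℕ∞ :=
  sInf {m : ℕ∞ | ∃ L : List (Equiv.Perm M),
    (∀ ψ ∈ L, ∃ l, ψ ∈ hamOn Ω (U l)) ∧ L.prod = θ ∧ (L.length : ℕ∞) = m}

/-- The oscillation norm on `ℝᴺ`: `max |r_i - r_j|` over `0 ≤ i, j ≤ N`, with `r_0 = 0`. -/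
def osc {N : ℕ} (r : Fin N → ℝ) : ℝ :=
  ⨆ p : Fin (N + 1) × Fin (N + 1),
    |(Fin.cons 0 r : Fin (N + 1) → ℝ) p.1 - (Fin.cons 0 r : Fin (N + 1) → ℝ) p.2|

end HamFrag

end

/-! Choose a compactly supported smooth `f` equal to `j` on `X_j`. Since `f` is constant along its
own flow, the flow of `g ∘ f` is the flow of `f` run at speed `g' (f x)`, and all these flows
commute. So polynomials `p_i` with `p_i(0) = 0` (which keeps supports compact) give a homomorphism
`shearHom`, taking `r` to the time-one map of `∑ r_i p_i ∘ f`. In `exists_dual_polynomials` the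
`p_i` are made dual to the nodes `0, …, N` and such that `p_i ∘ f` has mean zero: a Lagrange basis
polynomial is corrected by a multiple of the squared nodal polynomial, whose integral is positive
because connectedness forces `f` to take values strictly between `0` and `1`. The Hamiltonian of `r`
is then normalized and equal to `r_j` on `X_j`, with `r_0 = 0`. Superheaviness forces `σ_{c_j} =
r_j`, and asymptotic descent makes this hold for every lift of the time-one map.

Lower bound (`exists_lifts_of_list`, `osc_le_of_prod_eq`): given a decomposition into `m` factors,
lift the product, and lift its inverse by time-reversed Hamiltonians. Subadditivity and the bounded
spectrum condition bound `σ_{c_i}` by `m K_i - a` on the first lift and `σ_{c_j}` by `m K_j + a` on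
the second, where `a` is a sum of mean values and does not depend on the invariant. Adding the two
gives `r_i - r_j ≤ m (K_i + K_j)`. The case `m = 0` is injectivity.

Upper bound (`exists_inv_mul_mem_hamOn`, `exists_isFragmented`, `exists_isFragmented_le_osc`): cut
an autonomous Hamiltonian by a partition of unity and add the pieces one at a time. If `φ` and `χ`
are the flows of `A` and `A + B`, then `φ_T⁻¹ χ_T` is generated by `T B ∘ φ_{Ts}`, which for small
`T` is still supported in the cover member containing the support of `B`. So for small times a fixed
number of factors suffices, and `I(r) = I(r / k)^k` with `k` of the order of `osc r + 1` gives
linear growth.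

The formula for `φ_T⁻¹ χ_T` requires smooth flows that preserve the symplectic form; the first half
of the file proves this, starting from ordinary differential equations. -/

/-! ### Smooth dependence of solutions of ordinary differential equations on initial values -/

section LocalFlow

universe u

/-- A two-sided Grönwall inequality. -/
theorem norm_le_gronwallBound_of_norm_deriv_le {E : Type*} [NormedAddCommGroup E]
    [NormedSpace ℝ E] {f f' : ℝ → E} {r δ K ε : ℝ}
    (hf : ∀ t, |t| < r → HasDerivAt f (f' t) t) (h0 : ‖f 0‖ ≤ δ)
    (bound : ∀ t, |t| < r → ‖f' t‖ ≤ K * ‖f t‖ + ε) {t : ℝ} (ht : |t| < r) :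
    ‖f t‖ ≤ gronwallBound δ K ε |t| := by
  have key : ∀ {g g' : ℝ → E}, (∀ t, |t| < r → HasDerivAt g (g' t) t) → ‖g 0‖ ≤ δ →
      (∀ t, |t| < r → ‖g' t‖ ≤ K * ‖g t‖ + ε) → ∀ t, 0 ≤ t → t < r →
      ‖g t‖ ≤ gronwallBound δ K ε t := by
    intro g g' hg hg0 hgb t ht0 htr
    have hmem : ∀ s ∈ Icc 0 t, |s| < r := fun s hs => by
      rw [abs_of_nonneg hs.1]
      exact hs.2.trans_lt htr
    have := norm_le_gronwallBound_of_norm_deriv_right_le (f := g) (f' := g') (a := 0) (b := t)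
      (fun s hs => (hg s (hmem s hs)).continuousAt.continuousWithinAt)
      (fun s hs => (hg s (hmem s (Ico_subset_Icc_self hs))).hasDerivWithinAt) hg0
      (fun s hs => hgb s (hmem s (Ico_subset_Icc_self hs))) t ⟨ht0, le_rfl⟩
    simpa using this
  rcases le_total 0 t with h | h
  · rw [abs_of_nonneg h] at ht ⊢
    exact key hf h0 bound t h ht
  · rw [abs_of_nonpos h] at ht ⊢
    have := key (g := fun s => f (-s)) (g' := fun s => -f' (-s))
      (fun s hs => by
        have h1 := (hf (-s) (by rwa [abs_neg])).scomp s (hasDerivAt_neg s)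
        simpa using! h1)
      (by simpa using h0)
      (fun s hs => by simpa using bound (-s) (by rwa [abs_neg])) (-t) (by linarith) ht
    simpa using this

/-- The solution of a variational equation is the derivative of the flow in the initial value. -/
theorem hasFDerivAt_of_variational {E : Type*} [NormedAddCommGroup E] [NormedSpace ℝ E]
    {v : E → E} {s : Set E} (hs : Convex ℝ s) {K K' : ℝ} (hK : 0 ≤ K)
    (hvd : ∀ x ∈ s, HasFDerivAt v (fderiv ℝ v x) x)
    (hv : ∀ x ∈ s, ‖fderiv ℝ v x‖ ≤ K)
    (hv' : ∀ x ∈ s, ∀ y ∈ s, ‖fderiv ℝ v x - fderiv ℝ v y‖ ≤ K' * ‖x - y‖) (hK' : 0 ≤ K')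
    {Φ : ℝ → E → E} {L : ℝ → E →L[ℝ] E} {r : ℝ} {x : E} (hL0 : L 0 = ContinuousLinearMap.id ℝ E)
    (hΦ0 : ∀ᶠ y in 𝓝 x, Φ 0 y = y)
    (hΦ : ∀ᶠ y in 𝓝 x, ∀ t, |t| < r → Φ t y ∈ s ∧ HasDerivAt (Φ · y) (v (Φ t y)) t)
    (hL : ∀ t, |t| < r → HasDerivAt L (fderiv ℝ v (Φ t x) ∘L L t) t)
    {t : ℝ} (ht : |t| < r) :
    HasFDerivAt (Φ t) (L t) x := by
  have hx0 := hΦ0.self_of_nhds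
  have hx := hΦ.self_of_nhds
  have hlip : ∀ a ∈ s, ∀ b ∈ s, ‖v b - v a‖ ≤ K * ‖b - a‖ := fun a ha b hb =>
    hs.norm_image_sub_le_of_norm_hasFDerivWithin_le
      (fun y hy => (hvd y hy).hasFDerivWithinAt) hv ha hb
  have hquad : ∀ a ∈ s, ∀ b ∈ s, ‖v b - v a - fderiv ℝ v a (b - a)‖ ≤ K' * ‖b - a‖ ^ 2 := by
    intro a ha b hb
    have hseg : segment ℝ a b ⊆ s := hs.segment_subset ha hb
    have := (convex_segment a b).norm_image_sub_le_of_norm_hasFDerivWithin_le'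
      (f := v) (f' := fderiv ℝ v) (φ := fderiv ℝ v a) (C := K' * ‖b - a‖)
      (fun y hy => (hvd y (hseg hy)).hasFDerivWithinAt)
      (fun y hy => (hv' y (hseg hy) a ha).trans (by
        gcongr
        obtain ⟨p, q, hp, hq, hpq, rfl⟩ := hy
        have : p • a + q • b - a = q • (b - a) := by
          rw [← eq_sub_iff_add_eq] at hpq
          rw [hpq]; module
        rw [this, norm_smul, Real.norm_of_nonneg hq]
        exact mul_le_of_le_one_left (norm_nonneg _) (by linarith)))
      (left_mem_segment ℝ a b) (right_mem_segment ℝ a b)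
    rw [pow_two, ← mul_assoc]
    exact this
  have hr : 0 < r := (abs_nonneg t).trans_lt ht
  set C := Real.exp (K * r) with hC
  -- The flow is Lipschitz in the initial value, uniformly in time, by Grönwall with no
  -- inhomogeneous term.
  have hd : ∀ᶠ y in 𝓝 x, ∀ τ, |τ| < r → ‖Φ τ y - Φ τ x‖ ≤ C * ‖y - x‖ := by
    filter_upwards [hΦ0, hΦ] with y hy0 hy τ hτ
    have h1 := norm_le_gronwallBound_of_norm_deriv_le (f := fun τ => Φ τ y - Φ τ x)
      (f' := fun τ => v (Φ τ y) - v (Φ τ x)) (r := r) (δ := ‖y - x‖) (K := K) (ε := 0)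
      (fun τ hτ => (hy τ hτ).2.sub (hx τ hτ).2) (by rw [hy0, hx0])
      (fun τ hτ => by simpa using hlip _ (hx τ hτ).1 _ (hy τ hτ).1) hτ
    rw [gronwallBound_ε0, mul_comm] at h1
    refine h1.trans ?_
    rw [hC]
    gcongr
  set B := gronwallBound 0 K 1 r with hB
  have hgb : ∀ ε, gronwallBound 0 K ε r = ε * B := by
    intro ε
    rcases eq_or_ne K 0 with rfl | h
    · simp [hB, gronwallBound_K0]
    · simp only [hB, gronwallBound_of_K_ne_0 h]; ring
  -- The linearization error starts at zero and solves the variational equation up to the Taylor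
  -- remainder of `v`, which is quadratic in `‖y - x‖` by `hquad` and `hd`. Grönwall keeps it
  -- quadratic.
  have he : ∀ᶠ y in 𝓝 x, ‖Φ t y - Φ t x - L t (y - x)‖ ≤ K' * C ^ 2 * B * ‖y - x‖ ^ 2 := by
    filter_upwards [hΦ0, hΦ, hd] with y hy0 hy hdy
    have h1 := norm_le_gronwallBound_of_norm_deriv_le
      (f := fun τ => Φ τ y - Φ τ x - L τ (y - x))
      (f' := fun τ => v (Φ τ y) - v (Φ τ x) - fderiv ℝ v (Φ τ x) (L τ (y - x)))
      (r := r) (δ := 0) (K := K) (ε := K' * C ^ 2 * ‖y - x‖ ^ 2)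
      (fun τ hτ => ((hy τ hτ).2.sub (hx τ hτ).2).sub
        (((hL τ hτ).clm_apply (hasDerivAt_const τ (y - x))).congr_deriv (by simp)))
      (by simp [hy0, hx0, hL0])
      (fun τ hτ => by
        have e1 : v (Φ τ y) - v (Φ τ x) - fderiv ℝ v (Φ τ x) (L τ (y - x)) =
          (v (Φ τ y) - v (Φ τ x) - fderiv ℝ v (Φ τ x) (Φ τ y - Φ τ x)) +
          fderiv ℝ v (Φ τ x) (Φ τ y - Φ τ x - L τ (y - x)) := by
          simp only [map_sub]; abel
        have e2 := hquad _ (hx τ hτ).1 _ (hy τ hτ).1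
        have e3 : ‖fderiv ℝ v (Φ τ x) (Φ τ y - Φ τ x - L τ (y - x))‖ ≤
            K * ‖Φ τ y - Φ τ x - L τ (y - x)‖ :=
          ((fderiv ℝ v (Φ τ x)).le_opNorm _).trans
            (mul_le_mul_of_nonneg_right (hv _ (hx τ hτ).1) (norm_nonneg _))
        have e4 : K' * ‖Φ τ y - Φ τ x‖ ^ 2 ≤ K' * C ^ 2 * ‖y - x‖ ^ 2 := by
          rw [mul_assoc, ← mul_pow]
          gcongr
          exact hdy τ hτ
        rw [e1]
        linarith [norm_add_le (v (Φ τ y) - v (Φ τ x) - fderiv ℝ v (Φ τ x) (Φ τ y - Φ τ x))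
          (fderiv ℝ v (Φ τ x) (Φ τ y - Φ τ x - L τ (y - x)))])
      ht
    refine h1.trans (le_trans (gronwallBound_mono le_rfl (by positivity) hK ht.le) ?_)
    rw [hgb]
    exact le_of_eq (by ring)
  rw [hasFDerivAt_iff_isLittleO]
  have hbig : (fun y => Φ t y - Φ t x - L t (y - x)) =O[𝓝 x] fun y => ‖y - x‖ ^ 2 :=
    Asymptotics.IsBigO.of_bound _ (he.mono fun y hy => by simpa using hy)
  refine hbig.trans_isLittleO ?_
  have h2 : (fun y : E => ‖y - x‖ ^ 2) =o[𝓝 x] fun y => ‖y - x‖ ^ 1 := by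
    have h3 : Tendsto (fun y : E => ‖y - x‖) (𝓝 x) (𝓝 0) := by
      have : ContinuousAt (fun y : E => ‖y - x‖) x := by fun_prop
      simpa [ContinuousAt] using this
    exact (Asymptotics.isLittleO_pow_pow (𝕜 := ℝ) (m := 1) (n := 2) (by norm_num)).comp_tendsto h3
  simpa using h2.trans_isBigO (by simpa using (Asymptotics.isBigO_refl _ _).norm_left)

/-- A vector field of class `C^(k+1)` near a point has a local flow of class `C^k`. -/
theorem exists_contDiffAt_localFlow (k : ℕ) : ∀ {E : Type u} [NormedAddCommGroup E]
    [NormedSpace ℝ E] [CompleteSpace E] {v : E → E} {x₀ : E}, ContDiffAt ℝ (k + 1) v x₀ →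
    ∃ Φ : ℝ → E → E, ContDiffAt ℝ k ↿Φ ((0 : ℝ), x₀) ∧ (∀ᶠ x in 𝓝 x₀, Φ 0 x = x) ∧
      ∀ᶠ p : ℝ × E in 𝓝 ((0 : ℝ), x₀), HasDerivAt (Φ · p.2) (v (Φ p.1 p.2)) p.1 := by
  induction k with
  | zero =>
    intro E _ _ _ v x₀ hv
    obtain ⟨ε, hε, a, r, _, _, hr, hpl⟩ := IsPicardLindelof.of_contDiffAt_one (by simpa using hv)
    obtain ⟨α, hα, hαc⟩ := (hpl 0).exists_forall_mem_closedBall_eq_hasDerivWithinAt_continuousOn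
    have hI : Icc (0 - ε) (0 + ε) ∈ 𝓝 (0 : ℝ) := Icc_mem_nhds (by linarith) (by linarith)
    have hB : Metric.closedBall x₀ r ∈ 𝓝 x₀ := Metric.closedBall_mem_nhds _ hr
    refine ⟨fun t x => α (x, t), ?_, ?_, ?_⟩
    · rw [Nat.cast_zero, contDiffAt_zero]
      refine ⟨_, prod_mem_nhds hI hB, ?_⟩
      exact hαc.comp continuous_swap.continuousOn fun p hp => ⟨hp.2, hp.1⟩
    · filter_upwards [hB] with x hx using (hα x hx).1
    · filter_upwards [prod_mem_nhds (eventually_mem_nhds_iff.2 hI) hB] with p hp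
      exact ((hα p.2 hp.2).2 p.1 (mem_of_mem_nhds hp.1)).hasDerivAt hp.1
  | succ k ih =>
    intro E _ _ _ v x₀ hv
    set D := fderiv ℝ v with hD
    have hDc : ContDiffAt ℝ (k + 1) D x₀ := hv.fderiv_right (by push_cast; exact le_rfl)
    -- The induction hypothesis is applied on the larger space `E × (E →L[ℝ] E)` to the field
    -- coupled with its variational equation. That system has one derivative less than `v`; its flow
    -- is `C^k` and contains the candidate `L` for the space derivative of `Φ`.
    obtain ⟨Ψ, hΨc, hΨ0, hΨ⟩ := ih
      (v := fun p : E × (E →L[ℝ] E) => ((v p.1, D p.1 ∘L p.2) : E × (E →L[ℝ] E)))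
      (x₀ := (x₀, ContinuousLinearMap.id ℝ E))
      (((hv.of_le (by push_cast; exact le_self_add)).comp _ contDiffAt_fst).prodMk
        ((hDc.comp (x₀, ContinuousLinearMap.id ℝ E) contDiffAt_fst).clm_comp contDiffAt_snd))
    set Φ : ℝ → E → E := fun t x => (Ψ t (x, ContinuousLinearMap.id ℝ E)).1 with hΦdef
    set L : ℝ → E → E →L[ℝ] E := fun t x => (Ψ t (x, ContinuousLinearMap.id ℝ E)).2 with hLdef
    have hι : ∀ p, ContDiffAt ℝ k
        (fun p : ℝ × E => (p.1, (p.2, ContinuousLinearMap.id ℝ E))) p := fun p => by fun_prop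
    have hΨι : ContDiffAt ℝ k (fun p : ℝ × E => Ψ p.1 (p.2, ContinuousLinearMap.id ℝ E))
        (0, x₀) := ContDiffAt.comp (g := ↿Ψ) (0, x₀) hΨc (hι _)
    have hΦc : ContDiffAt ℝ k ↿Φ (0, x₀) := hΨι.fst
    have hLc : ContDiffAt ℝ k ↿L (0, x₀) := hΨι.snd
    have hΨ0' : ∀ᶠ x in 𝓝 x₀, Ψ 0 (x, ContinuousLinearMap.id ℝ E) =
        (x, ContinuousLinearMap.id ℝ E) := by
      have hc : ContinuousAt (fun x : E => (x, ContinuousLinearMap.id ℝ E)) x₀ := by fun_prop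
      exact hc.eventually hΨ0
    have hΦ0 : ∀ᶠ x in 𝓝 x₀, Φ 0 x = x := hΨ0'.mono fun x hx => by simp [hΦdef, hx]
    have hL0 : ∀ᶠ x in 𝓝 x₀, L 0 x = ContinuousLinearMap.id ℝ E :=
      hΨ0'.mono fun x hx => by simp [hLdef, hx]
    have hΨ' : ∀ᶠ p : ℝ × E in 𝓝 (0, x₀),
        HasDerivAt (Φ · p.2) (v (Φ p.1 p.2)) p.1 ∧
        HasDerivAt (L · p.2) (D (Φ p.1 p.2) ∘L L p.1 p.2) p.1 := by
      have hc : ContinuousAt (fun p : ℝ × E => (p.1, (p.2, ContinuousLinearMap.id ℝ E)))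
          (0, x₀) := by fun_prop
      filter_upwards [hc.eventually hΨ] with p hp
      exact ⟨hp.fst, hp.snd⟩
    obtain ⟨K', s₁, hs₁, hK'⟩ : ∃ K', ∃ s ∈ 𝓝 x₀, LipschitzOnWith K' D s :=
      (hDc.of_le (by exact_mod_cast le_add_self)).exists_lipschitzOnWith
    have hs₂ : ∀ᶠ x in 𝓝 x₀, ‖D x‖ < ‖D x₀‖ + 1 :=
      hDc.continuousAt.norm.eventually_lt continuousAt_const (by simp)
    have hs₃ : ∀ᶠ x in 𝓝 x₀, ContDiffAt ℝ (↑(k + 1) + 1) v x :=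
      hv.eventually (by exact_mod_cast ENat.natCast_ne_top _)
    obtain ⟨ρ, hρ, hball⟩ := Metric.eventually_nhds_iff_ball.1 ((hs₂.and hs₃).and hs₁)
    have hΦmem : ∀ᶠ p : ℝ × E in 𝓝 (0, x₀), Φ p.1 p.2 ∈ Metric.ball x₀ ρ := by
      refine hΦc.continuousAt.eventually_mem ?_
      have : ↿Φ (0, x₀) = x₀ := hΦ0.self_of_nhds
      rw [this]
      exact Metric.ball_mem_nhds _ hρ
    obtain ⟨T, hT, W, hW, hTW⟩ := mem_nhds_prod_iff.1 (hΨ'.and hΦmem)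
    obtain ⟨r, hr, hrT⟩ := Metric.mem_nhds_iff.1 hT
    have hmem : ∀ᶠ p : ℝ × E in 𝓝 (0, x₀), |p.1| < r ∧ ∀ᶠ x in 𝓝 p.2, x ∈ W ∧ Φ 0 x = x ∧
        L 0 x = ContinuousLinearMap.id ℝ E := by
      refine Filter.Eventually.and ?_ ?_
      · exact (continuousAt_fst (p := ((0 : ℝ), x₀))).abs.eventually_lt continuousAt_const
          (by simpa using hr)
      · exact (continuousAt_snd (p := ((0 : ℝ), x₀))).eventually
          (eventually_eventually_nhds.2 (Filter.Eventually.and hW (hΦ0.and hL0)))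
    have hderiv : ∀ᶠ p : ℝ × E in 𝓝 (0, x₀), HasFDerivAt (Φ p.1 ·) (↿L p) p.2 := by
      filter_upwards [hmem] with p ⟨hp1, hp2⟩
      have hT' : ∀ t : ℝ, |t| < r → t ∈ T := fun t ht => hrT (by simpa using ht)
      refine hasFDerivAt_of_variational (s := Metric.ball x₀ ρ) (convex_ball _ _)
        (K := ‖D x₀‖ + 1) (K' := K') (by positivity) (fun x hx => ?_)
        (fun x hx => (hball x hx).1.1.le) (fun x hx y hy => ?_) K'.2 (L := (L · p.2)) (r := r)
        hp2.self_of_nhds.2.2 (hp2.mono fun x hx => hx.2.1) (hp2.mono fun x hx t ht => ?_)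
        (fun t ht => ?_) hp1
      · exact ((hball x hx).1.2.differentiableAt (by simp)).hasFDerivAt
      · exact hK'.norm_sub_le (hball x hx).2 (hball y hy).2
      · have := hTW (mk_mem_prod (hT' t ht) hx.1)
        exact ⟨this.2, this.1.1⟩
      · exact (hTW (mk_mem_prod (hT' t ht) hp2.self_of_nhds.1)).1.2
    -- Both partial derivatives, `G` in time and `L` in space, are `C^k`, so `Φ` is `C^(k+1)`.
    set G : ℝ → E → ℝ →L[ℝ] E := fun t x => (1 : ℝ →L[ℝ] ℝ).smulRight (v (Φ t x)) with hG
    have hGc : ContDiffAt ℝ k ↿G (0, x₀) := by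
      have h1 : ContDiffAt ℝ k v (↿Φ (0, x₀)) := by
        have : ↿Φ (0, x₀) = x₀ := hΦ0.self_of_nhds
        rw [this]
        exact hv.of_le (by exact_mod_cast (by omega : k ≤ k + 1 + 1))
      exact contDiffAt_const.smulRight (h1.comp (0, x₀) hΦc)
    refine ⟨Φ, ?_, hΦ0, hΨ'.mono fun p hp => hp.1⟩
    rw [Nat.cast_succ, contDiffAt_succ_iff_hasFDerivAt]
    refine ⟨fun p => (↿G p).coprod (↿L p), ⟨_, ?_, fun p hp => hp⟩, ?_⟩
    · have hk : (k : WithTop ℕ∞) ≠ ∞ := by exact_mod_cast ENat.natCast_ne_top _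
      filter_upwards [eventually_eventually_nhds.2 hΨ', eventually_eventually_nhds.2 hderiv,
        hGc.eventually hk, hLc.eventually hk] with p h1 h2 h3 h4
      exact (hasStrictFDerivAt_uncurry_coprod (f₁ := G) (f₂ := L)
        (h1.mono fun q hq => hq.1.hasFDerivAt) h2 h3.continuousAt h4.continuousAt).hasFDerivAt
    · have : (fun p => (↿G p).coprod (↿L p)) = fun p => (↿G p) ∘L ContinuousLinearMap.fst ℝ ℝ E +
          (↿L p) ∘L ContinuousLinearMap.snd ℝ ℝ E := by
        ext <;> simp
      rw [this]
      exact (hGc.clm_comp contDiffAt_const).add (hLc.clm_comp contDiffAt_const)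

end LocalFlow

/-! ### The flow of a compactly supported vector field on a manifold -/

section ManifoldFlow

universe u

variable {E : Type u} [NormedAddCommGroup E] [NormedSpace ℝ E]
  {H : Type*} [TopologicalSpace H] {I : ModelWithCorners ℝ E H}
  {M : Type*} [TopologicalSpace M] [ChartedSpace H M] [IsManifold I ∞ M]
  [BoundarylessManifold I M] {v : (x : M) → TangentSpace I x}

/-- A smooth vector field on a manifold has local flows of every class `C^k`. -/
theorem exists_contMDiffAt_localFlow [CompleteSpace E]
    (hv : ContMDiff I I.tangent ∞ (fun x => (⟨x, v x⟩ : TangentBundle I M))) (k : ℕ) (x₀ : M) :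
    ∃ Φ : ℝ → M → M, ContMDiffAt (𝓘(ℝ, ℝ).prod I) I k ↿Φ ((0 : ℝ), x₀) ∧
      (∀ᶠ x in 𝓝 x₀, Φ 0 x = x) ∧
      ∀ᶠ p : ℝ × M in 𝓝 ((0 : ℝ), x₀), HasMFDerivAt 𝓘(ℝ, ℝ) I (Φ · p.2) p.1
        ((1 : ℝ →L[ℝ] ℝ).smulRight (v (Φ p.1 p.2))) := by
  have hv' := hv.contMDiffAt (x := x₀)
  rw [contMDiffAt_iff] at hv'
  have hx₀ : I.IsInteriorPoint x₀ := BoundarylessManifold.isInteriorPoint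
  have hvc := (hv'.2.contDiffAt (range_mem_nhds_isInteriorPoint hx₀)).snd
  obtain ⟨f, hfc, hf0, hf⟩ := exists_contDiffAt_localFlow k
    (hvc.of_le (m := k + 1) (by exact_mod_cast le_top))
  set e := extChartAt I x₀ with he
  have hec : ContMDiffAt I 𝓘(ℝ, E) k e x₀ := contMDiffAt_extChartAt.of_le le_rfl
  have hf00 : f 0 (e x₀) = e x₀ := hf0.self_of_nhds
  have hpair : ContMDiffAt (𝓘(ℝ, ℝ).prod I) (𝓘(ℝ, ℝ).prod 𝓘(ℝ, E)) k
      (fun p : ℝ × M => (p.1, e p.2)) (0, x₀) :=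
    contMDiffAt_fst.prodMk (hec.comp (0, x₀) contMDiffAt_snd)
  have hfe : ContMDiffAt (𝓘(ℝ, ℝ).prod I) 𝓘(ℝ, E) k (fun p : ℝ × M => f p.1 (e p.2)) (0, x₀) := by
    have h1 : ContMDiffAt 𝓘(ℝ, ℝ × E) 𝓘(ℝ, E) k ↿f ((0 : ℝ), e x₀) := hfc.contMDiffAt
    rw [modelWithCornersSelf_prod, ← chartedSpaceSelf_prod] at h1
    exact ContMDiffAt.comp (g := ↿f) (0, x₀) h1 hpair
  have htgt : e.target ∈ 𝓝 (e x₀) :=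
    mem_interior_iff_mem_nhds.1 (I.isInteriorPoint_iff.1 hx₀)
  have hmem : ∀ᶠ p : ℝ × M in 𝓝 ((0 : ℝ), x₀), f p.1 (e p.2) ∈ interior e.target := by
    refine hfe.continuousAt.eventually_mem ?_
    simp only [hf00]
    exact interior_mem_nhds.2 htgt
  refine ⟨fun t x => e.symm (f t (e x)), ?_, ?_, ?_⟩
  · have h1 : ContMDiffAt 𝓘(ℝ, E) I k e.symm (f 0 (e x₀)) := by
      rw [hf00]
      exact ((contMDiffOn_extChartAt_symm (n := ∞) x₀).contMDiffAt htgt).of_le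
        (by exact_mod_cast le_top)
    exact ContMDiffAt.comp (g := e.symm) (f := fun p : ℝ × M => f p.1 (e p.2)) (0, x₀) h1 hfe
  · filter_upwards [extChartAt_source_mem_nhds (I := I) x₀,
      (continuousAt_extChartAt x₀).eventually hf0] with x hx hx0
    rw [hx0, he, PartialEquiv.left_inv _ hx]
  · filter_upwards [hmem, hpair.continuousAt.eventually hf] with p hp1 hp2
    set c : ℝ → E := fun t => f t (e p.2) with hc
    set t := p.1
    let xₜ : M := e.symm (c t)
    have h : HasDerivAt c (x := t) <| fderivWithin ℝ (extChartAt I x₀ ∘ (extChartAt I xₜ).symm)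
      (range I) (extChartAt I xₜ xₜ) (v xₜ) := hp2
    rw [← tangentCoordChange_def] at h
    have hf3' : c t ∈ e.target := interior_subset hp1
    have hft1 : e.symm (c t) ∈ e.source := e.map_target hf3'
    have hft2 := mem_extChartAt_source (I := I) xₜ
    let w : E := v xₜ
    suffices hd : HasDerivAt ((extChartAt I xₜ ∘ e.symm) ∘ c) w t by
      refine ⟨(continuousAt_extChartAt_symm'' hf3').comp h.continuousAt, ?_⟩
      have hd' : HasFDerivAt ((extChartAt I xₜ ∘ e.symm) ∘ c) ((1 : ℝ →L[ℝ] ℝ).smulRight w) t :=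
        hd.hasFDerivAt.congr_fderiv (ContinuousLinearMap.ext_ring (by simp))
      exact hd'.hasFDerivWithinAt (s := range 𝓘(ℝ, ℝ))
    have hw : w = tangentCoordChange I x₀ xₜ xₜ (tangentCoordChange I xₜ x₀ xₜ w) := by
      rw [tangentCoordChange_comp (x := x₀) ⟨⟨hft2, hft1⟩, hft2⟩, tangentCoordChange_self hft2]
    rw [hw]
    apply HasFDerivAt.comp_hasDerivAt _ _ h
    apply HasFDerivWithinAt.hasFDerivAt (s := range I) _ <|
      mem_nhds_iff.mpr ⟨interior e.target,
        subset_trans interior_subset (extChartAt_target_subset_range ..), isOpen_interior, hp1⟩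
    change HasFDerivWithinAt _ _ _ (c t)
    rw [← e.right_inv hf3']
    exact hasFDerivWithinAt_tangentCoordChange ⟨hft1, hft2⟩

/-- A vector field vanishing outside a compact set has integral curves that are defined for all
times. -/
theorem exists_isMIntegralCurve_of_compactSupport [CompleteSpace E] [T2Space M]
    (hv : ContMDiff I I.tangent ∞ (fun x => (⟨x, v x⟩ : TangentBundle I M)))
    {C : Set M} (hC : IsCompact C) (hvC : ∀ x ∉ C, v x = 0) (x : M) :
    ∃ γ : ℝ → M, γ 0 = x ∧ IsMIntegralCurve γ v := by
  have hloc : ∀ x₀ : M, ∃ ε > 0, ∀ᶠ x in 𝓝 x₀, ∃ γ : ℝ → M, γ 0 = x ∧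
      IsMIntegralCurveOn γ v (Ioo (-ε) ε) := by
    intro x₀
    obtain ⟨Φ, -, h0, h⟩ := exists_contMDiffAt_localFlow hv 0 x₀
    obtain ⟨T, hT, W, hW, hTW⟩ := mem_nhds_prod_iff.1 h
    obtain ⟨ε, hε, hεT⟩ := Metric.mem_nhds_iff.1 hT
    refine ⟨ε, hε, ?_⟩
    filter_upwards [h0, hW] with x hx0 hxW
    refine ⟨(Φ · x), hx0, fun t ht => ?_⟩
    exact (hTW (mk_mem_prod (hεT (by simpa [abs_lt] using ht)) hxW)).hasMFDerivWithinAt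
  -- Compactness makes the existence time uniform on `C`; off `C` the integral curves are constant.
  -- A uniform time of existence extends to all times.
  obtain ⟨ε, hε, h⟩ : ∃ ε > 0, ∀ x ∈ C, ∃ γ : ℝ → M, γ 0 = x ∧
      IsMIntegralCurveOn γ v (Ioo (-ε) ε) := by
    refine hC.induction_on (p := fun s => ∃ ε > 0, ∀ x ∈ s, ∃ γ : ℝ → M, γ 0 = x ∧
      IsMIntegralCurveOn γ v (Ioo (-ε) ε)) ⟨1, one_pos, by simp⟩ ?_ ?_ ?_
    · rintro s t hst ⟨ε, hε, h⟩
      exact ⟨ε, hε, fun x hx => h x (hst hx)⟩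
    · rintro s t ⟨ε, hε, h⟩ ⟨ε', hε', h'⟩
      refine ⟨min ε ε', lt_min hε hε', ?_⟩
      rintro x (hx | hx)
      · obtain ⟨γ, h0, hγ⟩ := h x hx
        exact ⟨γ, h0, hγ.mono (Ioo_subset_Ioo (neg_le_neg (min_le_left _ _)) (min_le_left _ _))⟩
      · obtain ⟨γ, h0, hγ⟩ := h' x hx
        exact ⟨γ, h0, hγ.mono (Ioo_subset_Ioo (neg_le_neg (min_le_right _ _)) (min_le_right _ _))⟩
    · intro x _
      obtain ⟨ε, hε, h⟩ := hloc x
      exact ⟨_, mem_nhdsWithin_of_mem_nhds h, ε, hε, fun y hy => hy⟩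
  have h1 : ContMDiff I I.tangent 1 (fun x => (⟨x, v x⟩ : TangentBundle I M)) :=
    hv.of_le (by exact_mod_cast le_top)
  refine exists_isMIntegralCurve_of_isMIntegralCurveOn h1 hε (fun y => ?_) x
  by_cases hy : y ∈ C
  · exact h y hy
  · refine ⟨fun _ => y, rfl, fun t _ => ?_⟩
    rw [hvC y hy]
    simpa using! (hasMFDerivAt_const y t).hasMFDerivWithinAt

/-- Global flows of smooth vector fields form one-parameter groups. -/
theorem flow_add [T2Space M]
    (hv : ContMDiff I I.tangent ∞ (fun x => (⟨x, v x⟩ : TangentBundle I M))) {Φ : ℝ → M → M}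
    (h0 : ∀ x, Φ 0 x = x) (hΦ : ∀ x, IsMIntegralCurve (Φ · x) v) (s t : ℝ) (x : M) :
    Φ (s + t) x = Φ s (Φ t x) := by
  have h1 : ContMDiff I I.tangent 1 (fun x => (⟨x, v x⟩ : TangentBundle I M)) :=
    hv.of_le (by exact_mod_cast le_top)
  exact congrFun (isMIntegralCurve_Ioo_eq_of_contMDiff_boundaryless (t₀ := 0) h1
    ((hΦ x).comp_add t) (hΦ (Φ t x)) (by simp [h0])) s

/-- Global flows of smooth vector fields are smooth. -/
theorem contMDiff_flow [CompleteSpace E] [T2Space M]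
    (hv : ContMDiff I I.tangent ∞ (fun x => (⟨x, v x⟩ : TangentBundle I M))) {Φ : ℝ → M → M}
    (h0 : ∀ x, Φ 0 x = x) (hΦ : ∀ x, IsMIntegralCurve (Φ · x) v) :
    ContMDiff (𝓘(ℝ, ℝ).prod I) I ∞ ↿Φ := by
  have h1 : ContMDiff I I.tangent 1 (fun x => (⟨x, v x⟩ : TangentBundle I M)) :=
    hv.of_le (by exact_mod_cast le_top)
  rw [contMDiff_infty]
  intro k
  -- Working with a finite order `k` makes being `C^k` at a point an open condition.
  have hk : (k : WithTop ℕ∞) ≠ ∞ := by exact_mod_cast ENat.natCast_ne_top _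
  have hloc : ∀ y : M, ∀ᶠ p in 𝓝 ((0 : ℝ), y), ContMDiffAt (𝓘(ℝ, ℝ).prod I) I k ↿Φ p := by
    intro y
    obtain ⟨Ψ, hΨ, hΨ0, hΨd⟩ := exists_contMDiffAt_localFlow hv k y
    obtain ⟨T, hT, W, hW, hTW⟩ := mem_nhds_prod_iff.1 hΨd
    obtain ⟨ε, hε, hεT⟩ := Metric.mem_nhds_iff.1 hT
    have heq : ↿Φ =ᶠ[𝓝 ((0 : ℝ), y)] ↿Ψ := by
      have hI : Ioo (-ε) ε ∈ 𝓝 (0 : ℝ) := Ioo_mem_nhds (by linarith) hε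
      filter_upwards [prod_mem_nhds hI (Filter.inter_mem hW hΨ0)] with p hp
      exact isMIntegralCurveOn_Ioo_eqOn_of_contMDiff_boundaryless (t₀ := 0)
        (γ := (Φ · p.2)) (γ' := (Ψ · p.2)) (by simp [hε]) h1 ((hΦ p.2).isMIntegralCurveOn _)
        (fun t ht => (hTW (mk_mem_prod (hεT (by simpa [abs_lt] using ht))
          hp.2.1)).hasMFDerivWithinAt) (by rw [h0]; exact hp.2.2.symm) hp.1
    exact (contMDiffAt_iff_contMDiffAt_nhds hk).1 (hΨ.congr_of_eventuallyEq heq)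
  rintro ⟨T₀, x₀⟩
  -- For fixed `x₀`, the set of good times is clopen in `ℝ` and contains `0`.
  suffices hS : {T : ℝ | ContMDiffAt (𝓘(ℝ, ℝ).prod I) I k ↿Φ (T, x₀)} = univ by
    exact hS.ge (mem_univ T₀)
  refine IsClopen.eq_univ ⟨isClosed_of_closure_subset fun T hT => ?_, ?_⟩
    ⟨0, (hloc x₀).self_of_nhds⟩
  -- Closedness: for a good time `T'` close to the limit `T`, write `Φ t = Φ (t - T') ∘ Φ T'`; the
  -- first factor is covered by the regularity near time zero around `Φ T x₀`.
  · have hc : ContinuousAt (fun T' : ℝ => (T - T', Φ T' x₀)) T :=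
      (continuousAt_const.sub continuousAt_id).prodMk (hΦ x₀).continuous.continuousAt
    have hev : ∀ᶠ T' in 𝓝 T, ContMDiffAt (𝓘(ℝ, ℝ).prod I) I k ↿Φ (T - T', Φ T' x₀) := by
      refine hc.eventually ?_
      simp only [sub_self]
      exact hloc _
    obtain ⟨T', hT', hT'S⟩ := mem_closure_iff_nhds.1 hT _ hev
    have heq : ↿Φ = ↿Φ ∘ fun p : ℝ × M => (p.1 - T', Φ T' p.2) := by
      ext p
      change Φ p.1 p.2 = Φ (p.1 - T') (Φ T' p.2)
      rw [← flow_add hv h0 hΦ, sub_add_cancel]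
    change ContMDiffAt (𝓘(ℝ, ℝ).prod I) I k ↿Φ (T, x₀)
    rw [heq]
    refine ContMDiffAt.comp (T, x₀) (I' := 𝓘(ℝ, ℝ).prod I) hT' ?_
    refine ContMDiffAt.prodMk ?_ ?_
    · have h2 : ContMDiffAt 𝓘(ℝ, ℝ) 𝓘(ℝ, ℝ) k (fun t : ℝ => t - T') T := by
        refine ContDiffAt.contMDiffAt ?_
        fun_prop
      exact ContMDiffAt.comp (I' := 𝓘(ℝ, ℝ)) (T, x₀) h2 (contMDiffAt_fst (I := 𝓘(ℝ, ℝ)) (J := I) (p := (T, x₀)))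
    · have h2 : ContMDiffAt I (𝓘(ℝ, ℝ).prod I) k (fun x : M => (T', x)) x₀ :=
        contMDiffAt_const.prodMk contMDiffAt_id
      have h3 : ContMDiffAt I I k (fun x => Φ T' x) x₀ :=
        ContMDiffAt.comp (I' := 𝓘(ℝ, ℝ).prod I) x₀ (g := ↿Φ) hT'S h2
      exact ContMDiffAt.comp (I' := I) (T, x₀) h3 contMDiffAt_snd
  · rw [isOpen_iff_mem_nhds]
    intro T hT
    have hc : ContinuousAt (fun T : ℝ => (T, x₀)) T := by fun_prop
    exact hc.eventually ((contMDiffAt_iff_contMDiffAt_nhds hk).1 hT)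

end ManifoldFlow

namespace HamFrag

/-! ### Hamiltonian vector fields -/

section HamiltonianField

variable {n : ℕ} {M : Type*} [TopologicalSpace M] [ChartedSpace (Model n) M]
  [IsManifold (𝓡 (2 * n)) ∞ M]

/-- The derivative of the inverse of the chart around `x₀`. -/
noncomputable def chartFrame (n : ℕ) {M : Type*} [TopologicalSpace M] [ChartedSpace (Model n) M]
    (x₀ : M) (y : Model n) :
    Model n →L[ℝ] TangentSpace (𝓡 (2 * n)) ((extChartAt (𝓡 (2 * n)) x₀).symm y) :=
  mfderiv 𝓘(ℝ, Model n) (𝓡 (2 * n)) (extChartAt (𝓡 (2 * n)) x₀).symm y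

/-- The derivative of the chart around `x₀`. -/
noncomputable def chartCoframe (n : ℕ) {M : Type*} [TopologicalSpace M]
    [ChartedSpace (Model n) M] (x₀ x : M) : TangentSpace (𝓡 (2 * n)) x →L[ℝ] Model n :=
  mfderiv (𝓡 (2 * n)) 𝓘(ℝ, Model n) (extChartAt (𝓡 (2 * n)) x₀) x

theorem chartCoframe_chartFrame {x₀ : M} {y : Model n}
    (hy : y ∈ (extChartAt (𝓡 (2 * n)) x₀).target) (u : Model n) :
    chartCoframe n x₀ ((extChartAt (𝓡 (2 * n)) x₀).symm y) (chartFrame n x₀ y u) = u := by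
  have h := mfderiv_extChartAt_comp_mfderivWithin_extChartAt_symm hy
  simp only [modelWithCornersSelf_coe, range_id, mfderivWithin_univ] at h
  exact DFunLike.congr_fun h u

theorem chartFrame_chartCoframe {x₀ : M} {y : Model n}
    (hy : y ∈ (extChartAt (𝓡 (2 * n)) x₀).target)
    (ξ : TangentSpace (𝓡 (2 * n)) ((extChartAt (𝓡 (2 * n)) x₀).symm y)) :
    chartFrame n x₀ y (chartCoframe n x₀ ((extChartAt (𝓡 (2 * n)) x₀).symm y) ξ) = ξ := by
  have h := mfderivWithin_extChartAt_symm_comp_mfderiv_extChartAt hy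
  simp only [modelWithCornersSelf_coe, range_id, mfderivWithin_univ] at h
  exact DFunLike.congr_fun h ξ

theorem contMDiffOn_chartFrame (x₀ : M) {u : Model n → Model n}
    (hu : ContDiffOn ℝ ∞ u (extChartAt (𝓡 (2 * n)) x₀).target) :
    ContMDiffOn 𝓘(ℝ, Model n) (𝓡 (2 * n)).tangent ∞
      (fun y => (⟨(extChartAt (𝓡 (2 * n)) x₀).symm y, chartFrame n x₀ y (u y)⟩ :
        TangentBundle (𝓡 (2 * n)) M)) (extChartAt (𝓡 (2 * n)) x₀).target := by
  have ho := isOpen_extChartAt_target (I := 𝓡 (2 * n)) x₀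
  have h1 := (contMDiffOn_extChartAt_symm (I := 𝓡 (2 * n)) (n := ∞) x₀).contMDiffOn_tangentMapWithin
    (m := ∞) (by simp) ho.uniqueMDiffOn
  have h2 : ContMDiffOn 𝓘(ℝ, Model n) (𝓘(ℝ, Model n)).tangent ∞
      (fun y : Model n => (⟨y, u y⟩ : TangentBundle 𝓘(ℝ, Model n) (Model n)))
      (extChartAt (𝓡 (2 * n)) x₀).target :=
    contMDiffOn_vectorSpace_iff_contDiffOn.2 hu
  refine (h1.comp h2 (fun y hy => hy)).congr fun y hy => ?_
  simp only [Function.comp, tangentMapWithin, mfderivWithin_of_isOpen ho hy]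
  rfl

theorem contDiffOn_localCoeff (Ω : SymplecticForm n M) (x₀ : M) (u v : Model n) :
    ContDiffOn ℝ ∞ (localCoeff Ω.toFun x₀ u v) (extChartAt (𝓡 (2 * n)) x₀).target := by
  rw [← contMDiffOn_iff_contDiffOn]
  have h := ContMDiffOn.clm_bundle_apply₂ (F₁ := Model n) (F₂ := Model n) (F₃ := ℝ)
    (E₁ := fun x : M => TangentSpace (𝓡 (2 * n)) x) (E₂ := fun x : M => TangentSpace (𝓡 (2 * n)) x)
    (E₃ := fun _ : M => ℝ)
    (b := (extChartAt (𝓡 (2 * n)) x₀).symm)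
    (Ω.contMDiff.comp_contMDiffOn (contMDiffOn_extChartAt_symm (I := 𝓡 (2 * n)) (n := ∞) x₀))
    (contMDiffOn_chartFrame x₀ (contDiffOn_const (c := u)))
    (contMDiffOn_chartFrame x₀ (contDiffOn_const (c := v)))
  intro y hy
  have := h y hy
  rw [Bundle.contMDiffWithinAt_totalSpace] at this
  exact this.2

/-- The coordinate expression of a symplectic form in the chart around `x₀`. -/
noncomputable def chartForm (Ω : SymplecticForm n M) (x₀ : M) (y : Model n) :
    Model n →L[ℝ] Model n →L[ℝ] ℝ :=
  LinearMap.toContinuousLinearMap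
    { toFun := fun u => (Ω.toFun ((extChartAt (𝓡 (2 * n)) x₀).symm y)
        (chartFrame n x₀ y u)).comp (chartFrame n x₀ y)
      map_add' := fun u v => by rw [map_add, map_add, ContinuousLinearMap.add_comp]
      map_smul' := fun a u => by rw [map_smul, map_smul]; rfl }

theorem chartForm_apply (Ω : SymplecticForm n M) (x₀ : M) (y u v : Model n) :
    chartForm Ω x₀ y u v = Ω.toFun ((extChartAt (𝓡 (2 * n)) x₀).symm y) (chartFrame n x₀ y u)
      (chartFrame n x₀ y v) := rfl

theorem contDiffOn_chartForm (Ω : SymplecticForm n M) (x₀ : M) :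
    ContDiffOn ℝ ∞ (chartForm Ω x₀) (extChartAt (𝓡 (2 * n)) x₀).target :=
  contDiffOn_clm_apply.2 fun u => contDiffOn_clm_apply.2 fun v => contDiffOn_localCoeff Ω x₀ u v

theorem chartForm_swap (Ω : SymplecticForm n M) (x₀ : M) (y u v : Model n) :
    chartForm Ω x₀ y u v = -chartForm Ω x₀ y v u := by
  have h := Ω.alternating _ (chartFrame n x₀ y (u + v))
  have h1 := Ω.alternating _ (chartFrame n x₀ y u)
  have h2 := Ω.alternating _ (chartFrame n x₀ y v)
  simp only [map_add, add_apply, h1, h2] at h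
  simp only [chartForm_apply]
  linarith

theorem chartForm_injective (Ω : SymplecticForm n M) {x₀ : M} {y : Model n}
    (hy : y ∈ (extChartAt (𝓡 (2 * n)) x₀).target) {u : Model n}
    (h : ∀ v, chartForm Ω x₀ y u v = 0) : u = 0 := by
  have h1 : chartFrame n x₀ y u = 0 := Ω.nondegenerate _ _ fun w => by
    rw [← chartFrame_chartCoframe hy w]
    exact h _
  rw [← chartCoframe_chartFrame hy u, h1, map_zero]

/-- Nondegeneracy gives injectivity, and the dimensions agree. The equivalence is needed because
operator inversion is smooth at invertible operators. -/
theorem exists_chartForm_equiv (Ω : SymplecticForm n M) {x₀ : M} {y : Model n}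
    (hy : y ∈ (extChartAt (𝓡 (2 * n)) x₀).target) :
    ∃ e : Model n ≃L[ℝ] (Model n →L[ℝ] ℝ), (e : Model n →L[ℝ] Model n →L[ℝ] ℝ) =
      chartForm Ω x₀ y := by
  have hinj : Function.Injective (chartForm Ω x₀ y : Model n →ₗ[ℝ] Model n →L[ℝ] ℝ) :=
    (injective_iff_map_eq_zero _).2 fun u hu => chartForm_injective Ω hy fun v =>
      DFunLike.congr_fun hu v
  have hdim : Module.finrank ℝ (Model n) = Module.finrank ℝ (Model n →L[ℝ] ℝ) := by
    rw [← LinearEquiv.finrank_eq (LinearMap.toContinuousLinearMap (𝕜 := ℝ) (E := Model n)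
      (F' := ℝ))]
    exact (Subspace.dual_finrank_eq).symm
  refine ⟨(LinearMap.linearEquivOfInjective _ hinj hdim).toContinuousLinearEquiv, ?_⟩
  ext u v
  rfl

end HamiltonianField

/-! ### Existence, uniqueness and smoothness of Hamiltonian vector fields -/

section HamiltonianField

variable {n : ℕ} {M : Type*} [TopologicalSpace M] [ChartedSpace (Model n) M]
  [IsManifold (𝓡 (2 * n)) ∞ M]

theorem exists_hamField (Ω : SymplecticForm n M) (A : M → ℝ) (x : M) :
    ∃ X : TangentSpace (𝓡 (2 * n)) x, ∀ w, Ω.toFun x X w =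
      -(mfderiv (𝓡 (2 * n)) 𝓘(ℝ, ℝ) A x w : ℝ) := by
  have : FiniteDimensional ℝ (TangentSpace (𝓡 (2 * n)) x) :=
    inferInstanceAs (FiniteDimensional ℝ (Model n))
  let L : TangentSpace (𝓡 (2 * n)) x →ₗ[ℝ] TangentSpace (𝓡 (2 * n)) x →ₗ[ℝ] ℝ :=
    { toFun := fun u => (Ω.toFun x u).toLinearMap
      map_add' := fun u v => by rw [map_add]; rfl
      map_smul' := fun a u => by rw [map_smul]; rfl }
  have hinj : Function.Injective L := (injective_iff_map_eq_zero _).2 fun u hu =>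
    Ω.nondegenerate x u fun w => LinearMap.congr_fun hu w
  have hsurj : Function.Surjective L :=
    (LinearMap.injective_iff_surjective_of_finrank_eq_finrank
      (Subspace.dual_finrank_eq (K := ℝ) (V := TangentSpace (𝓡 (2 * n)) x)).symm).1 hinj
  let α : TangentSpace (𝓡 (2 * n)) x →ₗ[ℝ] ℝ :=
    (mfderiv (𝓡 (2 * n)) 𝓘(ℝ, ℝ) A x).toLinearMap
  obtain ⟨X, hX⟩ := hsurj (-α)
  exact ⟨X, fun w => LinearMap.congr_fun hX w⟩

/-- The Hamiltonian vector field of a function. -/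
noncomputable def hamField (Ω : SymplecticForm n M) (A : M → ℝ) (x : M) :
    TangentSpace (𝓡 (2 * n)) x :=
  (exists_hamField Ω A x).choose

theorem hamField_spec (Ω : SymplecticForm n M) (A : M → ℝ) (x : M)
    (w : TangentSpace (𝓡 (2 * n)) x) :
    Ω.toFun x (hamField Ω A x) w = -(mfderiv (𝓡 (2 * n)) 𝓘(ℝ, ℝ) A x w : ℝ) :=
  (exists_hamField Ω A x).choose_spec w

theorem eq_of_form_eq (Ω : SymplecticForm n M) {x : M} {X Y : TangentSpace (𝓡 (2 * n)) x}
    (h : ∀ w, Ω.toFun x X w = Ω.toFun x Y w) : X = Y :=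
  sub_eq_zero.1 <| Ω.nondegenerate x _ fun w => by
    rw [map_sub]
    exact sub_eq_zero.2 (h w)

theorem eq_hamField (Ω : SymplecticForm n M) {A : M → ℝ} {x : M} {X : TangentSpace (𝓡 (2 * n)) x}
    (h : ∀ w, Ω.toFun x X w = -(mfderiv (𝓡 (2 * n)) 𝓘(ℝ, ℝ) A x w : ℝ)) :
    X = hamField Ω A x :=
  eq_of_form_eq Ω fun w => (h w).trans (hamField_spec Ω A x w).symm

theorem hamField_eq_zero (Ω : SymplecticForm n M) {A : M → ℝ} {x : M}
    (h : A =ᶠ[𝓝 x] 0) : hamField Ω A x = 0 := by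
  refine (eq_hamField Ω fun w => ?_).symm
  have h0 : mfderiv (𝓡 (2 * n)) 𝓘(ℝ, ℝ) A x = 0 := by
    rw [h.mfderiv_eq]
    exact mfderiv_const
  rw [h0, map_zero]
  exact neg_zero.symm

/-- The coordinate expression of a Hamiltonian vector field. -/
noncomputable def chartHamField (Ω : SymplecticForm n M) (A : M → ℝ) (x₀ : M) (y : Model n) :
    Model n :=
  (chartForm Ω x₀ y).inverse (-fderiv ℝ (A ∘ (extChartAt (𝓡 (2 * n)) x₀).symm) y)

theorem chartForm_chartHamField (Ω : SymplecticForm n M) (A : M → ℝ) {x₀ : M} {y : Model n}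
    (hy : y ∈ (extChartAt (𝓡 (2 * n)) x₀).target) (w : Model n) :
    chartForm Ω x₀ y (chartHamField Ω A x₀ y) w =
      -fderiv ℝ (A ∘ (extChartAt (𝓡 (2 * n)) x₀).symm) y w := by
  obtain ⟨e, he⟩ := exists_chartForm_equiv Ω hy
  rw [chartHamField, ← he, ContinuousLinearMap.inverse_equiv]
  simp

theorem contDiffOn_comp_chart_symm {A : M → ℝ} (hA : ContMDiff (𝓡 (2 * n)) 𝓘(ℝ, ℝ) ∞ A) (x₀ : M) :
    ContDiffOn ℝ ∞ (A ∘ (extChartAt (𝓡 (2 * n)) x₀).symm) (extChartAt (𝓡 (2 * n)) x₀).target :=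
  contMDiffOn_iff_contDiffOn.1 (hA.comp_contMDiffOn (contMDiffOn_extChartAt_symm x₀))

theorem contDiffOn_chartHamField (Ω : SymplecticForm n M) {A : M → ℝ}
    (hA : ContMDiff (𝓡 (2 * n)) 𝓘(ℝ, ℝ) ∞ A) (x₀ : M) :
    ContDiffOn ℝ ∞ (chartHamField Ω A x₀) (extChartAt (𝓡 (2 * n)) x₀).target := by
  have ho := isOpen_extChartAt_target (I := 𝓡 (2 * n)) x₀
  intro y hy
  obtain ⟨e, he⟩ := exists_chartForm_equiv Ω hy
  refine ContDiffWithinAt.clm_apply ?_ ?_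
  -- The field is `-dA` with the inverse of the form applied to it, and inversion is smooth at the
  -- invertible operator `chartForm Ω x₀ y`.
  · refine ContDiffAt.comp_contDiffWithinAt (g := ContinuousLinearMap.inverse) y ?_
      (contDiffOn_chartForm Ω x₀ y hy)
    rw [← he]
    exact contDiffAt_map_inverse e
  · exact ((contDiffOn_comp_chart_symm hA x₀).fderiv_of_isOpen ho (by simp) y hy).neg

theorem hamField_chart_symm (Ω : SymplecticForm n M) {A : M → ℝ}
    (hA : ContMDiff (𝓡 (2 * n)) 𝓘(ℝ, ℝ) ∞ A) {x₀ : M} {y : Model n}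
    (hy : y ∈ (extChartAt (𝓡 (2 * n)) x₀).target) :
    hamField Ω A ((extChartAt (𝓡 (2 * n)) x₀).symm y) =
      chartFrame n x₀ y (chartHamField Ω A x₀ y) := by
  refine (eq_hamField Ω fun w => ?_).symm
  rw [← chartFrame_chartCoframe hy w, ← chartForm_apply, chartForm_chartHamField Ω A hy]
  have h1 : MDifferentiableAt 𝓘(ℝ, Model n) (𝓡 (2 * n)) (extChartAt (𝓡 (2 * n)) x₀).symm y :=
    ((contMDiffOn_extChartAt_symm (n := ∞) x₀).contMDiffAt
      ((isOpen_extChartAt_target x₀).mem_nhds hy)).mdifferentiableAt (by simp)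
  have h2 := mfderiv_comp y (hA.mdifferentiableAt (by simp)) h1
  rw [mfderiv_eq_fderiv] at h2
  rw [h2]
  rfl

theorem contMDiff_hamField (Ω : SymplecticForm n M) {A : M → ℝ}
    (hA : ContMDiff (𝓡 (2 * n)) 𝓘(ℝ, ℝ) ∞ A) :
    ContMDiff (𝓡 (2 * n)) (𝓡 (2 * n)).tangent ∞
      (fun x => (⟨x, hamField Ω A x⟩ : TangentBundle (𝓡 (2 * n)) M)) := by
  intro x₀
  have hs := extChartAt_source_mem_nhds (I := 𝓡 (2 * n)) x₀
  have h1 := (contMDiffOn_chartFrame x₀ (contDiffOn_chartHamField Ω hA x₀)).contMDiffAt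
    (extChartAt_target_mem_nhds x₀)
  refine (ContMDiffAt.comp x₀ h1 contMDiffAt_extChartAt).congr_of_eventuallyEq ?_
  filter_upwards [hs] with x hx
  have hx' := (extChartAt (𝓡 (2 * n)) x₀).map_source hx
  simp only [Function.comp]
  rw [← hamField_chart_symm Ω hA hx', (extChartAt (𝓡 (2 * n)) x₀).left_inv hx]

end HamiltonianField

end HamFrag

/-! ### Hamiltonian flows preserve the symplectic form -/

section LieDerivative

variable {E : Type*} [NormedAddCommGroup E] [NormedSpace ℝ E]

/-- The Lie derivative of a closed 2-form along a Hamiltonian vector field vanishes. -/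
theorem lieDeriv_hamiltonian_eq_zero {η : E → E →L[ℝ] E →L[ℝ] ℝ} {V : E → E} {A : E → ℝ} {y : E}
    (hη : DifferentiableAt ℝ η y) (hV : DifferentiableAt ℝ V y) (hA : ContDiffAt ℝ 2 A y)
    (hswap : ∀ z u w, η z u w = -η z w u)
    (hham : ∀ᶠ z in 𝓝 y, ∀ u, η z (V z) u = -fderiv ℝ A z u)
    (hclosed : ∀ u v w, fderiv ℝ (fun z => η z v w) y u + fderiv ℝ (fun z => η z w u) y v
      + fderiv ℝ (fun z => η z u v) y w = 0) (u w : E) :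
    fderiv ℝ η y (V y) u w + η y (fderiv ℝ V y u) w + η y u (fderiv ℝ V y w) = 0 := by
  have hcoeff : ∀ a b c, fderiv ℝ (fun z => η z b c) y a = fderiv ℝ η y a b c := by
    intro a b c
    have h := (hη.hasFDerivAt.clm_apply (hasFDerivAt_const b y)).clm_apply (hasFDerivAt_const c y)
    rw [h.fderiv]
    simp
  have hswap' : ∀ a b c, fderiv ℝ η y a b c = -fderiv ℝ η y a c b := by
    intro a b c
    rw [← hcoeff, ← hcoeff]
    have : (fun z => η z b c) = -fun z => η z c b := by
      ext z
      exact hswap z b c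
    rw [this, fderiv_neg]
    rfl
  have hA' : DifferentiableAt ℝ (fderiv ℝ A) y :=
    (hA.fderiv_right (m := 1) (by norm_num)).differentiableAt (by simp)
  have hsymm : ∀ a b, fderiv ℝ (fderiv ℝ A) y a b = fderiv ℝ (fderiv ℝ A) y b a :=
    fun a b => (hA.isSymmSndFDerivAt (by simp)).eq a b
  -- Differentiate the defining relation `η(V, b) = -dA(b)` in the direction `a`.
  have hH : ∀ a b, fderiv ℝ η y a (V y) b + η y (fderiv ℝ V y a) b =
      -fderiv ℝ (fderiv ℝ A) y a b := by
    intro a b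
    have h1 := (hη.hasFDerivAt.clm_apply hV.hasFDerivAt).clm_apply (hasFDerivAt_const b y)
    have h2 := (hA'.hasFDerivAt.clm_apply (hasFDerivAt_const b y)).neg
    have h3 : (fun z => η z (V z) b) =ᶠ[𝓝 y] fun z => -(fderiv ℝ A z) b :=
      hham.mono fun z hz => hz b
    have h4 := DFunLike.congr_fun (h1.unique (h2.congr_of_eventuallyEq h3)) a
    simp only [ContinuousLinearMap.comp_zero, zero_add, add_apply, neg_apply,
      ContinuousLinearMap.flip_apply, ContinuousLinearMap.comp_apply] at h4
    linarith
  -- Antisymmetrizing `hH` in `u` and `w` cancels the Hessian of `A`; closedness evaluated on `(V,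
  -- u, w)` supplies the remaining term. This is Cartan's formula in coordinates.
  have h1 := hH u w
  have h2 := hH w u
  have h3 := hclosed (V y) u w
  rw [hcoeff, hcoeff, hcoeff] at h3
  have h4 := hswap y (fderiv ℝ V y w) u
  have h5 := hsymm u w
  have h6 := hswap' u w (V y)
  linarith

/-- The time derivative at zero of the pullback of a 2-form under a flow whose vector field has
vanishing Lie derivative. -/
theorem hasDerivAt_pullback_of_lieDeriv_eq_zero {η : E → E →L[ℝ] E →L[ℝ] ℝ} {V : E → E} {y : E}
    (hη : DifferentiableAt ℝ η y) (hV : DifferentiableAt ℝ V y) {Ψ : ℝ × E → E}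
    (hΨ : ContDiffAt ℝ 2 Ψ (0, y)) (hΨ0 : ∀ᶠ z in 𝓝 y, Ψ (0, z) = z)
    (hΨV : ∀ᶠ p : ℝ × E in 𝓝 (0, y), HasDerivAt (fun t => Ψ (t, p.2)) (V (Ψ p)) p.1) {u w : E}
    (hLie : fderiv ℝ η y (V y) u w + η y (fderiv ℝ V y u) w + η y u (fderiv ℝ V y w) = 0) :
    HasDerivAt (fun t => η (Ψ (t, y)) (fderiv ℝ (fun z => Ψ (t, z)) y u)
      (fderiv ℝ (fun z => Ψ (t, z)) y w)) 0 0 := by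
  have hy0 := hΨ0.self_of_nhds
  have hdiff : ∀ᶠ p : ℝ × E in 𝓝 (0, y), DifferentiableAt ℝ Ψ p :=
    (hΨ.eventually (by simp)).mono fun p hp => hp.differentiableAt (by simp)
  have hι : ContinuousAt (fun t : ℝ => (t, y)) 0 := by fun_prop
  have hspace : ∀ᶠ t : ℝ in 𝓝 0, ∀ a, fderiv ℝ (fun z => Ψ (t, z)) y a = fderiv ℝ Ψ (t, y) (0, a) := by
    filter_upwards [hι.eventually hdiff] with t ht a
    have h := ht.hasFDerivAt.comp y (hasFDerivAt_prodMk_right t y)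
    rw [show (fun z => Ψ (t, z)) = Ψ ∘ fun z => (t, z) from rfl, h.fderiv]
    simp
  have htime : ∀ᶠ p : ℝ × E in 𝓝 (0, y), fderiv ℝ Ψ p (1, 0) = V (Ψ p) := by
    filter_upwards [hdiff, hΨV] with p hp hpV
    have h := hp.hasFDerivAt.comp_hasDerivAt p.1
      ((hasDerivAt_id p.1).prodMk (hasDerivAt_const p.1 p.2))
    exact h.unique hpV
  have hD : HasFDerivAt (fderiv ℝ Ψ) (fderiv ℝ (fderiv ℝ Ψ) (0, y)) (0, y) :=
    ((hΨ.fderiv_right (m := 1) (by norm_num)).differentiableAt (by simp)).hasFDerivAt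
  have hD0 : ∀ a, fderiv ℝ Ψ (0, y) (0, a) = a := by
    intro a
    rw [← hspace.self_of_nhds a, Filter.EventuallyEq.fderiv_eq (f := id) hΨ0]
    simp
  -- Symmetry of the second derivative of `Ψ`: the time derivative of the space derivative at time
  -- zero is the space derivative of `V`.
  have hD' : ∀ a, HasDerivAt (fun t : ℝ => fderiv ℝ Ψ (t, y) (0, a)) (fderiv ℝ V y a) 0 := by
    intro a
    have h0 : HasDerivAt (fun t : ℝ => fderiv ℝ Ψ (t, y)) (fderiv ℝ (fderiv ℝ Ψ) (0, y) (1, 0)) 0 :=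
      HasFDerivAt.comp_hasDerivAt (l := fderiv ℝ Ψ) (f := fun t : ℝ => (t, y)) (0 : ℝ) hD
        ((hasDerivAt_id (0 : ℝ)).prodMk (hasDerivAt_const (0 : ℝ) y))
    have h1 := h0.clm_apply (hasDerivAt_const (0 : ℝ) ((0, a) : ℝ × E))
    have h2 : fderiv ℝ (fderiv ℝ Ψ) (0, y) (1, 0) (0, a) = fderiv ℝ V y a := by
      rw [(hΨ.isSymmSndFDerivAt (by simp)).eq (1, 0) (0, a)]
      have h3' : HasFDerivAt (fun z : E => fderiv ℝ Ψ (0, z))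
          (fderiv ℝ (fderiv ℝ Ψ) (0, y) ∘L ContinuousLinearMap.inr ℝ ℝ E) y :=
        HasFDerivAt.comp (g := fderiv ℝ Ψ) y hD (hasFDerivAt_prodMk_right (0 : ℝ) y)
      have h3 := h3'.clm_apply (hasFDerivAt_const ((1, 0) : ℝ × E) y)
      have h4 : (fun z => fderiv ℝ Ψ (0, z) (1, 0)) =ᶠ[𝓝 y] V := by
        have hc : ContinuousAt (fun z : E => ((0 : ℝ), z)) y := by fun_prop
        filter_upwards [hc.eventually htime, hΨ0] with z hz hz0
        rw [hz, hz0]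
      have h5 := DFunLike.congr_fun (h3.unique (hV.hasFDerivAt.congr_of_eventuallyEq h4)) a
      simpa using h5
    refine h1.congr_deriv ?_
    simpa using h2
  have hcurve : HasDerivAt (fun t : ℝ => Ψ (t, y)) (V y) 0 := by
    have := hΨV.self_of_nhds
    simp only [hy0] at this
    exact this
  have hη' : HasDerivAt (fun t : ℝ => η (Ψ (t, y))) (fderiv ℝ η y (V y)) 0 := by
    have h : HasFDerivAt η (fderiv ℝ η y) (Ψ (0, y)) := by
      rw [hy0]
      exact hη.hasFDerivAt
    exact HasFDerivAt.comp_hasDerivAt (l := η) (f := fun t : ℝ => Ψ (t, y)) (0 : ℝ) h hcurve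
  have hmain := (hη'.clm_apply (hD' u)).clm_apply (hD' w)
  simp only [hD0, hy0, add_apply, hLie] at hmain
  refine hmain.congr_of_eventuallyEq ?_
  filter_upwards [hspace] with t ht
  rw [ht, ht]

end LieDerivative

namespace HamFrag

/-! ### Autonomous Hamiltonian flows -/

section Autonomous

variable {n : ℕ} {M : Type*} [TopologicalSpace M] [ChartedSpace (Model n) M]
  [IsManifold (𝓡 (2 * n)) ∞ M] {Ω : SymplecticForm n M} {A : M → ℝ} {φ ψ : ℝ → Equiv.Perm M}

/-- Nondegeneracy leaves only one candidate for the vector `X` in the definition. -/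
theorem isHamIsotopy_iff {H : ℝ → M → ℝ} : IsHamIsotopy Ω H φ ↔ φ 0 = 1 ∧ ∀ t x,
    HasMFDerivAt 𝓘(ℝ, ℝ) (𝓡 (2 * n)) (fun s : ℝ => φ s x) t
      ((1 : ℝ →L[ℝ] ℝ).smulRight (hamField Ω (H t) (φ t x))) := by
  refine and_congr_right fun _ => forall_congr' fun t => forall_congr' fun x => ⟨?_, fun h => ?_⟩
  · rintro ⟨X, hX, h⟩
    rwa [← eq_hamField Ω hX]
  · exact ⟨_, hamField_spec Ω (H t) (φ t x), h⟩

theorem IsHamIsotopy.isMIntegralCurve (hφ : IsHamIsotopy Ω (fun _ => A) φ) (x : M) :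
    IsMIntegralCurve (fun t => φ t x) (hamField Ω A) :=
  fun t => (isHamIsotopy_iff.1 hφ).2 t x

theorem IsHamIsotopy.zero_apply {H : ℝ → M → ℝ} (hφ : IsHamIsotopy Ω H φ) (x : M) :
    φ 0 x = x := by
  rw [hφ.1]
  rfl

/-- The Hamiltonian field vanishes off `C`, so its integral curves are complete; the group law
provides the inverse of each time-`t` map. -/
theorem exists_isHamIsotopy [T2Space M] (Ω : SymplecticForm n M)
    (hA : ContMDiff (𝓡 (2 * n)) 𝓘(ℝ, ℝ) ∞ A) {C : Set M} (hC : IsCompact C)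
    (hAC : ∀ x ∉ C, A x = 0) : ∃ φ : ℝ → Equiv.Perm M, IsHamIsotopy Ω (fun _ => A) φ := by
  have hv := contMDiff_hamField Ω hA
  have hsupp : ∀ x ∉ C, hamField Ω A x = 0 := fun x hx => hamField_eq_zero Ω <| by
    filter_upwards [hC.isClosed.isOpen_compl.mem_nhds hx] with y hy using hAC y hy
  choose Φ h0 hΦ using fun x => exists_isMIntegralCurve_of_compactSupport hv hC hsupp x
  have hadd := flow_add hv (Φ := fun t x => Φ x t) h0 hΦ
  refine ⟨fun t => ⟨fun x => Φ x t, fun x => Φ x (-t), fun x => ?_, fun x => ?_⟩,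
    isHamIsotopy_iff.2 ⟨?_, fun t x => hΦ x t⟩⟩
  · have := hadd (-t) t x
    rw [neg_add_cancel] at this
    exact this.symm.trans (h0 x)
  · have := hadd t (-t) x
    rw [add_neg_cancel] at this
    exact this.symm.trans (h0 x)
  · ext x
    exact h0 x

variable [T2Space M]

theorem IsHamIsotopy.unique (hA : ContMDiff (𝓡 (2 * n)) 𝓘(ℝ, ℝ) ∞ A)
    (hφ : IsHamIsotopy Ω (fun _ => A) φ) (hψ : IsHamIsotopy Ω (fun _ => A) ψ) : φ = ψ := by
  ext t x
  exact congrFun (isMIntegralCurve_Ioo_eq_of_contMDiff_boundaryless (t₀ := 0)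
    ((contMDiff_hamField Ω hA).of_le (by exact_mod_cast le_top)) (hφ.isMIntegralCurve x)
    (hψ.isMIntegralCurve x) (by rw [hφ.zero_apply, hψ.zero_apply])) t

theorem IsHamIsotopy.add_apply (hA : ContMDiff (𝓡 (2 * n)) 𝓘(ℝ, ℝ) ∞ A)
    (hφ : IsHamIsotopy Ω (fun _ => A) φ) (s t : ℝ) (x : M) : φ (s + t) x = φ s (φ t x) :=
  flow_add (contMDiff_hamField Ω hA) (Φ := fun t x => φ t x) hφ.zero_apply hφ.isMIntegralCurve s t x

theorem IsHamIsotopy.add (hA : ContMDiff (𝓡 (2 * n)) 𝓘(ℝ, ℝ) ∞ A)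
    (hφ : IsHamIsotopy Ω (fun _ => A) φ) (s t : ℝ) : φ (s + t) = φ s * φ t := by
  ext x
  exact hφ.add_apply hA s t x

theorem IsHamIsotopy.neg (hA : ContMDiff (𝓡 (2 * n)) 𝓘(ℝ, ℝ) ∞ A)
    (hφ : IsHamIsotopy Ω (fun _ => A) φ) (t : ℝ) : φ (-t) = (φ t)⁻¹ := by
  rw [eq_inv_iff_mul_eq_one, ← hφ.add hA, neg_add_cancel, hφ.1]

theorem IsHamIsotopy.contMDiff (hA : ContMDiff (𝓡 (2 * n)) 𝓘(ℝ, ℝ) ∞ A)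
    (hφ : IsHamIsotopy Ω (fun _ => A) φ) :
    ContMDiff (𝓘(ℝ, ℝ).prod (𝓡 (2 * n))) (𝓡 (2 * n)) ∞ (fun p : ℝ × M => φ p.1 p.2) :=
  contMDiff_flow (contMDiff_hamField Ω hA) (Φ := fun t x => φ t x) hφ.zero_apply
    hφ.isMIntegralCurve

theorem IsHamIsotopy.contMDiff_apply (hA : ContMDiff (𝓡 (2 * n)) 𝓘(ℝ, ℝ) ∞ A)
    (hφ : IsHamIsotopy Ω (fun _ => A) φ) (t : ℝ) :
    ContMDiff (𝓡 (2 * n)) (𝓡 (2 * n)) ∞ (φ t) :=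
  (hφ.contMDiff hA).comp (contMDiff_const.prodMk contMDiff_id)

omit [IsManifold (𝓡 (2 * n)) ∞ M] [T2Space M] in
theorem hasDerivAt_comp_of_hasMFDerivAt {γ : ℝ → M} {t : ℝ} {X : TangentSpace (𝓡 (2 * n)) (γ t)}
    (hA : MDifferentiableAt (𝓡 (2 * n)) 𝓘(ℝ, ℝ) A (γ t))
    (hγ : HasMFDerivAt 𝓘(ℝ, ℝ) (𝓡 (2 * n)) γ t ((1 : ℝ →L[ℝ] ℝ).smulRight X)) :
    HasDerivAt (fun s => A (γ s)) (mfderiv (𝓡 (2 * n)) 𝓘(ℝ, ℝ) A (γ t) X : ℝ) t := by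
  have h1 := hA.hasMFDerivAt.comp t hγ
  let L : ℝ →L[ℝ] ℝ := mfderiv (𝓡 (2 * n)) 𝓘(ℝ, ℝ) A (γ t) ∘L (1 : ℝ →L[ℝ] ℝ).smulRight X
  have h2 : HasFDerivAt (fun s => A (γ s)) L t := h1.hasFDerivAt
  refine h2.hasDerivAt.congr_deriv ?_
  change mfderiv (𝓡 (2 * n)) 𝓘(ℝ, ℝ) A (γ t) ((1 : ℝ) • X) = _
  rw [one_smul]

-- Conservation of energy: the derivative of `A` along its flow is `-Ω(X, X) = 0`.
omit [T2Space M] in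
theorem IsHamIsotopy.apply_eq (hA : ContMDiff (𝓡 (2 * n)) 𝓘(ℝ, ℝ) ∞ A)
    (hφ : IsHamIsotopy Ω (fun _ => A) φ) (t : ℝ) (x : M) : A (φ t x) = A x := by
  have hd : ∀ s, HasDerivAt (fun s => A (φ s x)) 0 s := by
    intro s
    have h2 := hasDerivAt_comp_of_hasMFDerivAt (hA.mdifferentiableAt (x := φ s x) (by simp))
      (hφ.isMIntegralCurve x s)
    refine h2.congr_deriv ?_
    have h4 := hamField_spec Ω A (φ s x) (hamField Ω A (φ s x))
    rw [Ω.alternating] at h4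
    exact neg_eq_zero.1 h4.symm
  have := is_const_of_deriv_eq_zero (fun s => (hd s).differentiableAt) (fun s => (hd s).deriv) t 0
  simpa only [hφ.zero_apply] using this

/-- The pullback of a 2-form under a map from the model space. -/
noncomputable def pullbackForm (Ω : SymplecticForm n M) (f : Model n → M) (y u v : Model n) : ℝ :=
  Ω.toFun (f y) (mfderiv 𝓘(ℝ, Model n) (𝓡 (2 * n)) f y u)
    (mfderiv 𝓘(ℝ, Model n) (𝓡 (2 * n)) f y v)

omit [T2Space M] in
theorem pullbackForm_congr {f g : Model n → M} {y : Model n} (h : f =ᶠ[𝓝 y] g) (u v : Model n) :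
    pullbackForm Ω f y u v = pullbackForm Ω g y u v := by
  -- Regarding all tangent spaces as the model space allows base points to be substituted freely.
  let F : M → Model n →L[ℝ] Model n →L[ℝ] ℝ := Ω.toFun
  have h1 : f y = g y := h.self_of_nhds
  have h2 : (mfderiv 𝓘(ℝ, Model n) (𝓡 (2 * n)) f y : Model n →L[ℝ] Model n) =
    mfderiv 𝓘(ℝ, Model n) (𝓡 (2 * n)) g y := h.mfderiv_eq
  have h3 : ∀ (p q : M) (a b : Model n →L[ℝ] Model n), p = q → a = b →
      F p (a u) (a v) = F q (b u) (b v) := by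
    rintro p _ a _ rfl rfl
    rfl
  exact h3 _ _ _ _ h1 h2

omit [T2Space M] in
theorem pullbackForm_chart_symm_comp {x₀ : M} {g : Model n → Model n} {y : Model n}
    (hg : DifferentiableAt ℝ g y) (hy : g y ∈ (extChartAt (𝓡 (2 * n)) x₀).target)
    (u v : Model n) :
    pullbackForm Ω (fun z => (extChartAt (𝓡 (2 * n)) x₀).symm (g z)) y u v =
      chartForm Ω x₀ (g y) (fderiv ℝ g y u) (fderiv ℝ g y v) := by
  have h1 : MDifferentiableAt 𝓘(ℝ, Model n) (𝓡 (2 * n)) (extChartAt (𝓡 (2 * n)) x₀).symm (g y) :=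
    ((contMDiffOn_extChartAt_symm (n := ∞) x₀).contMDiffAt
      ((isOpen_extChartAt_target x₀).mem_nhds hy)).mdifferentiableAt (by simp)
  have h2 := mfderiv_comp (I := 𝓘(ℝ, Model n)) (I' := 𝓘(ℝ, Model n)) y h1 hg.mdifferentiableAt
  rw [mfderiv_eq_fderiv] at h2
  have h3 : ∀ w, mfderiv 𝓘(ℝ, Model n) (𝓡 (2 * n))
      (fun z => (extChartAt (𝓡 (2 * n)) x₀).symm (g z)) y w =
      chartFrame n x₀ (g y) (fderiv ℝ g y w) := fun w => DFunLike.congr_fun h2 w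
  let F : M → Model n →L[ℝ] Model n →L[ℝ] ℝ := Ω.toFun
  exact congrArg₂ (fun a b : Model n => F ((extChartAt (𝓡 (2 * n)) x₀).symm (g y)) a b) (h3 u) (h3 v)

end Autonomous

/-! ### Invariance of the symplectic form under autonomous Hamiltonian flows -/

section Symplecticity

variable {n : ℕ} {M : Type*} [TopologicalSpace M] [ChartedSpace (Model n) M]
  [IsManifold (𝓡 (2 * n)) ∞ M] {Ω : SymplecticForm n M} {A : M → ℝ} {φ ψ : ℝ → Equiv.Perm M}

theorem mfderiv_chart_hamField (hA : ContMDiff (𝓡 (2 * n)) 𝓘(ℝ, ℝ) ∞ A) {x₀ q : M}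
    (hq : q ∈ (extChartAt (𝓡 (2 * n)) x₀).source) :
    chartCoframe n x₀ q (hamField Ω A q) =
      chartHamField Ω A x₀ (extChartAt (𝓡 (2 * n)) x₀ q) := by
  have hq' := (extChartAt (𝓡 (2 * n)) x₀).map_source hq
  have h : chartCoframe n x₀ ((extChartAt (𝓡 (2 * n)) x₀).symm (extChartAt (𝓡 (2 * n)) x₀ q))
      (hamField Ω A ((extChartAt (𝓡 (2 * n)) x₀).symm (extChartAt (𝓡 (2 * n)) x₀ q))) =
      chartHamField Ω A x₀ (extChartAt (𝓡 (2 * n)) x₀ q) := by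
    rw [hamField_chart_symm Ω hA hq', chartCoframe_chartFrame hq']
  rwa [(extChartAt (𝓡 (2 * n)) x₀).left_inv hq] at h

theorem hasDerivAt_chart_comp {x₀ : M} {γ : ℝ → M} {t : ℝ}
    (hA : ContMDiff (𝓡 (2 * n)) 𝓘(ℝ, ℝ) ∞ A)
    (hγ : HasMFDerivAt 𝓘(ℝ, ℝ) (𝓡 (2 * n)) γ t
      ((1 : ℝ →L[ℝ] ℝ).smulRight (hamField Ω A (γ t))))
    (hq : γ t ∈ (extChartAt (𝓡 (2 * n)) x₀).source) :
    HasDerivAt (fun s => extChartAt (𝓡 (2 * n)) x₀ (γ s))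
      (chartHamField Ω A x₀ (extChartAt (𝓡 (2 * n)) x₀ (γ t))) t := by
  have hd : MDifferentiableAt (𝓡 (2 * n)) 𝓘(ℝ, Model n) (extChartAt (𝓡 (2 * n)) x₀) (γ t) :=
    mdifferentiableAt_extChartAt (by rwa [← extChartAt_source (I := 𝓡 (2 * n))])
  have h1 := hd.hasMFDerivAt.comp t hγ
  let L : ℝ →L[ℝ] Model n :=
    chartCoframe n x₀ (γ t) ∘L (1 : ℝ →L[ℝ] ℝ).smulRight (hamField Ω A (γ t))
  have h2 : HasFDerivAt (fun s => extChartAt (𝓡 (2 * n)) x₀ (γ s)) L t := h1.hasFDerivAt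
  refine h2.hasDerivAt.congr_deriv ?_
  change chartCoframe n x₀ (γ t) ((1 : ℝ) • hamField Ω A (γ t)) = _
  rw [one_smul, mfderiv_chart_hamField hA hq]

variable [T2Space M]

/-- The group law `φ (t₀ + h) = φ h ∘ φ t₀` moves the question to time zero in a chart around the
image point `x₁`; there the vanishing Lie derivative applies, with `κ` the coordinate expression of
`φ t₀`. -/
theorem hasDerivAt_pullbackForm (hA : ContMDiff (𝓡 (2 * n)) 𝓘(ℝ, ℝ) ∞ A)
    (hφ : IsHamIsotopy Ω (fun _ => A) φ) {x₀ : M} {y : Model n}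
    (hy : y ∈ (extChartAt (𝓡 (2 * n)) x₀).target) (u v : Model n) (t₀ : ℝ) :
    HasDerivAt (fun t => pullbackForm Ω
      (fun z => φ t ((extChartAt (𝓡 (2 * n)) x₀).symm z)) y u v) 0 t₀ := by
  set e₀ := extChartAt (𝓡 (2 * n)) x₀ with he₀
  set x₁ := φ t₀ (e₀.symm y) with hx₁
  set e₁ := extChartAt (𝓡 (2 * n)) x₁ with he₁
  set y₁ := e₁ x₁ with hy₁
  have hsrc : e₁.source ∈ 𝓝 x₁ := extChartAt_source_mem_nhds x₁
  have htgt : e₁.target ∈ 𝓝 y₁ := extChartAt_target_mem_nhds x₁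
  have hsymm₀ : ContMDiffAt 𝓘(ℝ, Model n) (𝓡 (2 * n)) ∞ e₀.symm y :=
    (contMDiffOn_extChartAt_symm x₀).contMDiffAt ((isOpen_extChartAt_target x₀).mem_nhds hy)
  have hsymm₁ : ContMDiffAt 𝓘(ℝ, Model n) (𝓡 (2 * n)) ∞ e₁.symm y₁ :=
    (contMDiffOn_extChartAt_symm x₁).contMDiffAt htgt
  have he₁c : ContMDiffAt (𝓡 (2 * n)) 𝓘(ℝ, Model n) ∞ e₁ x₁ := contMDiffAt_extChartAt
  have hsymm₁' : e₁.symm y₁ = x₁ := e₁.left_inv (mem_of_mem_nhds hsrc)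
  set κ : Model n → Model n := fun z => e₁ (φ t₀ (e₀.symm z)) with hκ
  have hφe : ContMDiffAt 𝓘(ℝ, Model n) (𝓡 (2 * n)) ∞ (fun z => φ t₀ (e₀.symm z)) y :=
    ((hφ.contMDiff_apply hA t₀).contMDiffAt).comp y hsymm₀
  have hκc : ContDiffAt ℝ ∞ κ y := contMDiffAt_iff_contDiffAt.1 (he₁c.comp y hφe)
  set Ψ : ℝ × Model n → Model n := fun p => e₁ (φ p.1 (e₁.symm p.2)) with hΨ
  have hφ₁ : ContMDiffAt (𝓘(ℝ, ℝ).prod 𝓘(ℝ, Model n)) (𝓡 (2 * n)) ∞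
      (fun p : ℝ × Model n => φ p.1 (e₁.symm p.2)) (0, y₁) := by
    refine ContMDiffAt.comp (I' := 𝓘(ℝ, ℝ).prod (𝓡 (2 * n))) (0, y₁)
      (g := fun p : ℝ × M => φ p.1 p.2) (f := fun p : ℝ × Model n => (p.1, e₁.symm p.2))
      (hφ.contMDiff hA).contMDiffAt (contMDiffAt_fst.prodMk ?_)
    exact ContMDiffAt.comp (I' := 𝓘(ℝ, Model n)) (0, y₁) hsymm₁ contMDiffAt_snd
  have hφ₁0 : φ 0 (e₁.symm y₁) = x₁ := by rw [hφ.zero_apply, hsymm₁']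
  have hΨc : ContDiffAt ℝ ∞ Ψ (0, y₁) := by
    have h1 : ContMDiffAt (𝓘(ℝ, ℝ).prod 𝓘(ℝ, Model n)) 𝓘(ℝ, Model n) ∞ Ψ (0, y₁) := by
      refine ContMDiffAt.comp (I' := 𝓡 (2 * n)) (0, y₁) (g := e₁) ?_ hφ₁
      rw [hφ₁0]
      exact he₁c
    rw [← modelWithCornersSelf_prod, chartedSpaceSelf_prod] at h1
    exact contMDiffAt_iff_contDiffAt.1 h1
  have hsrc₁ : ∀ᶠ p : ℝ × Model n in 𝓝 (0, y₁), φ p.1 (e₁.symm p.2) ∈ e₁.source := by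
    refine hφ₁.continuousAt.eventually_mem ?_
    rw [hφ₁0]
    exact hsrc
  have hΨ0 : ∀ᶠ z in 𝓝 y₁, Ψ (0, z) = z := by
    filter_upwards [htgt] with z hz
    simp only [hΨ, hφ.zero_apply, e₁.right_inv hz]
  have hΨV : ∀ᶠ p : ℝ × Model n in 𝓝 (0, y₁),
      HasDerivAt (fun t => Ψ (t, p.2)) (chartHamField Ω A x₁ (Ψ p)) p.1 := by
    filter_upwards [hsrc₁] with p hp
    exact hasDerivAt_chart_comp hA (hφ.isMIntegralCurve (e₁.symm p.2) p.1) hp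
  have hLie := lieDeriv_hamiltonian_eq_zero (y := y₁)
    ((contDiffOn_chartForm Ω x₁).contDiffAt htgt |>.differentiableAt (by simp))
    ((contDiffOn_chartHamField Ω hA x₁).contDiffAt htgt |>.differentiableAt (by simp))
    (((contDiffOn_comp_chart_symm hA x₁).contDiffAt htgt).of_le ENat.LEInfty.out)
    (chartForm_swap Ω x₁)
    (by filter_upwards [htgt] with z hz w using chartForm_chartHamField Ω A hz w)
    (fun a b c => Ω.closed x₁ y₁ (mem_of_mem_nhds htgt) a b c)
    (fderiv ℝ κ y u) (fderiv ℝ κ y v)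
  have hmain := hasDerivAt_pullback_of_lieDeriv_eq_zero
    ((contDiffOn_chartForm Ω x₁).contDiffAt htgt |>.differentiableAt (by simp))
    ((contDiffOn_chartHamField Ω hA x₁).contDiffAt htgt |>.differentiableAt (by simp))
    (hΨc.of_le ENat.LEInfty.out) hΨ0 hΨV hLie
  have hι : ContinuousAt (fun t : ℝ => (t, y₁)) 0 := by fun_prop
  have hΨd : ∀ᶠ p : ℝ × Model n in 𝓝 (0, y₁), DifferentiableAt ℝ Ψ p :=
    ((hΨc.of_le (m := 1) (by exact_mod_cast le_top)).eventually (by simp)).mono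
      fun p hp => hp.differentiableAt (by simp)
  have hloc : ∀ᶠ h in 𝓝 (0 : ℝ), pullbackForm Ω (fun z => φ (t₀ + h) (e₀.symm z)) y u v =
      chartForm Ω x₁ (Ψ (h, y₁)) (fderiv ℝ (fun z => Ψ (h, z)) y₁ (fderiv ℝ κ y u))
        (fderiv ℝ (fun z => Ψ (h, z)) y₁ (fderiv ℝ κ y v)) := by
    filter_upwards [hι.eventually hsrc₁, hι.eventually hΨd] with h hh hhd
    simp only [hsymm₁'] at hh
    have hc1 : ∀ᶠ z in 𝓝 y, φ t₀ (e₀.symm z) ∈ e₁.source :=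
      hφe.continuousAt.eventually_mem hsrc
    have hc2 : ∀ᶠ z in 𝓝 y, φ h (φ t₀ (e₀.symm z)) ∈ e₁.source := by
      have : ContinuousAt (fun z => φ h (φ t₀ (e₀.symm z))) y :=
        (hφ.contMDiff_apply hA h).continuous.continuousAt.comp hφe.continuousAt
      exact this.eventually_mem ((isOpen_extChartAt_source x₁).mem_nhds hh)
    have heq : (fun z => φ (t₀ + h) (e₀.symm z)) =ᶠ[𝓝 y] fun z => e₁.symm (Ψ (h, κ z)) := by
      filter_upwards [hc1, hc2] with z hz1 hz2
      simp only [hΨ, hκ]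
      rw [e₁.left_inv hz1, e₁.left_inv hz2, add_comm, hφ.add_apply hA]
    have hslice : DifferentiableAt ℝ (fun z => Ψ (h, z)) (κ y) :=
      DifferentiableAt.comp (g := Ψ) (f := fun z => (h, z)) (κ y) hhd (by fun_prop)
    have hκd : DifferentiableAt ℝ κ y := hκc.differentiableAt (by simp)
    have hcomp := hslice.hasFDerivAt.comp y hκd.hasFDerivAt
    have htgt' : Ψ (h, κ y) ∈ e₁.target := e₁.map_source (by simpa only [hκ, hsymm₁', ← hx₁, ← hy₁])
    rw [pullbackForm_congr heq, pullbackForm_chart_symm_comp (g := fun z => Ψ (h, κ z))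
      hcomp.differentiableAt htgt']
    have : fderiv ℝ (fun z => Ψ (h, κ z)) y = fderiv ℝ (fun z => Ψ (h, z)) (κ y) ∘L fderiv ℝ κ y :=
      hcomp.fderiv
    rw [this]
    rfl
  have h1 := hmain.congr_of_eventuallyEq hloc
  have h2 := HasDerivAt.comp_sub_const (f := fun h => pullbackForm Ω
    (fun z => φ (t₀ + h) (e₀.symm z)) y u v) t₀ t₀ (by rwa [sub_self])
  simpa only [add_sub_cancel] using h2

/-- Autonomous Hamiltonian flows preserve the symplectic form. -/
theorem IsHamIsotopy.form_mfderiv (hA : ContMDiff (𝓡 (2 * n)) 𝓘(ℝ, ℝ) ∞ A)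
    (hφ : IsHamIsotopy Ω (fun _ => A) φ) (t : ℝ) (x : M) (u v : TangentSpace (𝓡 (2 * n)) x) :
    Ω.toFun (φ t x) (mfderiv (𝓡 (2 * n)) (𝓡 (2 * n)) (φ t) x u)
      (mfderiv (𝓡 (2 * n)) (𝓡 (2 * n)) (φ t) x v) = Ω.toFun x u v := by
  set e := extChartAt (𝓡 (2 * n)) x with he
  have key : ∀ y ∈ e.target, ∀ a b : TangentSpace (𝓡 (2 * n)) (e.symm y),
      Ω.toFun (φ t (e.symm y)) (mfderiv (𝓡 (2 * n)) (𝓡 (2 * n)) (φ t) (e.symm y) a)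
        (mfderiv (𝓡 (2 * n)) (𝓡 (2 * n)) (φ t) (e.symm y) b) = Ω.toFun (e.symm y) a b := by
    intro y hy a b
    have hd := hasDerivAt_pullbackForm hA hφ hy (chartCoframe n x (e.symm y) a)
      (chartCoframe n x (e.symm y) b)
    have hconst := is_const_of_deriv_eq_zero (fun s => (hd s).differentiableAt)
      (fun s => (hd s).deriv) t 0
    have h1 : MDifferentiableAt 𝓘(ℝ, Model n) (𝓡 (2 * n)) e.symm y :=
      ((contMDiffOn_extChartAt_symm (n := ∞) x).contMDiffAt
        ((isOpen_extChartAt_target x).mem_nhds hy)).mdifferentiableAt (by simp)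
    have h2 := mfderiv_comp y
      ((hφ.contMDiff_apply hA t).mdifferentiableAt (x := e.symm y) (by simp)) h1
    have h3 : ∀ c, mfderiv 𝓘(ℝ, Model n) (𝓡 (2 * n)) (fun z => φ t (e.symm z)) y
        (chartCoframe n x (e.symm y) c) =
        mfderiv (𝓡 (2 * n)) (𝓡 (2 * n)) (φ t) (e.symm y) c := fun c => by
      refine (DFunLike.congr_fun h2 _).trans ?_
      exact congrArg (mfderiv (𝓡 (2 * n)) (𝓡 (2 * n)) (φ t) (e.symm y))
        (chartFrame_chartCoframe hy c)
    have h4 : (fun z => φ 0 (e.symm z)) = e.symm := funext fun z => hφ.zero_apply _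
    rw [h4] at hconst
    have h5 : pullbackForm Ω e.symm y (chartCoframe n x (e.symm y) a)
        (chartCoframe n x (e.symm y) b) = Ω.toFun (e.symm y) a b := by
      change Ω.toFun (e.symm y) (chartFrame n x y _) (chartFrame n x y _) = _
      rw [chartFrame_chartCoframe hy, chartFrame_chartCoframe hy]
    rw [h5] at hconst
    rw [← hconst, ← h3, ← h3]
    rfl
  have hx : x ∈ e.source := mem_extChartAt_source x
  have := key (e x) (e.map_source hx)
  rw [e.left_inv hx] at this
  exact this u v

end Symplecticity

/-! ### Time-dependent Hamiltonian isotopies built from autonomous ones -/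

section Isotopies

variable {n : ℕ} {M : Type*} [TopologicalSpace M] [ChartedSpace (Model n) M]
  [IsManifold (𝓡 (2 * n)) ∞ M] {Ω : SymplecticForm n M} {A B : M → ℝ} {φ χ : ℝ → Equiv.Perm M}

theorem hamField_add {x : M} (hA : MDifferentiableAt (𝓡 (2 * n)) 𝓘(ℝ, ℝ) A x)
    (hB : MDifferentiableAt (𝓡 (2 * n)) 𝓘(ℝ, ℝ) B x) :
    hamField Ω (A + B) x = hamField Ω A x + hamField Ω B x := by
  refine (eq_hamField Ω fun w => ?_).symm
  rw [map_add, mfderiv_add hA hB]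
  change Ω.toFun x (hamField Ω A x) w + Ω.toFun x (hamField Ω B x) w = _
  rw [hamField_spec, hamField_spec]
  exact (neg_add _ _).symm

theorem hamField_comp {x : M} (hA : MDifferentiableAt (𝓡 (2 * n)) 𝓘(ℝ, ℝ) A x) {g : ℝ → ℝ} {g' : ℝ}
    (hg : HasDerivAt g g' (A x)) :
    hamField Ω (fun y => g (A y)) x = g' • hamField Ω A x := by
  refine (eq_hamField Ω fun w => ?_).symm
  have h := (hg.hasFDerivAt.hasMFDerivAt.comp x hA.hasMFDerivAt).mfderiv
  let a : ℝ := mfderiv (𝓡 (2 * n)) 𝓘(ℝ, ℝ) A x w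
  let b : ℝ := mfderiv (𝓡 (2 * n)) 𝓘(ℝ, ℝ) (fun y => g (A y)) x w
  have h1 : b = a * g' := DFunLike.congr_fun h w
  have h2 : Ω.toFun x (hamField Ω A x) w = -a := hamField_spec Ω A x w
  rw [map_smul]
  change g' * Ω.toFun x (hamField Ω A x) w = -b
  rw [h1, h2]
  ring

theorem hamField_const_mul {x : M} (hA : MDifferentiableAt (𝓡 (2 * n)) 𝓘(ℝ, ℝ) A x) (a : ℝ) :
    hamField Ω (fun y => a * A y) x = a • hamField Ω A x :=
  hamField_comp hA (by simpa using (hasDerivAt_id (A x)).const_mul a)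

theorem smulRight_one_eq {E : Type*} [NormedAddCommGroup E] [NormedSpace ℝ E] {L : ℝ →L[ℝ] E} {v : E}
    (h : L 1 = v) : L = (1 : ℝ →L[ℝ] ℝ).smulRight v :=
  ContinuousLinearMap.ext_ring (by simpa using h)

omit [IsManifold (𝓡 (2 * n)) ∞ M] in
theorem hasMFDerivAt_comp_of_hasDerivAt {γ : ℝ → M} {b : ℝ → ℝ} {b' t : ℝ}
    {X : TangentSpace (𝓡 (2 * n)) (γ (b t))}
    (hγ : HasMFDerivAt 𝓘(ℝ, ℝ) (𝓡 (2 * n)) γ (b t) ((1 : ℝ →L[ℝ] ℝ).smulRight X))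
    (hb : HasDerivAt b b' t) :
    HasMFDerivAt 𝓘(ℝ, ℝ) (𝓡 (2 * n)) (fun s => γ (b s)) t
      ((1 : ℝ →L[ℝ] ℝ).smulRight (b' • X)) := by
  have h := hγ.comp t hb.hasFDerivAt.hasMFDerivAt
  refine h.congr_mfderiv (smulRight_one_eq (E := Model n) ?_)
  change ((1 : ℝ) • b') • X = b' • X
  rw [one_smul]

variable [T2Space M]

/-- The chain rule for a flow whose time and starting point both vary: the velocity is the sum of
the two partial contributions. -/
theorem IsHamIsotopy.hasMFDerivAt_comp (hA : ContMDiff (𝓡 (2 * n)) 𝓘(ℝ, ℝ) ∞ A)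
    (hφ : IsHamIsotopy Ω (fun _ => A) φ) {b : ℝ → ℝ} {b' t : ℝ} {γ : ℝ → M}
    {X : TangentSpace (𝓡 (2 * n)) (γ t)} (hb : HasDerivAt b b' t)
    (hγ : HasMFDerivAt 𝓘(ℝ, ℝ) (𝓡 (2 * n)) γ t ((1 : ℝ →L[ℝ] ℝ).smulRight X)) :
    HasMFDerivAt 𝓘(ℝ, ℝ) (𝓡 (2 * n)) (fun s => φ (b s) (γ s)) t
      ((1 : ℝ →L[ℝ] ℝ).smulRight (b' • hamField Ω A (φ (b t) (γ t)) +
        mfderiv (𝓡 (2 * n)) (𝓡 (2 * n)) (φ (b t)) (γ t) X)) := by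
  have hd : MDifferentiableAt (𝓘(ℝ, ℝ).prod (𝓡 (2 * n))) (𝓡 (2 * n))
      (fun p : ℝ × M => φ p.1 p.2) (b t, γ t) :=
    (hφ.contMDiff hA).mdifferentiableAt (by simp)
  have h := hd.hasMFDerivAt.comp t (hb.hasFDerivAt.hasMFDerivAt.prodMk hγ)
  refine h.congr_mfderiv (smulRight_one_eq (E := Model n) ?_)
  refine Eq.trans (mfderiv_prod_eq_add_apply (v := (((1 : ℝ) • b', (1 : ℝ) • X) :
    ℝ × Model n)) hd) ?_
  have h1 := (hφ.isMIntegralCurve (γ t) (b t)).mfderiv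
  have h2 : mfderiv 𝓘(ℝ, ℝ) (𝓡 (2 * n)) (fun z => φ z (γ t)) (b t) ((1 : ℝ) • b' : ℝ) =
      ((1 : ℝ) • b') • hamField Ω A (φ (b t) (γ t)) := DFunLike.congr_fun h1 _
  change mfderiv 𝓘(ℝ, ℝ) (𝓡 (2 * n)) (fun z => φ z (γ t)) (b t) ((1 : ℝ) • b' : ℝ) +
    mfderiv (𝓡 (2 * n)) (𝓡 (2 * n)) (φ (b t)) (γ t) ((1 : ℝ) • X) =
    b' • hamField Ω A (φ (b t) (γ t)) + mfderiv (𝓡 (2 * n)) (𝓡 (2 * n)) (φ (b t)) (γ t) X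
  rw [h2, one_smul, one_smul]

/-- Autonomous Hamiltonian flows preserve their Hamiltonian vector field. -/
theorem IsHamIsotopy.mfderiv_hamField (hA : ContMDiff (𝓡 (2 * n)) 𝓘(ℝ, ℝ) ∞ A)
    (hφ : IsHamIsotopy Ω (fun _ => A) φ) (t : ℝ) (x : M) :
    mfderiv (𝓡 (2 * n)) (𝓡 (2 * n)) (φ t) x (hamField Ω A x) = hamField Ω A (φ t x) := by
  -- Both sides of `φ t ∘ φ s = φ s ∘ φ t` are differentiated at `s = 0`.
  have h1 := hφ.hasMFDerivAt_comp hA (b := fun _ => t) (γ := fun s => φ s x) (t := 0)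
    (hasDerivAt_const 0 t) (hφ.isMIntegralCurve x 0)
  have h2 := hφ.hasMFDerivAt_comp hA (b := fun s => s) (γ := fun _ => φ t x) (t := 0) (X := 0)
    (hasDerivAt_id 0) (by simpa using! hasMFDerivAt_const (φ t x) (0 : ℝ))
  have h3 : (fun s => φ t (φ s x)) = fun s => φ s (φ t x) := by
    ext s
    rw [← hφ.add_apply hA, ← hφ.add_apply hA, add_comm]
  rw [h3] at h1
  have h4 := DFunLike.congr_fun (hasMFDerivAt_unique h1 h2) (1 : ℝ)
  let D : M → Model n →L[ℝ] Model n := fun x => mfderiv (𝓡 (2 * n)) (𝓡 (2 * n)) (φ t) x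
  let V : M → Model n := hamField Ω A
  let D0 : Model n →L[ℝ] Model n := mfderiv (𝓡 (2 * n)) (𝓡 (2 * n)) (φ 0) (φ t x)
  have h5 : (1 : ℝ) • ((0 : ℝ) • V (φ t (φ 0 x)) + D (φ 0 x) (V (φ 0 x))) =
    (1 : ℝ) • ((1 : ℝ) • V (φ 0 (φ t x)) + D0 0) := h4
  rw [one_smul, one_smul, one_smul, zero_smul, zero_add, map_zero, add_zero, hφ.zero_apply,
    hφ.zero_apply] at h5
  exact h5

/-- The isotopy `s ↦ (φᵀˢ)⁻¹ ∘ χᵀˢ`, where `φ` and `χ` are the flows of `A` and `A + B`, is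
generated by `T • B ∘ φᵀˢ`. -/
theorem IsHamIsotopy.inv_mul (hA : ContMDiff (𝓡 (2 * n)) 𝓘(ℝ, ℝ) ∞ A)
    (hB : ContMDiff (𝓡 (2 * n)) 𝓘(ℝ, ℝ) ∞ B) (hφ : IsHamIsotopy Ω (fun _ => A) φ)
    (hχ : IsHamIsotopy Ω (fun _ => A + B) χ) (T : ℝ) :
    IsHamIsotopy Ω (fun s x => T * B (φ (T * s) x)) (fun s => (φ (T * s))⁻¹ * χ (T * s)) := by
  refine isHamIsotopy_iff.2 ⟨by simp [hφ.1, hχ.1], fun s x => ?_⟩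
  set y := χ (T * s) x with hy
  have hfun : (fun r => ((φ (T * r))⁻¹ * χ (T * r)) x) = fun r => φ (-(T * r)) (χ (T * r) x) := by
    ext r
    rw [hφ.neg hA]
    rfl
  have hval : ((φ (T * s))⁻¹ * χ (T * s)) x = φ (-(T * s)) y := congrFun hfun s
  have hTs : HasDerivAt (fun r => T * r) T s := by simpa using (hasDerivAt_id s).const_mul T
  have h1 := hφ.hasMFDerivAt_comp hA (b := fun r => -(T * r)) (γ := fun r => χ (T * r) x) hTs.neg
    (hasMFDerivAt_comp_of_hasDerivAt (hχ.isMIntegralCurve x (T * s)) hTs)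
  have hback : φ (T * s) (φ (-(T * s)) y) = y := by
    rw [← hφ.add_apply hA, add_neg_cancel, hφ.zero_apply]
  -- The contributions of `A` cancel because the flow of `A` preserves its own Hamiltonian field;
  -- only the transported field of `B` survives.
  have hvec : (-T) • hamField Ω A (φ (-(T * s)) y) +
      mfderiv (𝓡 (2 * n)) (𝓡 (2 * n)) (φ (-(T * s))) y (T • hamField Ω (A + B) y) =
      T • mfderiv (𝓡 (2 * n)) (𝓡 (2 * n)) (φ (-(T * s))) y (hamField Ω B y) := by
    rw [hamField_add (hA.mdifferentiableAt (by simp)) (hB.mdifferentiableAt (by simp)), map_smul,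
      map_add, hφ.mfderiv_hamField hA, smul_add, ← add_assoc, neg_smul, neg_add_cancel, zero_add]
  -- A symplectic map carries the Hamiltonian field of `B` to that of `B` composed with the inverse
  -- map.
  have hham : mfderiv (𝓡 (2 * n)) (𝓡 (2 * n)) (φ (-(T * s))) y (hamField Ω B y) =
      hamField Ω (fun x => B (φ (T * s) x)) (φ (-(T * s)) y) := by
    refine eq_hamField Ω fun w => ?_
    let D : ℝ → M → Model n →L[ℝ] Model n := fun t x => mfderiv (𝓡 (2 * n)) (𝓡 (2 * n)) (φ t) x
    let dB : M → Model n →L[ℝ] ℝ := fun x => mfderiv (𝓡 (2 * n)) 𝓘(ℝ, ℝ) B x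
    have e1 : D (-(T * s)) y (D (T * s) (φ (-(T * s)) y) w) = w := by
      have hc : (φ (-(T * s)) : M → M) ∘ φ (T * s) = id := by
        ext z
        change φ (-(T * s)) (φ (T * s) z) = z
        rw [← hφ.add_apply hA, neg_add_cancel, hφ.zero_apply]
      have h := mfderiv_comp (φ (-(T * s)) y)
        ((hφ.contMDiff_apply hA (-(T * s))).mdifferentiableAt
          (x := φ (T * s) (φ (-(T * s)) y)) (by simp))
        ((hφ.contMDiff_apply hA (T * s)).mdifferentiableAt (by simp))
      rw [hc, mfderiv_id] at h
      have h' : w = D (-(T * s)) (φ (T * s) (φ (-(T * s)) y)) (D (T * s) (φ (-(T * s)) y) w) :=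
        DFunLike.congr_fun h w
      rw [hback] at h'
      exact h'.symm
    have e2 : (mfderiv (𝓡 (2 * n)) 𝓘(ℝ, ℝ) (fun x => B (φ (T * s) x)) (φ (-(T * s)) y) w : ℝ) =
        dB y (D (T * s) (φ (-(T * s)) y) w) := by
      have h := mfderiv_comp (φ (-(T * s)) y)
        (hB.mdifferentiableAt (x := φ (T * s) (φ (-(T * s)) y)) (by simp))
        ((hφ.contMDiff_apply hA (T * s)).mdifferentiableAt (by simp))
      have h' : (mfderiv (𝓡 (2 * n)) 𝓘(ℝ, ℝ) (fun x => B (φ (T * s) x)) (φ (-(T * s)) y) w : ℝ) =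
        dB (φ (T * s) (φ (-(T * s)) y)) (D (T * s) (φ (-(T * s)) y) w) := DFunLike.congr_fun h w
      rwa [hback] at h'
    have e3 := hφ.form_mfderiv hA (-(T * s)) y (hamField Ω B y) (D (T * s) (φ (-(T * s)) y) w)
    have e4 := hamField_spec Ω B y (D (T * s) (φ (-(T * s)) y) w)
    refine Eq.trans ?_ (e3.trans (e4.trans (congrArg Neg.neg e2.symm)))
    exact congrArg (Ω.toFun (φ (-(T * s)) y)
      (mfderiv (𝓡 (2 * n)) (𝓡 (2 * n)) (φ (-(T * s))) y (hamField Ω B y))) e1.symm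
  have hfield : hamField Ω (fun x => T * B (φ (T * s) x)) (φ (-(T * s)) y) =
      (-T) • hamField Ω A (φ (-(T * s)) y) +
      mfderiv (𝓡 (2 * n)) (𝓡 (2 * n)) (φ (-(T * s))) y (T • hamField Ω (A + B) y) := by
    rw [hvec, hham]
    exact hamField_const_mul
      ((hB.comp (hφ.contMDiff_apply hA (T * s))).mdifferentiableAt (by simp)) T
  rw [hval, hfun, hfield]
  exact h1

end Isotopies

/-! ### Fragmentation of autonomous Hamiltonian flows -/

section Fragmentation

/-- A smooth step, equal to `0` for `t ≤ 1 / 3` and to `1` for `t ≥ 2 / 3`. -/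
noncomputable def smoothStep (t : ℝ) : ℝ := Real.smoothTransition (3 * t - 1)

theorem contDiff_smoothStep : ContDiff ℝ ∞ smoothStep :=
  Real.smoothTransition.contDiff.comp (by fun_prop)

theorem smoothStep_mem_Icc (t : ℝ) : smoothStep t ∈ Icc (0 : ℝ) 1 :=
  ⟨Real.smoothTransition.nonneg _, Real.smoothTransition.le_one _⟩

theorem smoothStep_eq_zero {t : ℝ} (ht : t ≤ 1 / 3) : smoothStep t = 0 :=
  Real.smoothTransition.zero_of_nonpos (by linarith)

theorem smoothStep_eq_one {t : ℝ} (ht : 2 / 3 ≤ t) : smoothStep t = 1 :=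
  Real.smoothTransition.one_of_one_le (by linarith)

theorem deriv_smoothStep_eq_zero_of_lt {t : ℝ} (ht : t < 1 / 3) : deriv smoothStep t = 0 := by
  have : smoothStep =ᶠ[𝓝 t] fun _ => 0 := by
    filter_upwards [Iio_mem_nhds ht] with s hs using smoothStep_eq_zero (le_of_lt hs)
  rw [this.deriv_eq, deriv_const]

theorem deriv_smoothStep_eq_zero_of_gt {t : ℝ} (ht : 2 / 3 < t) : deriv smoothStep t = 0 := by
  have : smoothStep =ᶠ[𝓝 t] fun _ => 1 := by
    filter_upwards [Ioi_mem_nhds ht] with s hs using smoothStep_eq_one (le_of_lt hs)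
  rw [this.deriv_eq, deriv_const]

/-- Near any time `t` a function of `fract t` and `⌊t⌋` can be unwrapped, provided that it
is compatible with the gluing of the end of a period with the beginning of the next one. -/
theorem exists_floor_unwrap {α : Type*} (g : ℝ → ℤ → α)
    (hg : ∀ t k, t ∈ Ico (0 : ℝ) (1 / 3) → g t (k + 1) = g (t + 1) k)
    (hg' : ∀ t k, t ∈ Ioo (-(1 / 3) : ℝ) 0 → g t (k + 1) = g (t + 1) k) (t₀ : ℝ) :
    ∀ᶠ t in 𝓝 t₀, g (Int.fract t) ⌊t⌋ = g (t - ⌊t₀⌋) ⌊t₀⌋ := by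
  have h1 : (⌊t₀⌋ : ℝ) - 1 / 3 < t₀ := by linarith [Int.floor_le t₀]
  have h2 : t₀ < (⌊t₀⌋ : ℝ) + 4 / 3 := by linarith [Int.lt_floor_add_one t₀]
  filter_upwards [Ioo_mem_nhds h1 h2] with t ht
  generalize ⌊t₀⌋ = k at ht ⊢
  rcases lt_or_ge t k with h | h
  · have hf : ⌊t⌋ = k - 1 := Int.floor_eq_iff.2 ⟨by push_cast; linarith [ht.1], by
      push_cast; linarith⟩
    have := hg' (t - k) (k - 1) ⟨by linarith [ht.1], by linarith⟩
    rw [Int.fract, hf, show t - ((k - 1 : ℤ) : ℝ) = t - k + 1 by push_cast; ring, ← this,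
      sub_add_cancel]
  · rcases lt_or_ge t (k + 1) with h' | h'
    · have hf : ⌊t⌋ = k := Int.floor_eq_iff.2 ⟨h, h'⟩
      rw [Int.fract, hf]
    · have hf : ⌊t⌋ = k + 1 := Int.floor_eq_iff.2 ⟨by push_cast; linarith, by
        push_cast; linarith [ht.2]⟩
      have := hg (t - k - 1) k ⟨by linarith, by linarith [ht.2]⟩
      rw [Int.fract, hf, show t - ((k + 1 : ℤ) : ℝ) = t - k - 1 by push_cast; ring, this,
        sub_add_cancel]

variable {n : ℕ} {M : Type*} [TopologicalSpace M] [ChartedSpace (Model n) M]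
  [IsManifold (𝓡 (2 * n)) ∞ M] {Ω : SymplecticForm n M} {A B : M → ℝ} {φ χ : ℝ → Equiv.Perm M}

omit [IsManifold (𝓡 (2 * n)) ∞ M] in
theorem contMDiff_slice {H : ℝ → M → ℝ}
    (hH : ContMDiff (𝓘(ℝ, ℝ).prod (𝓡 (2 * n))) 𝓘(ℝ, ℝ) ∞ (fun p : ℝ × M => H p.1 p.2)) (t : ℝ) :
    ContMDiff (𝓡 (2 * n)) 𝓘(ℝ, ℝ) ∞ (H t) :=
  hH.comp (contMDiff_const.prodMk contMDiff_id)

/-- The time-one map of a Hamiltonian isotopy which is supported in a compact subset of `U` for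
`0 ≤ t ≤ 1` belongs to `Ham(U)`. -/
theorem mem_hamOn_of_isotopy {U C : Set M} {H : ℝ → M → ℝ}
    (hH : ContMDiff (𝓘(ℝ, ℝ).prod (𝓡 (2 * n))) 𝓘(ℝ, ℝ) ∞ (fun p : ℝ × M => H p.1 p.2))
    (hC : IsCompact C) (hCU : C ⊆ U) (hHC : ∀ t ∈ Icc (0 : ℝ) 1, ∀ x ∉ C, H t x = 0)
    (hφ : IsHamIsotopy Ω H φ) : φ 1 ∈ hamOn Ω U := by
  -- Time is reparametrized by `smoothStep`: the new Hamiltonian vanishes for `t < 1/3` and `t >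
  -- 2/3`, so it extends periodically, and it samples `H` only at times in `[0, 1]`.
  let F0 : ℝ → M → ℝ := fun t x => deriv smoothStep t * H (smoothStep t) x
  have hF0 : ContMDiff (𝓘(ℝ, ℝ).prod (𝓡 (2 * n))) 𝓘(ℝ, ℝ) ∞ (fun p : ℝ × M => F0 p.1 p.2) := by
    have h1 : ContMDiff 𝓘(ℝ, ℝ) 𝓘(ℝ, ℝ) ∞ (deriv smoothStep) :=
      (contDiff_infty_iff_deriv.1 contDiff_smoothStep).2.contMDiff
    have h2 : ContMDiff 𝓘(ℝ, ℝ) 𝓘(ℝ, ℝ) ∞ smoothStep := contDiff_smoothStep.contMDiff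
    exact (h1.comp contMDiff_fst).mul (hH.comp ((h2.comp contMDiff_fst).prodMk contMDiff_snd))
  have hlt : ∀ t < 1 / 3, F0 t = 0 := fun t ht => by
    ext x
    simp [F0, deriv_smoothStep_eq_zero_of_lt ht]
  have hgt : ∀ t, 2 / 3 < t → F0 t = 0 := fun t ht => by
    ext x
    simp [F0, deriv_smoothStep_eq_zero_of_gt ht]
  let F : ℝ → M → ℝ := fun t => F0 (Int.fract t)
  -- The flow of the periodic extension picks up one factor `φ 1` in each period.
  let η : ℝ → Equiv.Perm M := fun t => φ (smoothStep (Int.fract t)) * φ 1 ^ ⌊t⌋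
  have hF : ∀ t₀, ∀ᶠ t in 𝓝 t₀, F t = F0 (t - ⌊t₀⌋) :=
    exists_floor_unwrap (fun t _ => F0 t)
      (fun t k ht => by rw [hlt t ht.2, hgt (t + 1) (by linarith [ht.1])])
      (fun t k ht => by rw [hlt t (by linarith [ht.2]), hgt (t + 1) (by linarith [ht.1])])
  have hη : ∀ t₀, ∀ᶠ t in 𝓝 t₀, η t = φ (smoothStep (t - ⌊t₀⌋)) * φ 1 ^ ⌊t₀⌋ := by
    refine exists_floor_unwrap (fun t k => φ (smoothStep t) * φ 1 ^ k) ?_ ?_ <;> intro t k ht <;>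
    · rw [smoothStep_eq_zero (by linarith [ht.2]), smoothStep_eq_one (t := t + 1)
        (by linarith [ht.1]), hφ.1, one_mul, add_comm k 1, zpow_one_add]
  refine ⟨F, ⟨⟨fun p => ?_, C, hC, hCU, fun t x hx => ?_⟩, fun t x => ?_⟩, η,
    isHamIsotopy_iff.2 ⟨?_, fun t x => ?_⟩, ?_⟩
  · have h1 : ContMDiff (𝓘(ℝ, ℝ).prod (𝓡 (2 * n))) 𝓘(ℝ, ℝ) ∞
        (fun q : ℝ × M => F0 (q.1 - ⌊p.1⌋) q.2) := by
      refine hF0.comp (ContMDiff.prodMk ?_ contMDiff_snd)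
      exact ContMDiff.sub contMDiff_fst contMDiff_const
    refine h1.contMDiffAt.congr_of_eventuallyEq ?_
    filter_upwards [continuousAt_fst.eventually (hF p.1)] with q hq
    rw [hq]
  · simp only [F, F0, hHC _ (smoothStep_mem_Icc _) x hx, mul_zero]
  · simp only [F, Int.fract_add_one]
  · simp [η, smoothStep_eq_zero, hφ.1]
  · have h1 := (hF t).self_of_nhds
    have h2 := (hη t).self_of_nhds
    set k := ⌊t⌋
    have h3 : (fun s => η s x) =ᶠ[𝓝 t] fun s => φ (smoothStep (s - k)) ((φ 1 ^ k) x) := by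
      filter_upwards [hη t] with s hs
      rw [hs]
      rfl
    have hb : HasDerivAt (fun s : ℝ => smoothStep (s - k)) (deriv smoothStep (t - k)) t :=
      HasDerivAt.comp_sub_const t (k : ℝ)
        (contDiff_smoothStep.differentiable (by simp) _).hasDerivAt
    have h4 := hasMFDerivAt_comp_of_hasDerivAt (γ := fun r => φ r ((φ 1 ^ k) x))
      (b := fun s : ℝ => smoothStep (s - k))
      ((isHamIsotopy_iff.1 hφ).2 (smoothStep (t - k)) ((φ 1 ^ k) x)) hb
    rw [← hamField_const_mul ((contMDiff_slice hH _).mdifferentiableAt (by simp))] at h4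
    rw [h1, h2]
    exact h4.congr_of_eventuallyEq h3
  · simp [η, smoothStep_eq_zero, hφ.1]

theorem isHamIsotopy_zero (Ω : SymplecticForm n M) :
    IsHamIsotopy Ω (fun _ => (0 : M → ℝ)) (fun _ => 1) := by
  refine isHamIsotopy_iff.2 ⟨rfl, fun t x => ?_⟩
  rw [hamField_eq_zero Ω (EventuallyEq.refl _ _)]
  have h : HasMFDerivAt 𝓘(ℝ, ℝ) (𝓡 (2 * n)) (fun _ : ℝ => x) t 0 := hasMFDerivAt_const x t
  exact h.congr_mfderiv (smulRight_one_eq (E := Model n) rfl)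

variable [T2Space M]

/-- The quotient is generated by `T B ∘ φ_{Ts}`, whose support is a small displacement of that of
`B`; the tube lemma keeps it inside `U` for small `T`. -/
theorem exists_inv_mul_mem_hamOn {U C : Set M} (hU : IsOpen U) (hC : IsCompact C) (hCU : C ⊆ U)
    (hA : ContMDiff (𝓡 (2 * n)) 𝓘(ℝ, ℝ) ∞ A) (hB : ContMDiff (𝓡 (2 * n)) 𝓘(ℝ, ℝ) ∞ B)
    (hBC : ∀ x ∉ C, B x = 0) (hφ : IsHamIsotopy Ω (fun _ => A) φ)
    (hχ : IsHamIsotopy Ω (fun _ => A + B) χ) :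
    ∃ ε > 0, ∀ T, |T| ≤ ε → (φ T)⁻¹ * χ T ∈ hamOn Ω U := by
  have hcont : Continuous fun p : ℝ × M => φ p.1 p.2 := (hφ.contMDiff hA).continuous
  obtain ⟨V, W, hV, -, h0V, hCW, hVW⟩ := generalized_tube_lemma (s := {(0 : ℝ)}) (t := C)
    isCompact_singleton hC (hU.preimage hcont) (by
      rintro ⟨t, x⟩ ⟨rfl, hx⟩
      simpa [hφ.zero_apply] using hCU hx)
  obtain ⟨ε, hε, hεV⟩ := Metric.isOpen_iff.1 hV 0 (h0V rfl)
  refine ⟨ε / 2, by positivity, fun T hT => ?_⟩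
  have hsmall : ∀ t ∈ Icc (-(ε / 2)) (ε / 2), t ∈ V := fun t ht => hεV <| by
    rw [Metric.mem_ball, dist_zero_right, Real.norm_eq_abs]
    linarith [abs_le.2 ht]
  have hiso := hφ.inv_mul hA hB hχ T
  -- The flow-out of `C` over `|t| ≤ ε/2` is a single compact set containing the supports for all `s
  -- ∈ [0, 1]`.
  have hmem := mem_hamOn_of_isotopy (U := U)
    (C := (fun p : ℝ × M => φ p.1 p.2) '' (Icc (-(ε / 2)) (ε / 2) ×ˢ C)) ?_
    ((isCompact_Icc.prod hC).image hcont) ?_ ?_ hiso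
  · simpa only [mul_one] using hmem
  · have h1 : ContMDiff (𝓘(ℝ, ℝ).prod (𝓡 (2 * n))) (𝓘(ℝ, ℝ).prod (𝓡 (2 * n))) ∞
        (fun p : ℝ × M => (T * p.1, p.2)) :=
      (contMDiff_const.mul contMDiff_fst).prodMk contMDiff_snd
    exact contMDiff_const.mul (hB.comp ((hφ.contMDiff hA).comp h1))
  · rintro _ ⟨⟨t, x⟩, ⟨ht, hx⟩, rfl⟩
    exact hVW ⟨hsmall t ht, hCW hx⟩
  · intro s hs x hx
    rw [hBC, mul_zero]
    intro hx'
    refine hx ⟨(-(T * s), φ (T * s) x), ⟨abs_le.1 ?_, hx'⟩, ?_⟩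
    · rw [abs_neg, abs_mul, abs_of_nonneg hs.1]
      calc |T| * s ≤ |T| * 1 := by gcongr; exact hs.2
        _ ≤ ε / 2 := by linarith
    · change φ (-(T * s)) (φ (T * s) x) = x
      rw [← hφ.add_apply hA, neg_add_cancel, hφ.zero_apply]

/-- `θ` is a product of at most `m` elements of the sets `Ham(U_l)`. -/
def IsFragmented (Ω : SymplecticForm n M) {Λ : Type*} (U : Λ → Set M) (m : ℕ)
    (θ : Equiv.Perm M) : Prop :=
  ∃ L : List (Equiv.Perm M), (∀ ψ ∈ L, ∃ l, ψ ∈ hamOn Ω (U l)) ∧ L.prod = θ ∧ L.length ≤ m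

omit [T2Space M] in
theorem IsFragmented.mul {Λ : Type*} {U : Λ → Set M} {m m' : ℕ} {θ θ' : Equiv.Perm M}
    (h : IsFragmented Ω U m θ) (h' : IsFragmented Ω U m' θ') :
    IsFragmented Ω U (m + m') (θ * θ') := by
  obtain ⟨L, hL, rfl, hm⟩ := h
  obtain ⟨L', hL', rfl, hm'⟩ := h'
  refine ⟨L ++ L', fun ψ hψ => ?_, List.prod_append, by rw [List.length_append]; omega⟩
  exact (List.mem_append.1 hψ).elim (hL ψ) (hL' ψ)

omit [T2Space M] in
theorem IsFragmented.one {Λ : Type*} {U : Λ → Set M} : IsFragmented Ω U 0 1 :=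
  ⟨[], by simp, rfl, le_rfl⟩

omit [T2Space M] in
theorem IsFragmented.pow {Λ : Type*} {U : Λ → Set M} {m : ℕ} {θ : Equiv.Perm M}
    (h : IsFragmented Ω U m θ) (k : ℕ) : IsFragmented Ω U (k * m) (θ ^ k) := by
  induction k with
  | zero => simpa using IsFragmented.one
  | succ k ih =>
    rw [add_mul, one_mul, pow_succ]
    exact ih.mul h

/-- Adding a summand costs one factor: `χ T = φ T * ((φ T)⁻¹ * χ T)`, with `φ` the flow of the
previous partial sum. -/
theorem exists_isFragmented_of_sum {Λ : Type*} {U : Λ → Set M} (hU : ∀ l, IsOpen (U l))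
    (D : List (M → ℝ)) (hD : ∀ B ∈ D, ContMDiff (𝓡 (2 * n)) 𝓘(ℝ, ℝ) ∞ B ∧
      ∃ l, ∃ C, IsCompact C ∧ C ⊆ U l ∧ ∀ x ∉ C, B x = 0) :
    ∃ ε > 0, ∀ T φ, |T| ≤ ε → IsHamIsotopy Ω (fun _ => D.sum) φ →
      IsFragmented Ω U D.length (φ T) := by
  -- The induction also carries smoothness and compact support, which guarantee that the partial
  -- sums have flows.
  suffices h : ContMDiff (𝓡 (2 * n)) 𝓘(ℝ, ℝ) ∞ D.sum ∧
      (∃ C, IsCompact C ∧ ∀ x ∉ C, D.sum x = 0) ∧ ∃ ε > 0, ∀ T φ, |T| ≤ ε →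
      IsHamIsotopy Ω (fun _ => D.sum) φ → IsFragmented Ω U D.length (φ T) from h.2.2
  induction D with
  | nil =>
    have h0 : ContMDiff (𝓡 (2 * n)) 𝓘(ℝ, ℝ) ∞ (0 : M → ℝ) := contMDiff_const
    change ContMDiff (𝓡 (2 * n)) 𝓘(ℝ, ℝ) ∞ (0 : M → ℝ) ∧ _
    refine ⟨h0, ⟨∅, isCompact_empty, fun _ _ => rfl⟩, 1, one_pos, fun T φ _ hφ => ?_⟩
    rw [IsHamIsotopy.unique h0 hφ (isHamIsotopy_zero Ω)]
    exact IsFragmented.one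
  | cons B D ih =>
    obtain ⟨hA, ⟨C₁, hC₁, hAC⟩, ε₁, hε₁, hfrag⟩ := ih fun B hB => hD B (List.mem_cons_of_mem _ hB)
    obtain ⟨hB, l, C, hC, hCU, hBC⟩ := hD B List.mem_cons_self
    have hsum : (B :: D).sum = D.sum + B := by rw [List.sum_cons, add_comm]
    have hAB : ContMDiff (𝓡 (2 * n)) 𝓘(ℝ, ℝ) ∞ (D.sum + B) := hA.add hB
    have hABC : ∀ x ∉ C₁ ∪ C, (D.sum + B) x = 0 := fun x hx => by
      rw [Pi.add_apply, hAC x fun h => hx (Or.inl h), hBC x fun h => hx (Or.inr h), add_zero]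
    rw [hsum]
    refine ⟨hAB, ⟨_, hC₁.union hC, hABC⟩, ?_⟩
    obtain ⟨φ, hφ⟩ := exists_isHamIsotopy Ω hA hC₁ hAC
    obtain ⟨χ, hχ⟩ := exists_isHamIsotopy Ω hAB (hC₁.union hC) hABC
    obtain ⟨ε₂, hε₂, hmem⟩ := exists_inv_mul_mem_hamOn (hU l) hC hCU hA hB hBC hφ hχ
    refine ⟨min ε₁ ε₂, lt_min hε₁ hε₂, fun T χ' hT hχ' => ?_⟩
    rw [hχ'.unique hAB hχ, ← mul_inv_cancel_left (φ T) (χ T)]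
    refine (hfrag T φ (hT.trans (min_le_left _ _)) hφ).mul ⟨[(φ T)⁻¹ * χ T], ?_, by simp, le_rfl⟩
    intro ψ hψ
    rw [List.mem_singleton.1 hψ]
    exact ⟨l, hmem T (hT.trans (min_le_right _ _))⟩

/-- The flow of an autonomous Hamiltonian with compact support is, for small times, a product of a
fixed number of Hamiltonian diffeomorphisms supported in members of an open cover. -/
theorem exists_isFragmented [SecondCountableTopology M] {Λ : Type*} {U : Λ → Set M}
    (hU : ∀ l, IsOpen (U l)) (hUcover : ⋃ l, U l = univ)
    (hA : ContMDiff (𝓡 (2 * n)) 𝓘(ℝ, ℝ) ∞ A) {C : Set M} (hC : IsCompact C)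
    (hAC : ∀ x ∉ C, A x = 0) (hφ : IsHamIsotopy Ω (fun _ => A) φ) :
    ∃ m, ∃ ε > 0, ∀ T, |T| ≤ ε → IsFragmented Ω U m (φ T) := by
  have := ChartedSpace.locallyCompactSpace (Model n) M
  obtain ⟨ρ, hρ⟩ := SmoothPartitionOfUnity.exists_isSubordinate (𝓡 (2 * n)) isClosed_univ U hU
    hUcover.ge
  -- By local finiteness only finitely many partition functions meet `C`, so finitely many pieces
  -- sum to `A` even if the cover is infinite.
  have hfin : {i | (Function.support (ρ i) ∩ C).Nonempty}.Finite :=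
    ρ.locallyFinite.finite_nonempty_inter_compact hC
  set s := hfin.toFinset
  let D : List (M → ℝ) := s.toList.map fun i x => ρ i x * A x
  have hDsum : D.sum = A := by
    rw [Finset.sum_map_toList]
    ext x
    rw [Finset.sum_apply, ← Finset.sum_mul]
    by_cases hx : x ∈ C
    · have h1 := ρ.sum_eq_one (mem_univ x)
      rw [finsum_eq_sum_of_support_subset (s := s)] at h1
      · rw [h1, one_mul]
      · intro i hi
        simp only [s, Set.Finite.coe_toFinset, mem_ofPred_eq]
        exact ⟨x, hi, hx⟩
    · rw [hAC x hx, mul_zero]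
  obtain ⟨ε, hε, h⟩ := exists_isFragmented_of_sum (Ω := Ω) hU D fun B hB => by
    obtain ⟨i, -, rfl⟩ := List.mem_map.1 hB
    refine ⟨(ρ i).contMDiff.mul hA, i, C ∩ tsupport (ρ i), hC.inter_right (isClosed_tsupport _),
      inter_subset_right.trans (hρ i), fun x hx => ?_⟩
    change ρ i x * A x = 0
    by_cases hxC : x ∈ C
    · rw [image_eq_zero_of_notMem_tsupport fun h => hx ⟨hxC, h⟩, zero_mul]
    · rw [hAC x hxC, mul_zero]
  exact ⟨_, ε, hε, fun T hT => h T φ hT (by rwa [hDsum])⟩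

end Fragmentation

/-! ### Positivity of the Liouville measure -/

section Liouville

variable {n : ℕ} {M : Type*} [TopologicalSpace M] [ChartedSpace (Model n) M]
  [IsManifold (𝓡 (2 * n)) ∞ M] (Ω : SymplecticForm n M)

theorem det_chartMatrix_ne_zero {x₀ : M} {y : Model n}
    (hy : y ∈ (extChartAt (𝓡 (2 * n)) x₀).target) : (chartMatrix Ω x₀ y).det ≠ 0 := by
  intro hdet
  obtain ⟨v, hv, hvM⟩ := Matrix.exists_vecMul_eq_zero_iff.2 hdet
  let u : Model n := WithLp.toLp 2 v
  have hu : u = ∑ i, v i • EuclideanSpace.single i (1 : ℝ) := by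
    ext j
    simp [u, Finset.sum_apply, Pi.single_apply]
  have h1 : ∀ j, chartForm Ω x₀ y u (EuclideanSpace.single j 1) = 0 := fun j => by
    rw [hu, map_sum, sum_apply]
    refine Eq.trans ?_ (congrFun hvM j)
    refine Finset.sum_congr rfl fun i _ => ?_
    rw [map_smul]
    rfl
  have h2 : chartForm Ω x₀ y u = 0 := by
    refine ContinuousLinearMap.coe_injective ((EuclideanSpace.basisFun _ ℝ).toBasis.ext fun j => ?_)
    simpa using h1 j
  have h3 := chartForm_injective Ω hy (u := u) fun v => by rw [h2]; rfl
  exact hv (congrArg WithLp.ofLp h3)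

theorem continuousOn_det_chartMatrix (x₀ : M) :
    ContinuousOn (fun y => (chartMatrix Ω x₀ y).det) (extChartAt (𝓡 (2 * n)) x₀).target :=
  (continuous_id.matrix_det).comp_continuousOn <| continuousOn_pi.2 fun _ =>
    continuousOn_pi.2 fun _ => (contDiffOn_localCoeff Ω x₀ _ _).continuousOn

variable [MeasurableSpace M] [BorelSpace M]

/-- One chart suffices, since the Liouville measure dominates each `chartVolume`, and there the
density is nowhere zero by nondegeneracy. -/
theorem liouville_ne_zero_of_isOpen {V : Set M} (hV : IsOpen V) (hne : V.Nonempty) :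
    liouville Ω V ≠ 0 := by
  obtain ⟨x₀, hx₀⟩ := hne
  have hle : chartVolume Ω x₀ V ≤ liouville Ω V :=
    Measure.le_iff'.1 (le_iSup (fun x => chartVolume Ω x) x₀) V
  refine fun h0 => absurd (le_antisymm (hle.trans h0.le) zero_le) ?_
  set e := extChartAt (𝓡 (2 * n)) x₀ with he
  have ho : IsOpen e.target := isOpen_extChartAt_target x₀
  have hsymm : ContinuousOn e.symm e.target := continuousOn_extChartAt_symm x₀
  have hdens : AEMeasurable (fun y => ENNReal.ofReal (Real.sqrt |(chartMatrix Ω x₀ y).det|))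
      (volume.restrict e.target) :=
    ((continuousOn_det_chartMatrix Ω x₀).aemeasurable ho.measurableSet).norm.sqrt.ennreal_ofReal
  rw [chartVolume, Measure.map_apply_of_aemeasurable ((hsymm.aemeasurable ho.measurableSet).mono_ac
    (withDensity_absolutelyContinuous _ _)) hV.measurableSet, withDensity_apply_eq_zero' hdens]
  have hS := hsymm.isOpen_inter_preimage ho hV
  have hne : (e.target ∩ e.symm ⁻¹' V).Nonempty := by
    refine ⟨e x₀, mem_extChartAt_target x₀, ?_⟩
    rwa [mem_preimage, e.left_inv (mem_extChartAt_source x₀)]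
  intro h
  refine (hS.measure_pos volume hne).ne' ?_
  have h1 : volume.restrict e.target (e.target ∩ e.symm ⁻¹' V) = 0 := by
    refine measure_mono_null ?_ h
    rintro y ⟨hy, hyV⟩
    refine ⟨?_, hyV⟩
    have : 0 < Real.sqrt |(chartMatrix Ω x₀ y).det| :=
      Real.sqrt_pos.2 (abs_pos.2 (det_chartMatrix_ne_zero Ω hy))
    exact (ENNReal.ofReal_pos.2 this).ne'
  rwa [Measure.restrict_apply hS.measurableSet, inter_eq_left.2 inter_subset_left] at h1

end Liouville

/-! ### Functions which are locally constant on disjoint compact sets -/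

section Separation

/-- A combination of smooth cut-offs, one per `X i`; each also vanishes off the interior of a
compact neighbourhood `C` of the union, which gives compact support. -/
theorem exists_contMDiff_eq_on_compacts {n : ℕ} {M : Type*} [TopologicalSpace M] [T2Space M]
    [SecondCountableTopology M] [ChartedSpace (Model n) M] [IsManifold (𝓡 (2 * n)) ∞ M]
    {ι : Type*} [Fintype ι] {X : ι → Set M} (hX : ∀ i, IsCompact (X i))
    (hdisj : Pairwise fun i j => Disjoint (X i) (X j)) (a : ι → ℝ) :
    ∃ f : M → ℝ, ContMDiff (𝓡 (2 * n)) 𝓘(ℝ, ℝ) ∞ f ∧ (∃ C, IsCompact C ∧ ∀ x ∉ C, f x = 0) ∧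
      ∀ i, ∀ x ∈ X i, f x = a i := by
  classical
  have := ChartedSpace.locallyCompactSpace (Model n) M
  obtain ⟨C, hC, hXC⟩ := exists_compact_superset (isCompact_iUnion hX)
  have hρ : ∀ i, ∃ ρ : M → ℝ, ContMDiff (𝓡 (2 * n)) 𝓘(ℝ, ℝ) ∞ ρ ∧ (∀ x ∉ C, ρ x = 0) ∧
      ∀ j, ∀ x ∈ X j, ρ x = if j = i then 1 else 0 := by
    intro i
    obtain ⟨ρ, h0, h1, -⟩ := exists_contMDiffMap_zero_one_of_isClosed (n := ⊤) (𝓡 (2 * n))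
      (s := (interior C)ᶜ ∪ ⋃ j : {j // j ≠ i}, X j) (t := X i)
      (isOpen_interior.isClosed_compl.union (isClosed_iUnion_of_finite fun j => (hX j).isClosed))
      (hX i).isClosed (by
        refine disjoint_union_left.2 ⟨?_, disjoint_iUnion_left.2 fun j => hdisj j.2⟩
        exact disjoint_compl_left_iff_subset.2 ((subset_iUnion X i).trans hXC))
    refine ⟨ρ, ρ.contMDiff, fun x hx => h0 (Or.inl fun h => hx (interior_subset h)),
      fun j x hx => ?_⟩
    split_ifs with hji
    · subst hji
      exact h1 hx
    · exact h0 (Or.inr (mem_iUnion.2 ⟨⟨j, hji⟩, hx⟩))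
  choose ρ hs hC0 hval using hρ
  refine ⟨fun x => ∑ i, a i * ρ i x, ?_, ⟨C, hC, fun x hx => ?_⟩, fun j x hx => ?_⟩
  · exact contMDiff_finsetSum fun i _ => contMDiff_const.mul (hs i)
  · exact Finset.sum_eq_zero fun i _ => by rw [hC0 i x hx, mul_zero]
  · simp [hval _ j x hx]

theorem integrable_polynomial_comp {M : Type*} [TopologicalSpace M] [T2Space M]
    [MeasurableSpace M] [BorelSpace M] (μ : Measure M) [IsFiniteMeasure μ] {f : M → ℝ}
    (hf : Continuous f) {C : Set M} (hC : IsCompact C) (hfC : ∀ x ∉ C, f x = 0) {p : Polynomial ℝ}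
    (hp : p.eval 0 = 0) : Integrable (fun x => p.eval (f x)) μ :=
  Continuous.integrable_of_hasCompactSupport (p.continuous.comp hf)
    (HasCompactSupport.intro hC fun x hx => by rw [hfC x hx, hp])

/-- Polynomials dual to the nodes `0, …, N` whose composition with `f` has mean zero. -/
theorem exists_dual_polynomials {M : Type*} [TopologicalSpace M] [T2Space M] [PreconnectedSpace M]
    [MeasurableSpace M] [BorelSpace M] (μ : Measure M) [IsFiniteMeasure μ]
    (hμ : ∀ V : Set M, IsOpen V → V.Nonempty → μ V ≠ 0) {f : M → ℝ} (hf : Continuous f)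
    {C : Set M} (hC : IsCompact C) (hfC : ∀ x ∉ C, f x = 0) {x₀ x₁ : M} (h0 : f x₀ = 0)
    (h1 : f x₁ = 1) (N : ℕ) :
    ∃ p : Fin N → Polynomial ℝ, ∀ i, (∀ j : Fin (N + 1), (p i).eval (j : ℝ) =
      if j = i.succ then 1 else 0) ∧ ∫ x, (p i).eval (f x) ∂μ = 0 := by
  let v : Fin (N + 1) → ℝ := fun j => (j : ℝ)
  have hv : InjOn v (Finset.univ : Finset (Fin (N + 1))) := fun i _ j _ hij =>
    Fin.ext (Nat.cast_injective (R := ℝ) hij)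
  let w : Polynomial ℝ := Lagrange.nodal Finset.univ v
  have hw : ∀ j, w.eval (v j) = 0 := fun j => Lagrange.eval_nodal_at_node (Finset.mem_univ j)
  have hv0 : v 0 = 0 := by simp [v]
  have hint := fun p => integrable_polynomial_comp μ hf hC hfC (p := p)
  have hw0 : (w ^ 2).eval 0 = 0 := by
    have := hw 0
    rw [hv0] at this
    simp [this]
  -- On the open set `0 < f < 1` there is no node, so `w ∘ f` is nonzero; the set is nonempty by the
  -- intermediate value theorem.
  have hpos : 0 < ∫ x, (w ^ 2).eval (f x) ∂μ := by
    rw [integral_pos_iff_support_of_nonneg (fun x => by simpa using sq_nonneg _) (hint _ hw0)]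
    refine pos_iff_ne_zero.2 ?_
    have hV : IsOpen (f ⁻¹' Ioo 0 1) := isOpen_Ioo.preimage hf
    have hne : (f ⁻¹' Ioo 0 1).Nonempty := by
      have : Icc (f x₀) (f x₁) ⊆ range f := intermediate_value_univ x₀ x₁ hf
      rw [h0, h1] at this
      obtain ⟨x, hx⟩ := this (show (1 / 2 : ℝ) ∈ Icc 0 1 by norm_num)
      refine ⟨x, ?_⟩
      rw [mem_preimage, hx]
      norm_num
    refine fun h => hμ _ hV hne (measure_mono_null (fun x hx => ?_) h)
    rw [Function.mem_support, Polynomial.eval_pow]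
    refine pow_ne_zero 2 ?_
    rw [Lagrange.eval_nodal]
    refine Finset.prod_ne_zero_iff.2 fun j _ => sub_ne_zero.2 fun hj => ?_
    change f x = ((j : ℕ) : ℝ) at hj
    have hj0 : (0 : ℝ) < (j : ℕ) := by rw [← hj]; exact hx.1
    have hj1 : ((j : ℕ) : ℝ) < 1 := by rw [← hj]; exact hx.2
    have : 0 < (j : ℕ) := by exact_mod_cast hj0
    have : (j : ℕ) < 1 := by exact_mod_cast hj1
    omega
  let ℓ : Fin N → Polynomial ℝ := fun i => Lagrange.basis Finset.univ v i.succ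
  have hℓ : ∀ i j, (ℓ i).eval (v j) = if j = i.succ then 1 else 0 := fun i j => by
    split_ifs with h
    · rw [h]
      exact Lagrange.eval_basis_self hv (Finset.mem_univ _)
    · exact Lagrange.eval_basis_of_ne (fun h' => h h'.symm) (Finset.mem_univ _)
  have hℓ0 : ∀ i, (ℓ i).eval 0 = 0 := fun i => by
    have := hℓ i 0
    rwa [hv0, if_neg (Fin.succ_ne_zero i).symm] at this
  -- This multiple of `w ^ 2` cancels the mean and, since `w` vanishes at every node, leaves the
  -- nodal values unchanged.
  let a : Fin N → ℝ := fun i => (∫ x, (ℓ i).eval (f x) ∂μ) / ∫ x, (w ^ 2).eval (f x) ∂μ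
  refine ⟨fun i => ℓ i - Polynomial.C (a i) * w ^ 2, fun i => ⟨fun j => ?_, ?_⟩⟩
  · have h1 := hw j
    have h2 := hℓ i j
    simp only [v] at h1 h2
    simp [h1, h2]
  · simp only [Polynomial.eval_sub, Polynomial.eval_mul, Polynomial.eval_C]
    rw [integral_sub (hint _ (hℓ0 i)) ((hint _ hw0).const_mul _), integral_const_mul,
      div_mul_cancel₀ _ hpos.ne', sub_self]

end Separation

/-! ### Reparametrized autonomous flows -/

section Shear

variable {n : ℕ} {M : Type*} [TopologicalSpace M] [T2Space M] [ChartedSpace (Model n) M]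
  [IsManifold (𝓡 (2 * n)) ∞ M] {Ω : SymplecticForm n M} {f : M → ℝ} {φ : ℝ → Equiv.Perm M}

/-- The diffeomorphism that moves `x` for time `h (f x)` along the Hamiltonian flow of `f`. -/
def shear (hf : ContMDiff (𝓡 (2 * n)) 𝓘(ℝ, ℝ) ∞ f) (hφ : IsHamIsotopy Ω (fun _ => f) φ)
    (h : ℝ → ℝ) : Equiv.Perm M where
  toFun x := φ (h (f x)) x
  invFun x := φ (-h (f x)) x
  left_inv x := by
    change φ (-h (f (φ (h (f x)) x))) (φ (h (f x)) x) = x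
    rw [hφ.apply_eq hf, ← hφ.add_apply hf, neg_add_cancel, hφ.zero_apply]
  right_inv x := by
    change φ (h (f (φ (-h (f x)) x))) (φ (-h (f x)) x) = x
    rw [hφ.apply_eq hf, ← hφ.add_apply hf, add_neg_cancel, hφ.zero_apply]

/-- Moving a point by one shear does not change its `f`-value, so the times of two successive shears
add. -/
theorem shear_add (hf : ContMDiff (𝓡 (2 * n)) 𝓘(ℝ, ℝ) ∞ f) (hφ : IsHamIsotopy Ω (fun _ => f) φ)
    (h k : ℝ → ℝ) : shear hf hφ (h + k) = shear hf hφ h * shear hf hφ k := by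
  ext x
  change φ (h (f x) + k (f x)) x = φ (h (f (φ (k (f x)) x))) (φ (k (f x)) x)
  rw [hφ.apply_eq hf, hφ.add_apply hf]

theorem shear_zero (hf : ContMDiff (𝓡 (2 * n)) 𝓘(ℝ, ℝ) ∞ f)
    (hφ : IsHamIsotopy Ω (fun _ => f) φ) : shear hf hφ 0 = 1 := by
  ext x
  exact hφ.zero_apply x

/-- The Hamiltonian isotopy of `g ∘ f`. -/
theorem isHamIsotopy_shear (hf : ContMDiff (𝓡 (2 * n)) 𝓘(ℝ, ℝ) ∞ f)
    (hφ : IsHamIsotopy Ω (fun _ => f) φ) {g g' : ℝ → ℝ} (hg : ∀ s, HasDerivAt g (g' s) s) :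
    IsHamIsotopy Ω (fun _ x => g (f x)) (fun t => shear hf hφ fun s => t * g' s) := by
  refine isHamIsotopy_iff.2 ⟨?_, fun t x => ?_⟩
  · simpa only [zero_mul] using! shear_zero hf hφ
  · have hb : HasDerivAt (fun r : ℝ => r * g' (f x)) (g' (f x)) t := by
      simpa using (hasDerivAt_id t).mul_const (g' (f x))
    have h1 := hasMFDerivAt_comp_of_hasDerivAt (γ := fun r => φ r x)
      (b := fun r : ℝ => r * g' (f x))
      (hφ.isMIntegralCurve x (t * g' (f x))) hb
    rw [hamField_comp (hf.mdifferentiableAt (by simp)) (hg _)]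
    change HasMFDerivAt 𝓘(ℝ, ℝ) (𝓡 (2 * n)) (fun r => φ (r * g' (f x)) x) t
      ((1 : ℝ →L[ℝ] ℝ).smulRight (g' (f (φ (t * g' (f x)) x)) •
        hamField Ω f (φ (t * g' (f x)) x)))
    rw [hφ.apply_eq hf]
    exact h1

end Shear

/-! ### Lifts to the universal cover and their asymptotic invariants -/

section Lifts

variable {n : ℕ} {M : Type*} [TopologicalSpace M] [ChartedSpace (Model n) M]
  [IsManifold (𝓡 (2 * n)) ∞ M] {Ω : SymplecticForm n M}

omit [IsManifold (𝓡 (2 * n)) ∞ M] in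
theorem autonomous_mem_periodicHam {A : M → ℝ} (hA : ContMDiff (𝓡 (2 * n)) 𝓘(ℝ, ℝ) ∞ A)
    {C : Set M} (hC : IsCompact C) (hAC : ∀ x ∉ C, A x = 0) :
    (fun _ => A) ∈ periodicHam n (univ : Set M) :=
  ⟨⟨hA.comp contMDiff_snd, C, hC, subset_univ C, fun _ => hAC⟩, fun _ _ => rfl⟩

theorem apply_one_mem_Ham {U : Set M} {H : ℝ → M → ℝ} {φ : ℝ → Equiv.Perm M}
    (hH : H ∈ periodicHam n U) (hφ : IsHamIsotopy Ω H φ) : φ 1 ∈ Ham Ω :=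
  (proj Ω (tildeOf Ω hH hφ)).2

theorem coe_proj_tildeOf {U : Set M} {H : ℝ → M → ℝ} {φ : ℝ → Equiv.Perm M}
    (hH : H ∈ periodicHam n U) (hφ : IsHamIsotopy Ω H φ) :
    (proj Ω (tildeOf Ω hH hφ) : Equiv.Perm M) = φ 1 := rfl

section Reverse

variable {U : Set M} {F : ℝ → M → ℝ} {φ : ℝ → Equiv.Perm M}

omit [IsManifold (𝓡 (2 * n)) ∞ M] in
theorem reverse_mem_periodicHam (hF : F ∈ periodicHam n U) :
    (fun t x => -F (1 - t) x) ∈ periodicHam n U := by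
  obtain ⟨⟨hs, C, hC, hCU, hFC⟩, hper⟩ := hF
  refine ⟨⟨?_, C, hC, hCU, fun t x hx => neg_eq_zero.2 (hFC _ x hx)⟩, fun t x => ?_⟩
  · exact (hs.comp ((contMDiff_const.sub contMDiff_fst).prodMk contMDiff_snd)).neg
  · have := hper (1 - (t + 1)) x
    rw [show 1 - (t + 1) + 1 = 1 - t by ring] at this
    exact congrArg Neg.neg this.symm

/-- Running the path backwards and translating it to start at the identity yields a path ending at
`(φ 1)⁻¹`, generated in the same open set. This is how the bounded spectrum condition is applied to
inverses. -/
theorem IsHamIsotopy.reverse (hF : F ∈ periodicHam n U) (hφ : IsHamIsotopy Ω F φ) :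
    IsHamIsotopy Ω (fun t x => -F (1 - t) x) (fun t => φ (1 - t) * (φ 1)⁻¹) := by
  refine isHamIsotopy_iff.2 ⟨by simp, fun t x => ?_⟩
  have hb : HasDerivAt (fun s : ℝ => 1 - s) (-1) t := by
    simpa using (hasDerivAt_id t).const_sub 1
  have h1 := hasMFDerivAt_comp_of_hasDerivAt (γ := fun r => φ r ((φ 1)⁻¹ x))
    ((isHamIsotopy_iff.1 hφ).2 (1 - t) ((φ 1)⁻¹ x)) hb
  rw [← hamField_const_mul ((contMDiff_slice hF.1.1 _).mdifferentiableAt (by simp))] at h1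
  simp only [neg_one_mul] at h1
  exact h1

theorem meanValue_reverse [MeasurableSpace M] (Ω : SymplecticForm n M) (F : ℝ → M → ℝ) :
    meanValue Ω (fun t x => -F (1 - t) x) = -meanValue Ω F := by
  simp only [meanValue, integral_neg, intervalIntegral.integral_neg, mul_neg]
  rw [intervalIntegral.integral_comp_sub_left (fun t => ∫ x, F t x ∂liouville Ω) 1]
  norm_num

end Reverse

theorem IsSubadditiveInvariant.stab_le {c : HamTilde Ω → ℝ} (hc : IsSubadditiveInvariant Ω c)
    (g : HamTilde Ω) : stab Ω c g ≤ c g := by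
  -- The bound starts at exponent one: subadditivity gives `0 ≤ c 1`, but `c 1` may be positive.
  have h : ∀ k : ℕ, c (g ^ (k + 1)) ≤ (k + 1) * c g := by
    intro k
    induction k with
    | zero => simp
    | succ k ih =>
      have := hc (g ^ (k + 1)) g
      rw [← pow_succ] at this
      push_cast
      linarith
  refine le_of_tendsto (tendsto_stab Ω hc g) ?_
  filter_upwards [eventually_ge_atTop 1] with k hk
  obtain ⟨m, rfl⟩ := Nat.exists_eq_add_of_le' hk
  rw [div_le_iff₀ (by positivity), mul_comm]
  exact_mod_cast h m

theorem IsSubadditiveInvariant.stab_one {c : HamTilde Ω → ℝ} (hc : IsSubadditiveInvariant Ω c) :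
    stab Ω c 1 = 0 :=
  tendsto_nhds_unique (tendsto_stab Ω hc 1) (by
    simpa only [one_pow] using tendsto_const_div_atTop_nhds_zero_nat (c 1))

variable [MeasurableSpace M]

/-- For a Hamiltonian constant on `S¹ × X`, the lower and upper bounds of superheaviness meet. -/
theorem IsSuperheavy.stab_eq {c : HamTilde Ω → ℝ} {X : Set M} (hX : IsSuperheavy Ω c X)
    {H : ℝ → M → ℝ} {φ : ℝ → Equiv.Perm M} (hH : H ∈ periodicHam n univ)
    (hφ : IsHamIsotopy Ω H φ) (hmean : meanValue Ω H = 0) {r : ℝ}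
    (hr : ∀ t, ∀ x ∈ X, H t x = r) : stab Ω c (tildeOf Ω hH hφ) = r := by
  obtain ⟨h1, h2⟩ := hX.2 H φ hH hφ hmean
  refine le_antisymm (EReal.coe_le_coe_iff.1 (h2.trans ?_)) (EReal.coe_le_coe_iff.1 (le_trans ?_ h1))
  · exact iSup_le fun t => iSup₂_le fun x hx => by rw [hr t x hx]
  · exact le_iInf fun t => le_iInf₂ fun x hx => by rw [hr t x hx]

/-- Over the empty set the infimum is `⊤`, which cannot lie below a real number. -/
theorem IsSuperheavy.nonempty {c : HamTilde Ω → ℝ} {X : Set M} (hX : IsSuperheavy Ω c X) :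
    X.Nonempty := by
  rw [nonempty_iff_ne_empty]
  rintro rfl
  have h1 := (hX.2 _ _ (autonomous_mem_periodicHam (A := 0) contMDiff_const
    isCompact_empty fun _ _ => rfl) (isHamIsotopy_zero Ω) (by simp [meanValue])).1
  simp at h1

/-- A product of elements of the sets `Ham(U_l)` and its inverse have lifts on which the
stabilizations of the invariants `c i` are bounded in terms of the number of factors, up to opposite
errors which do not depend on `i`. -/
theorem exists_lifts_of_list {ι : Type*} {c : ι → HamTilde Ω → ℝ}
    (hc : ∀ i, IsSubadditiveInvariant Ω (c i)) {Λ : Type*} {U : Λ → Set M} {K : ι → ℝ}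
    (hK : ∀ i, 0 < K i) (hUK : ∀ i l, BoundedSpectrumWith Ω (c i) (U l) (K i))
    (L : List (Equiv.Perm M)) (hL : ∀ ψ ∈ L, ∃ l, ψ ∈ hamOn Ω (U l)) :
    ∃ g h : HamTilde Ω, ∃ a : ℝ, (proj Ω g : Equiv.Perm M) = L.prod ∧
      (proj Ω h : Equiv.Perm M) = L.prod⁻¹ ∧
      ∀ i, stab Ω (c i) g ≤ L.length * K i - a ∧ stab Ω (c i) h ≤ L.length * K i + a := by
  -- The trivial lifts are kept as a separate alternative because `c i 1 ≤ 0` may fail, whereas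
  -- `stab` vanishes at `1`.
  suffices hs : ∃ g h : HamTilde Ω, ∃ a : ℝ, (proj Ω g : Equiv.Perm M) = L.prod ∧
      (proj Ω h : Equiv.Perm M) = L.prod⁻¹ ∧ ((g = 1 ∧ h = 1 ∧ a = 0) ∨
      ∀ i, c i g ≤ L.length * K i - a ∧ c i h ≤ L.length * K i + a) by
    obtain ⟨g, h, a, hg, hh, ⟨rfl, rfl, rfl⟩ | hle⟩ := hs
    · refine ⟨1, 1, 0, hg, hh, fun i => ?_⟩
      have := mul_nonneg (Nat.cast_nonneg (α := ℝ) L.length) (hK i).le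
      rw [(hc i).stab_one]
      constructor <;> linarith
    · exact ⟨g, h, a, hg, hh, fun i =>
        ⟨((hc i).stab_le g).trans (hle i).1, ((hc i).stab_le h).trans (hle i).2⟩⟩
  induction L with
  | nil => exact ⟨1, 1, 0, by simp, by simp, Or.inl ⟨rfl, rfl, rfl⟩⟩
  | cons ψ L ih =>
    obtain ⟨g, h, a, hg, hh, hgh⟩ := ih fun θ hθ => hL θ (List.mem_cons_of_mem _ hθ)
    obtain ⟨l, F, hF, φ, hφ, rfl⟩ := hL ψ List.mem_cons_self
    set g' := tildeOf Ω hF hφ with hg'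
    set h' := tildeOf Ω (reverse_mem_periodicHam hF) (hφ.reverse hF) with hh'
    have hpg : (proj Ω g' : Equiv.Perm M) = φ 1 := coe_proj_tildeOf hF hφ
    have hph : (proj Ω h' : Equiv.Perm M) = (φ 1)⁻¹ := by
      refine (coe_proj_tildeOf (reverse_mem_periodicHam hF) (hφ.reverse hF)).trans ?_
      simp [hφ.1]
    have hcg : ∀ i, c i g' ≤ K i - meanValue Ω F := fun i => by linarith [hUK i l F φ hF hφ]
    have hch : ∀ i, c i h' ≤ K i + meanValue Ω F := fun i => by
      have := hUK i l _ _ (reverse_mem_periodicHam hF) (hφ.reverse hF)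
      rw [meanValue_reverse] at this
      linarith
    -- The error `a` accumulates the mean values of the factors; reversal changes their sign, and
    -- the lift of the inverse multiplies in the opposite order.
    refine ⟨g' * g, h * h', meanValue Ω F + a, ?_, ?_, Or.inr fun i => ?_⟩
    · rw [map_mul, Subgroup.coe_mul, hpg, hg, List.prod_cons]
    · rw [map_mul, Subgroup.coe_mul, hph, hh, List.prod_cons, mul_inv_rev]
    · rw [List.length_cons]
      push_cast
      rcases hgh with ⟨rfl, rfl, rfl⟩ | hle
      · have := mul_nonneg (Nat.cast_nonneg (α := ℝ) L.length) (hK i).le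
        rw [mul_one, one_mul]
        constructor <;> linarith [hcg i, hch i]
      · constructor
        · linarith [hc i g' g, hcg i, (hle i).1]
        · linarith [hc i h h', hch i, (hle i).2]

end Lifts

/-! ### The oscillation norm -/

section Osc

variable {N : ℕ} (r : Fin N → ℝ)

theorem abs_sub_le_osc (i j : Fin (N + 1)) :
    |(Fin.cons 0 r : Fin (N + 1) → ℝ) i - (Fin.cons 0 r : Fin (N + 1) → ℝ) j| ≤ osc r :=
  le_ciSup (f := fun p : Fin (N + 1) × Fin (N + 1) =>
    |(Fin.cons 0 r : Fin (N + 1) → ℝ) p.1 - (Fin.cons 0 r : Fin (N + 1) → ℝ) p.2|)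
    (Set.finite_range _).bddAbove (i, j)

theorem osc_nonneg : 0 ≤ osc r := (abs_nonneg _).trans (abs_sub_le_osc r 0 0)

theorem abs_le_osc (i : Fin N) : |r i| ≤ osc r := by
  simpa using abs_sub_le_osc r i.succ 0

theorem osc_le {b : ℝ} (h : ∀ i j : Fin (N + 1),
    (Fin.cons 0 r : Fin (N + 1) → ℝ) i - (Fin.cons 0 r : Fin (N + 1) → ℝ) j ≤ b) : osc r ≤ b :=
  ciSup_le fun p => abs_le.2 ⟨by linarith [h p.2 p.1], h p.1 p.2⟩

end Osc

/-! ### Attainment and linear upper bounds of the fragmentation norm -/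

section FragNorm

variable {n : ℕ} {M : Type*} [TopologicalSpace M] [ChartedSpace (Model n) M]
  [IsManifold (𝓡 (2 * n)) ∞ M] {Ω : SymplecticForm n M} {Λ : Type*} {U : Λ → Set M}

/-- The fragmentation norm is attained. -/
theorem IsFragmented.exists_fragNorm_eq {m : ℕ} {θ : Ham Ω}
    (h : IsFragmented Ω U m (θ : Equiv.Perm M)) :
    ∃ L : List (Equiv.Perm M), (∀ ψ ∈ L, ∃ l, ψ ∈ hamOn Ω (U l)) ∧ L.prod = θ ∧
      fragNorm Ω U θ = L.length ∧ L.length ≤ m := by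
  obtain ⟨L₀, h1, h2, h3⟩ := h
  have hmem : (L₀.length : ℕ∞) ∈ {m : ℕ∞ | ∃ L : List (Equiv.Perm M),
    (∀ ψ ∈ L, ∃ l, ψ ∈ hamOn Ω (U l)) ∧ L.prod = θ ∧ (L.length : ℕ∞) = m} := ⟨L₀, h1, h2, rfl⟩
  obtain ⟨L, hL1, hL2, hL3⟩ := csInf_mem ⟨_, hmem⟩
  refine ⟨L, hL1, hL2, hL3.symm, le_trans ?_ h3⟩
  have := sInf_le hmem
  rw [← hL3] at this
  exact_mod_cast this

/-- A small vector is a sum of small vectors along the axes, whose images are multiplied; the factor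
counts add up. -/
theorem exists_isFragmented_of_small {N : ℕ} (I : Multiplicative (Fin N → ℝ) →* Ham Ω)
    (hI : ∀ i, ∃ m, ∃ ε > 0, ∀ t, |t| ≤ ε →
      IsFragmented Ω U m (I (Multiplicative.ofAdd (Pi.single i t)) : Equiv.Perm M)) :
    ∃ m, ∃ ε > 0, ∀ r : Fin N → ℝ, (∀ i, |r i| ≤ ε) →
      IsFragmented Ω U m (I (Multiplicative.ofAdd r) : Equiv.Perm M) := by
  suffices h : ∀ s : Finset (Fin N), ∃ m, ∃ ε > 0, ∀ r : Fin N → ℝ, (∀ i, |r i| ≤ ε) →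
      IsFragmented Ω U m
        (I (Multiplicative.ofAdd (∑ i ∈ s, Pi.single i (r i))) : Equiv.Perm M) by
    obtain ⟨m, ε, hε, h⟩ := h Finset.univ
    refine ⟨m, ε, hε, fun r hr => ?_⟩
    have := h r hr
    rwa [Finset.univ_sum_single] at this
  intro s
  induction s using Finset.induction_on with
  | empty => exact ⟨0, 1, one_pos, fun r _ => by simpa using IsFragmented.one⟩
  | insert i s his ih =>
    obtain ⟨m, ε, hε, h⟩ := ih
    obtain ⟨m', ε', hε', h'⟩ := hI i
    refine ⟨m' + m, min ε' ε, lt_min hε' hε, fun r hr => ?_⟩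
    rw [Finset.sum_insert his, ofAdd_add, map_mul, Subgroup.coe_mul]
    exact (h' _ ((hr i).trans (min_le_left _ _))).mul
      (h r fun j => (hr j).trans (min_le_right _ _))

/-- Divide `r` by an integer `k` until it is small, fragment the image, and take the `k`-th power.
-/
theorem exists_isFragmented_le_osc {N : ℕ} (I : Multiplicative (Fin N → ℝ) →* Ham Ω)
    (hI : ∀ i, ∃ m, ∃ ε > 0, ∀ t, |t| ≤ ε →
      IsFragmented Ω U m (I (Multiplicative.ofAdd (Pi.single i t)) : Equiv.Perm M)) :
    ∃ A : ℝ, 0 ≤ A ∧ ∀ r : Fin N → ℝ, ∃ m : ℕ, (m : ℝ) ≤ A * (osc r + 1) ∧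
      IsFragmented Ω U m (I (Multiplicative.ofAdd r) : Equiv.Perm M) := by
  obtain ⟨m, ε, hε, h⟩ := exists_isFragmented_of_small I hI
  refine ⟨(ε⁻¹ + 1) * m, by positivity, fun r => ?_⟩
  -- The summand `1` makes `k` positive and strictly larger than `osc r / ε`, so the coordinates of
  -- `r / k` are at most `ε` in absolute value.
  set k := ⌊osc r / ε⌋₊ + 1 with hk
  have hk0 : (0 : ℝ) < k := by positivity
  have hk1 : osc r / ε < k := by exact_mod_cast Nat.lt_floor_add_one (osc r / ε)
  have hk2 : (k : ℝ) ≤ osc r / ε + 1 := by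
    rw [hk]
    push_cast
    linarith [Nat.floor_le (div_nonneg (osc_nonneg r) hε.le)]
  have h1 := (h ((k : ℝ)⁻¹ • r) fun i => by
    rw [Pi.smul_apply, smul_eq_mul, abs_mul, abs_of_pos (inv_pos.2 hk0), inv_mul_le_iff₀ hk0]
    rw [div_lt_iff₀ hε] at hk1
    exact (abs_le_osc r i).trans hk1.le).pow k
  rw [← Subgroup.coe_pow, ← map_pow, ← ofAdd_nsmul, ← Nat.cast_smul_eq_nsmul ℝ, smul_smul,
    mul_inv_cancel₀ hk0.ne', one_smul] at h1
  refine ⟨k * m, ?_, h1⟩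
  have h2 : (k : ℝ) ≤ (ε⁻¹ + 1) * (osc r + 1) := by
    have := osc_nonneg r
    have h3 : (0 : ℝ) < ε⁻¹ := inv_pos.2 hε
    rw [div_eq_mul_inv] at hk2
    nlinarith
  push_cast
  calc (k : ℝ) * m ≤ (ε⁻¹ + 1) * (osc r + 1) * m := by gcongr
    _ = (ε⁻¹ + 1) * m * (osc r + 1) := by ring

end FragNorm

/-! ### The homomorphism from `ℝᴺ` and the lower bound by oscillation -/

section Homomorphism

variable {n : ℕ} {M : Type*} [TopologicalSpace M] [T2Space M] [ChartedSpace (Model n) M]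
  [IsManifold (𝓡 (2 * n)) ∞ M] {Ω : SymplecticForm n M} {f : M → ℝ} {φ : ℝ → Equiv.Perm M}
  {N : ℕ} (p : Fin N → Polynomial ℝ)

/-- The polynomial `∑ r_i p_i`. -/
noncomputable def combination (r : Fin N → ℝ) : Polynomial ℝ :=
  ∑ i, r i • p i

theorem combination_add (r s : Fin N → ℝ) :
    combination p (r + s) = combination p r + combination p s := by
  simp [combination, add_smul, Finset.sum_add_distrib]

theorem eval_combination (r : Fin N → ℝ) (x : ℝ) :
    (combination p r).eval x = ∑ i, r i * (p i).eval x := by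
  simp [combination, Polynomial.eval_finsetSum]

theorem combination_single (i : Fin N) (t : ℝ) : combination p (Pi.single i t) = t • p i := by
  rw [combination, Finset.sum_eq_single i (fun j _ hj => by rw [Pi.single_eq_of_ne hj, zero_smul])
    (fun h => absurd (Finset.mem_univ i) h), Pi.single_eq_same]

/-- The Hamiltonian isotopy of `g ∘ f` for a polynomial `g`. -/
theorem isHamIsotopy_shear_polynomial (hf : ContMDiff (𝓡 (2 * n)) 𝓘(ℝ, ℝ) ∞ f)
    (hφ : IsHamIsotopy Ω (fun _ => f) φ) (g : Polynomial ℝ) :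
    IsHamIsotopy Ω (fun _ x => g.eval (f x))
      (fun t => shear hf hφ fun s => t * g.derivative.eval s) :=
  isHamIsotopy_shear hf hφ fun s => g.hasDerivAt s

omit [T2Space M] [IsManifold (𝓡 (2 * n)) ∞ M] in
theorem contMDiff_polynomial_comp (hf : ContMDiff (𝓡 (2 * n)) 𝓘(ℝ, ℝ) ∞ f) (g : Polynomial ℝ) :
    ContMDiff (𝓡 (2 * n)) 𝓘(ℝ, ℝ) ∞ (fun x => g.eval (f x)) := by
  have h : ContDiff ℝ ∞ fun s : ℝ => g.eval s := by
    simpa only [Polynomial.coe_aeval_eq_eval] using! g.contDiff_aeval ∞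
  exact h.contMDiff.comp hf

omit [T2Space M] [IsManifold (𝓡 (2 * n)) ∞ M] in
theorem polynomial_comp_mem_periodicHam (hf : ContMDiff (𝓡 (2 * n)) 𝓘(ℝ, ℝ) ∞ f)
    {C : Set M} (hC : IsCompact C) (hfC : ∀ x ∉ C, f x = 0) {g : Polynomial ℝ}
    (hg : g.eval 0 = 0) : (fun _ x => g.eval (f x)) ∈ periodicHam n (univ : Set M) :=
  autonomous_mem_periodicHam (A := fun x => g.eval (f x)) (contMDiff_polynomial_comp hf g) hC
    fun x hx => by rw [hfC x hx, hg]

theorem shear_combination_add (hf : ContMDiff (𝓡 (2 * n)) 𝓘(ℝ, ℝ) ∞ f)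
    (hφ : IsHamIsotopy Ω (fun _ => f) φ) (r s : Fin N → ℝ) :
    (shear hf hφ fun x => (combination p (r + s)).derivative.eval x) =
      (shear hf hφ fun x => (combination p r).derivative.eval x) *
        shear hf hφ fun x => (combination p s).derivative.eval x := by
  rw [← shear_add]
  simp only [combination_add, Polynomial.derivative_add, Polynomial.eval_add]
  rfl

/-- The homomorphism sending `r` to the time-one map of `∑ r_i p_i ∘ f`. -/
noncomputable def shearHom (hf : ContMDiff (𝓡 (2 * n)) 𝓘(ℝ, ℝ) ∞ f)
    (hφ : IsHamIsotopy Ω (fun _ => f) φ) {C : Set M} (hC : IsCompact C) (hfC : ∀ x ∉ C, f x = 0)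
    (hp : ∀ i, (p i).eval 0 = 0) : Multiplicative (Fin N → ℝ) →* Ham Ω :=
  MonoidHom.mk' (fun r => ⟨shear hf hφ fun s => (combination p r.toAdd).derivative.eval s, by
    have h := apply_one_mem_Ham (polynomial_comp_mem_periodicHam hf hC hfC
      (g := combination p r.toAdd) (by simp [eval_combination, hp]))
      (isHamIsotopy_shear_polynomial hf hφ _)
    simpa only [one_mul] using h⟩) fun r s =>
    Subtype.ext (shear_combination_add p hf hφ r.toAdd s.toAdd)

theorem coe_shearHom (hf : ContMDiff (𝓡 (2 * n)) 𝓘(ℝ, ℝ) ∞ f)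
    (hφ : IsHamIsotopy Ω (fun _ => f) φ) {C : Set M} (hC : IsCompact C) (hfC : ∀ x ∉ C, f x = 0)
    (hp : ∀ i, (p i).eval 0 = 0) (r : Fin N → ℝ) :
    (shearHom p hf hφ hC hfC hp (Multiplicative.ofAdd r) : Equiv.Perm M) =
      shear hf hφ fun s => (combination p r).derivative.eval s := rfl

theorem isFragmented_shearHom_single [SecondCountableTopology M]
    (hf : ContMDiff (𝓡 (2 * n)) 𝓘(ℝ, ℝ) ∞ f)
    (hφ : IsHamIsotopy Ω (fun _ => f) φ) {C : Set M} (hC : IsCompact C) (hfC : ∀ x ∉ C, f x = 0)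
    (hp : ∀ i, (p i).eval 0 = 0) {Λ : Type*} {U : Λ → Set M} (hU : ∀ l, IsOpen (U l))
    (hUcover : ⋃ l, U l = univ) (i : Fin N) :
    ∃ m, ∃ ε > 0, ∀ t, |t| ≤ ε → IsFragmented Ω U m
      (shearHom p hf hφ hC hfC hp (Multiplicative.ofAdd (Pi.single i t)) : Equiv.Perm M) := by
  obtain ⟨m, ε, hε, h⟩ := exists_isFragmented (A := fun x => (p i).eval (f x)) hU hUcover
    (contMDiff_polynomial_comp hf (p i)) hC (fun x hx => by rw [hfC x hx, hp])
    (isHamIsotopy_shear_polynomial hf hφ (p i))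
  refine ⟨m, ε, hε, fun t ht => ?_⟩
  have := h t ht
  rw [coe_shearHom, combination_single]
  simpa only [Polynomial.derivative_smul, Polynomial.eval_smul, smul_eq_mul] using this

theorem meanValue_combination [MeasurableSpace M] [BorelSpace M] (Ω : SymplecticForm n M)
    (hvol : liouville Ω univ < ⊤) (hf : Continuous f) {C : Set M} (hC : IsCompact C)
    (hfC : ∀ x ∉ C, f x = 0) (hp : ∀ i, (p i).eval 0 = 0)
    (hmean : ∀ i, ∫ x, (p i).eval (f x) ∂(liouville Ω) = 0) (r : Fin N → ℝ) :
    meanValue Ω (fun _ x => (combination p r).eval (f x)) = 0 := by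
  have : IsFiniteMeasure (liouville Ω) := ⟨hvol⟩
  have h1 : ∫ x, (combination p r).eval (f x) ∂(liouville Ω) = 0 := by
    simp only [eval_combination]
    rw [integral_finsetSum _ fun i _ =>
      (integrable_polynomial_comp _ hf hC hfC (hp i)).const_mul (r i)]
    exact Finset.sum_eq_zero fun i _ => by rw [integral_const_mul, hmean, mul_zero]
  simp [meanValue, h1]

/-- If `L` is a decomposition of the image of `r` under `shearHom`, its length bounds the
oscillation of `r`. -/
theorem osc_le_of_prod_eq [MeasurableSpace M] [BorelSpace M]
    (hvol : liouville Ω univ < ⊤) {c : Fin (N + 1) → HamTilde Ω → ℝ}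
    (hsub : ∀ i, IsSubadditiveInvariant Ω (c i)) (hdesc : ∀ i, DescendsAsymptotically Ω (c i))
    {Λ : Type*} {U : Λ → Set M} {K : Fin (N + 1) → ℝ} (hK : ∀ i, 0 < K i)
    (hUK : ∀ i l, BoundedSpectrumWith Ω (c i) (U l) (K i)) {X : Fin (N + 1) → Set M}
    (hX : ∀ i, IsSuperheavy Ω (c i) (X i)) (hf : ContMDiff (𝓡 (2 * n)) 𝓘(ℝ, ℝ) ∞ f)
    (hφ : IsHamIsotopy Ω (fun _ => f) φ) {C : Set M} (hC : IsCompact C) (hfC : ∀ x ∉ C, f x = 0)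
    (hfX : ∀ j : Fin (N + 1), ∀ x ∈ X j, f x = (j : ℝ)) (hp : ∀ i, (p i).eval 0 = 0)
    (hpj : ∀ i, ∀ j : Fin (N + 1), (p i).eval (j : ℝ) = if j = i.succ then 1 else 0)
    (hmean : ∀ i, ∫ x, (p i).eval (f x) ∂(liouville Ω) = 0) (r : Fin N → ℝ)
    {L : List (Equiv.Perm M)} (hL : ∀ ψ ∈ L, ∃ l, ψ ∈ hamOn Ω (U l))
    (hLr : L.prod = shearHom p hf hφ hC hfC hp (Multiplicative.ofAdd r)) :
    osc r ≤ L.length * (2 * ∑ i, K i) := by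
  -- The value is computed on the lift given by the Hamiltonian of `r`, which is normalized and
  -- constant on `X j`; asymptotic descent transfers it to an arbitrary lift `g`.
  have hstab : ∀ (r : Fin N → ℝ) (g : HamTilde Ω), proj Ω g =
      shearHom p hf hφ hC hfC hp (Multiplicative.ofAdd r) →
      ∀ j, stab Ω (c j) g = (Fin.cons 0 r : Fin (N + 1) → ℝ) j := by
    intro r g hg j
    have hH := polynomial_comp_mem_periodicHam hf hC hfC
      (g := combination p r) (by simp [eval_combination, hp])
    have hiso := isHamIsotopy_shear_polynomial hf hφ (combination p r)
    have hval := (hX j).stab_eq hH hiso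
      (meanValue_combination p Ω hvol hf.continuous hC hfC hp hmean r)
      (r := (Fin.cons 0 r : Fin (N + 1) → ℝ) j) fun _ x hx => by
        simp only [eval_combination, hfX j x hx, hpj]
        cases j using Fin.cases with
        | zero => simp [(Fin.succ_ne_zero _).symm]
        | succ j => simp
    obtain ⟨s, hs⟩ := hdesc j
    rw [← hval, hs, hs, hg]
    congr 1
    refine Subtype.ext ?_
    rw [coe_proj_tildeOf, coe_shearHom]
    simp only [one_mul]
  obtain ⟨g, h, a, hg, hh, hle⟩ := exists_lifts_of_list hsub hK hUK L hL
  have hgr := hstab r g (Subtype.ext (hg.trans hLr))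
  -- The inverse of the image of `r` is the image of `-r`.
  have hhr := hstab (-r) h (Subtype.ext (by
    rw [hh, hLr, ofAdd_neg, map_inv, Subgroup.coe_inv]))
  have hneg : ∀ j, (Fin.cons 0 (-r) : Fin (N + 1) → ℝ) j =
      -(Fin.cons 0 r : Fin (N + 1) → ℝ) j := fun j => by
    cases j using Fin.cases <;> simp
  have hKsum : ∀ i, K i ≤ ∑ i, K i := fun i =>
    Finset.single_le_sum (fun j _ => (hK j).le) (Finset.mem_univ i)
  refine osc_le r fun i j => ?_
  -- The index `i` is used for the product and `j` for its inverse; the unknown `a` cancels in the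
  -- sum.
  have h1 := (hle i).1
  have h2 := (hle j).2
  rw [hgr] at h1
  rw [hhr, hneg] at h2
  have h3 := mul_le_mul_of_nonneg_left (add_le_add (hKsum i) (hKsum j))
    (Nat.cast_nonneg (α := ℝ) L.length)
  linarith

end Homomorphism

end HamFrag

/-! ### The main theorem -/

theorem theorem1p4 {n : ℕ} {M : Type*} [TopologicalSpace M] [T2Space M]
    [SecondCountableTopology M] [ConnectedSpace M] [ChartedSpace (HamFrag.Model n) M]
    [IsManifold (𝓡 (2 * n)) ∞ M] [MeasurableSpace M] [BorelSpace M]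
    (Ω : HamFrag.SymplecticForm n M) (hvol : HamFrag.liouville Ω univ < ⊤)
    {N : ℕ} (hN : 0 < N)
    (c : Fin (N + 1) → HamFrag.HamTilde Ω → ℝ)
    (hsub : ∀ i, HamFrag.IsSubadditiveInvariant Ω (c i))
    (hdesc : ∀ i, HamFrag.DescendsAsymptotically Ω (c i))
    {Λ : Type*} (U : Λ → Set M) (hUopen : ∀ l, IsOpen (U l)) (hUcover : ⋃ l, U l = univ)
    (hUspec : ∀ i, ∃ K : ℝ, 0 < K ∧ ∀ l, HamFrag.BoundedSpectrumWith Ω (c i) (U l) K)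
    (X : Fin (N + 1) → Set M) (hXcompact : ∀ i, IsCompact (X i))
    (hXdisj : Pairwise fun i j => Disjoint (X i) (X j))
    (hXheavy : ∀ i, HamFrag.IsSuperheavy Ω (c i) (X i)) :
    ∃ I : Multiplicative (Fin N → ℝ) →* HamFrag.Ham Ω,
      Function.Injective I ∧
      ∃ A : ℝ, 0 < A ∧ ∀ r : Fin N → ℝ, ∃ m : ℕ,
        HamFrag.fragNorm Ω U (I (Multiplicative.ofAdd r)) = m ∧
        A⁻¹ * HamFrag.osc r ≤ m ∧ (m : ℝ) ≤ A * (HamFrag.osc r + 1) := by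
  choose K hK hUK using hUspec
  obtain ⟨f, hf, ⟨C, hC, hfC⟩, hfX⟩ := HamFrag.exists_contMDiff_eq_on_compacts (n := n) hXcompact hXdisj
    fun j => ((j : ℕ) : ℝ)
  obtain ⟨φ, hφ⟩ := HamFrag.exists_isHamIsotopy Ω hf hC hfC
  have : IsFiniteMeasure (HamFrag.liouville Ω) := ⟨hvol⟩
  obtain ⟨x₀, hx₀⟩ := (hXheavy 0).nonempty
  -- Since `N ≥ 1` there is a set `X 1`; together with `X 0` it makes `f` take both values `0` and
  -- `1`.
  obtain ⟨x₁, hx₁⟩ := (hXheavy ⟨1, by omega⟩).nonempty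
  obtain ⟨p, hp⟩ := HamFrag.exists_dual_polynomials (HamFrag.liouville Ω)
    (fun V hV hne => HamFrag.liouville_ne_zero_of_isOpen Ω hV hne) hf.continuous hC hfC
    (x₀ := x₀) (x₁ := x₁) (by simpa using hfX 0 x₀ hx₀) (by simpa using hfX _ x₁ hx₁) N
  have hp0 : ∀ i, (p i).eval 0 = 0 := fun i => by
    have := (hp i).1 0
    rwa [if_neg (Fin.succ_ne_zero i).symm, Fin.val_zero, Nat.cast_zero] at this
  set I := HamFrag.shearHom p hf hφ hC hfC hp0 with hI
  have hlower : ∀ (r : Fin N → ℝ) (L : List (Equiv.Perm M)),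
      (∀ ψ ∈ L, ∃ l, ψ ∈ HamFrag.hamOn Ω (U l)) → L.prod = I (Multiplicative.ofAdd r) →
      HamFrag.osc r ≤ L.length * (2 * ∑ i, K i) := fun r L hL hLr =>
    HamFrag.osc_le_of_prod_eq p hvol hsub hdesc hK hUK hXheavy hf hφ hC hfC hfX hp0
      (fun i => (hp i).1) (fun i => (hp i).2) r hL hLr
  obtain ⟨A, hA, hupper⟩ := HamFrag.exists_isFragmented_le_osc (U := U) I
    (HamFrag.isFragmented_shearHom_single p hf hφ hC hfC hp0 hUopen hUcover)
  have hKsum : 0 ≤ ∑ i, K i := Finset.sum_nonneg fun i _ => (hK i).le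
  -- One constant serves both bounds: it dominates `2 ∑ K_i` from below and `A` from above, and the
  -- summand `1` makes it positive.
  refine ⟨I, (injective_iff_map_eq_one I).2 fun r hr => ?_, 2 * ∑ i, K i + A + 1, by positivity,
    fun r => ?_⟩
  -- If `r` maps to the identity, the empty decomposition forces the oscillation of `r` to vanish.
  · have h1 := hlower r.toAdd [] (by simp) (by rw [ofAdd_toAdd, hr]; rfl)
    refine Multiplicative.toAdd.injective (funext fun i => abs_nonpos_iff.1 ?_)
    simpa using (HamFrag.abs_le_osc r.toAdd i).trans h1
  · obtain ⟨m, hm, hfrag⟩ := hupper r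
    obtain ⟨L, hL, hLr, hnorm, hLm⟩ := hfrag.exists_fragNorm_eq
    have hosc := HamFrag.osc_nonneg r
    have hLm' : (L.length : ℝ) ≤ m := by exact_mod_cast hLm
    refine ⟨L.length, hnorm, ?_, ?_⟩
    · rw [inv_mul_le_iff₀ (by positivity)]
      have h1 := hlower r L hL hLr
      have h2 : (0 : ℝ) ≤ L.length := Nat.cast_nonneg _
      nlinarith [mul_nonneg h2 hA]
    · nlinarith [mul_nonneg hKsum hosc]
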